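/- For an $n$-dimensional pseudo-Riemannian manifold $(M,g)$, let the isometric embedding class be the smallest integer $k\ge 0$ such that there is a smooth isometric embedding $\iota:M\to\mathbb{R}^{r,s}$, $\iota^*\eta=g$, for some $r+s=n+k$, where $\mathbb{R}^{r,s}$ is $\mathbb{R}^{r+s}$ with the flat metric $\eta$ of signature $(r,s)$ (the class is $\infty$ if there is no such $k$). None of the following has isometric embedding class $2$; in fact the class of each of them is greater than $2$. (a) $\mathbb{CP}^2$, or any nonempty open subset of it, with the Fubini–Study metric induced by $\operatorname{Re}\big(|Z|^2|dZ|^2-|\langle Z,dZ\rangle|^2\big)/|Z|^4$ on $\mathbb{C}^3\setminus\{0\}$. (b) The Kerr solution, Lorentzian or Riemannian, with parameters $m\neq0$, $a\neq0$: that is, any four-manifold $(M,g)$ some nonempty part of which is parametrized by coordinates $(t,r,\theta,\varphi)$, ranging over a nonempty open subset of $\mathbb{R}^4$ with $\sin\theta\neq0$, in which $$g=-\frac{\Delta}{\Sigma}(dt-a\sin^2\theta\,d\varphi)^2+\frac{\sin^2\theta}{\Sigma}\big((r^2+a^2)d\varphi-a\,dt\big)^2+\frac{\Sigma}{\Delta}dr^2+\Sigma\,d\theta^2,$$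 with $\Sigma=r^2+a^2\cos^2\theta\neq0$ and $\Delta=r^2-2mr+a^2\neq0$; or, in the Riemannian case, coordinates $(\tau,r,\theta,\varphi)$ in which $$g=\frac{\Delta}{\Sigma}(d\tau-a\sin^2\theta\,d\varphi)^2+\frac{\sin^2\theta}{\Sigma}\big((r^2-a^2)d\varphi+a\,d\tau\big)^2+\frac{\Sigma}{\Delta}dr^2+\Sigma\,d\theta^2,$$ with $\Sigma=r^2-a^2\cos^2\theta>0$ and $\Delta=r^2-2mr-a^2>0$. (c) A hyper-Kähler four-manifold $(M,g)$, or an open subset of it, on which $J$ is not identically zero. Here $J=\psi_{AB}{}^{CD}\psi_{CD}{}^{EF}\psi_{EF}{}^{AB}$ for the anti-self-dual Weyl spinor $\psi$ (with respect to the orientation given by the complex structures); equivalently, $J=\operatorname{tr}(W_-^3)$, where $W_-$ is the restriction of the Weyl curvature operator $F_{ab}\mapsto\frac12C_{ab}{}^{cd}F_{cd}$ to anti-self-dual two-forms. -/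

import Mathlib

open Set Module
open scoped Manifold ContDiff

noncomputable section

/-! ### Metrics, isometric embeddings and the embedding class -/

/-- A field of bilinear forms on the tangent spaces of a manifold `M` modelled on `E`
(a metric tensor, once further conditions are imposed). -/
abbrev MetricField (E : Type*) [NormedAddCommGroup E] [NormedSpace ℝ E]
    (M : Type*) [TopologicalSpace M] [ChartedSpace E M] :=
  ∀ x : M, LinearMap.BilinForm ℝ (TangentSpace 𝓘(ℝ, E) x)

/-- The underlying vector space of the pseudo-Euclidean space `ℝ^{r,s}`. -/
abbrev PseudoEuclidean (r s : ℕ) := (Fin r → ℝ) × (Fin s → ℝ)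

/-- The flat metric of signature `(r, s)` on `ℝ^{r,s}`. -/
def pseudoEuclideanForm {r s : ℕ} (v w : PseudoEuclidean r s) : ℝ :=
  ∑ i, v.1 i * w.1 i - ∑ j, v.2 j * w.2 j

/-- `ι` restricts to a smooth isometric embedding of the open submanifold `U` of `(M, g)` into
`ℝ^{r,s}`: it is smooth on `U`, a homeomorphism from `U` onto its image, and pulls the flat metric
back to `g`. (It is then an immersion wherever `g` is nondegenerate.) -/
structure IsIsometricEmbeddingOn {E : Type*} [NormedAddCommGroup E] [NormedSpace ℝ E]
    {M : Type*} [TopologicalSpace M] [ChartedSpace E M] (g : MetricField E M) (U : Set M)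
    {r s : ℕ} (ι : M → PseudoEuclidean r s) : Prop where
  contMDiffOn : ContMDiffOn 𝓘(ℝ, E) 𝓘(ℝ, PseudoEuclidean r s) ∞ ι U
  isEmbedding : Topology.IsEmbedding (U.domRestrict ι)
  isometric : ∀ x ∈ U, ∀ v w : TangentSpace 𝓘(ℝ, E) x,
    pseudoEuclideanForm
      (mfderiv 𝓘(ℝ, E) 𝓘(ℝ, PseudoEuclidean r s) ι x v : PseudoEuclidean r s)
      (mfderiv 𝓘(ℝ, E) 𝓘(ℝ, PseudoEuclidean r s) ι x w : PseudoEuclidean r s) = g x v w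

/-- The isometric embedding class of the open submanifold `U` of `(M, g)`: the smallest `k` such
that `(U, g)` embeds isometrically into some `ℝ^{r,s}` with `r + s = dim M + k` (`⊤` if there is no
such `k`). The class of `(M, g)` itself is the case `U = univ`. -/
def isometricEmbeddingClass {E : Type*} [NormedAddCommGroup E] [NormedSpace ℝ E]
    {M : Type*} [TopologicalSpace M] [ChartedSpace E M] (g : MetricField E M) (U : Set M) : ℕ∞ :=
  sInf ((fun k : ℕ => (k : ℕ∞)) '' {k : ℕ | ∃ r s : ℕ, r + s = finrank ℝ E + k ∧
    ∃ ι : M → PseudoEuclidean r s, IsIsometricEmbeddingOn g U ι})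

/-! ### The complex projective plane and its Fubini-Study metric -/

/-- The complex projective plane. -/
def CP2 := Projectivization ℂ (Fin 3 → ℂ)

namespace CP2

/-- The point `[Z]` with homogeneous coordinates `Z`. -/
def mk (Z : Fin 3 → ℂ) (hZ : Z ≠ 0) : CP2 := Projectivization.mk ℂ Z hZ

/-- The affine coordinates `(Z_j / Z_i)_{j ≠ i}` of the point `[Z]`. -/
def affine (i : Fin 3) (p : CP2) : Fin 2 → ℂ :=
  Projectivization.lift
    (fun (Z : {Z : Fin 3 → ℂ // Z ≠ 0}) (j : Fin 2) => Z.1 (i.succAbove j) / Z.1 i) (by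
    rintro ⟨a, ha⟩ ⟨b, hb⟩ t h
    obtain rfl : a = t • b := h
    have ht : t ≠ 0 := by rintro rfl; exact ha (zero_smul _ _)
    funext j
    simp [mul_div_mul_left _ _ ht]) p

/-- The set of points `[Z]` with `Z_i ≠ 0`. -/
def affineDomain (i : Fin 3) : Set CP2 := {p | (Projectivization.rep p) i ≠ 0}

/-- The homogeneous coordinates `Z` with `Z_i = 1` and the other coordinates given by `z`. -/
def homogenize (i : Fin 3) (z : Fin 2 → ℂ) : Fin 3 → ℂ := i.insertNth 1 z

lemma homogenize_self (i : Fin 3) (z : Fin 2 → ℂ) : homogenize i z i = 1 := by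
  simp [homogenize]

lemma homogenize_succAbove (i : Fin 3) (z : Fin 2 → ℂ) (j : Fin 2) :
    homogenize i z (i.succAbove j) = z j := by
  simp [homogenize]

lemma homogenize_ne_zero (i : Fin 3) (z : Fin 2 → ℂ) : homogenize i z ≠ 0 := fun h => by
  have := congrFun h i
  simp [homogenize_self] at this

lemma mk_mem_affineDomain (i : Fin 3) (Z : Fin 3 → ℂ) (hZ : Z ≠ 0) :
    mk Z hZ ∈ affineDomain i ↔ Z i ≠ 0 := by
  obtain ⟨a, ha⟩ := Projectivization.exists_smul_eq_mk_rep ℂ Z hZ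
  have : (Projectivization.rep (mk Z hZ)) i = a * Z i := by
    change (Projectivization.mk ℂ Z hZ).rep i = _
    rw [← ha]; rfl
  simp [affineDomain, this]

lemma affine_mk (i : Fin 3) (Z : Fin 3 → ℂ) (hZ : Z ≠ 0) (j : Fin 2) :
    affine i (mk Z hZ) j = Z (i.succAbove j) / Z i := rfl

/-- The affine chart `[Z] ↦ (Z_j / Z_i)_{j ≠ i}`, defined where `Z_i ≠ 0`. -/
def affineEquiv (i : Fin 3) : PartialEquiv CP2 (Fin 2 → ℂ) where
  toFun := affine i
  invFun z := mk (homogenize i z) (homogenize_ne_zero i z)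
  source := affineDomain i
  target := univ
  map_source' _ _ := mem_univ _
  map_target' z _ := by
    rw [mk_mem_affineDomain, homogenize_self]; exact one_ne_zero
  left_inv' p hp := by
    induction p using Projectivization.ind with
    | h Z hZ =>
      have hi : Z i ≠ 0 := (mk_mem_affineDomain i Z hZ).1 hp
      refine (Projectivization.mk_eq_mk_iff' ℂ _ _ _ _).2 ⟨(Z i)⁻¹, ?_⟩
      funext k
      refine Fin.succAboveCases i ?_ (fun j => ?_) k
      · simp [homogenize_self, hi]
      · rw [homogenize_succAbove]
        change _ = Z (i.succAbove j) / Z i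
        simp [div_eq_inv_mul]
  right_inv' z _ := by
    funext j
    rw [affine_mk, homogenize_succAbove, homogenize_self, div_one]

lemma exists_mem_affineDomain (p : CP2) : ∃ i, p ∈ affineDomain i := by
  by_contra! h
  refine Projectivization.rep_nonzero p (funext fun i => ?_)
  by_contra hi
  exact h i hi

/-- An index `i` with `Z_i ≠ 0` at the given point. -/
def pivot (p : CP2) : Fin 3 := (exists_mem_affineDomain p).choose

lemma mem_affineDomain_pivot (p : CP2) : p ∈ affineDomain (pivot p) :=
  (exists_mem_affineDomain p).choose_spec

lemma contDiff_homogenize (i k : Fin 3) : ContDiff ℝ ∞ fun z => homogenize i z k := by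
  refine Fin.succAboveCases i ?_ (fun j => ?_) k
  · simp only [homogenize_self]; exact contDiff_const
  · simp only [homogenize_succAbove]; exact contDiff_apply ℝ ℂ j

lemma transition_source (i i' : Fin 3) :
    ((affineEquiv i).symm.trans (affineEquiv i')).source = {z | homogenize i z i' ≠ 0} := by
  ext z
  simp only [PartialEquiv.trans_source, PartialEquiv.symm_source, mem_inter_iff, mem_preimage,
    mem_ofPred_eq]
  exact ⟨fun h => (mk_mem_affineDomain i' _ _).1 h.2,
    fun h => ⟨mem_univ _, (mk_mem_affineDomain i' _ (homogenize_ne_zero i z)).2 h⟩⟩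

lemma contDiffOn_transition (i i' : Fin 3) :
    ContDiffOn ℝ ∞ ((affineEquiv i).symm.trans (affineEquiv i'))
      ((affineEquiv i).symm.trans (affineEquiv i')).source := by
  rw [transition_source]
  refine contDiffOn_pi.2 fun j => ?_
  change ContDiffOn ℝ ∞ (fun z => homogenize i z (i'.succAbove j) / homogenize i z i') _
  simp only [div_eq_mul_inv]
  exact (contDiff_homogenize i _).contDiffOn.mul
    ((contDiff_homogenize i i').contDiffOn.inv fun _ hz => hz)

/-- The three affine charts, and the complex projective plane as glued from them. -/
def chartedSpaceCore : ChartedSpaceCore (Fin 2 → ℂ) CP2 where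
  atlas := range affineEquiv
  chartAt p := affineEquiv (pivot p)
  mem_chart_source := mem_affineDomain_pivot
  chart_mem_atlas p := ⟨pivot p, rfl⟩
  open_source := by
    rintro _ _ ⟨i, rfl⟩ ⟨i', rfl⟩
    rw [transition_source]
    exact isOpen_ne_fun (contDiff_homogenize i i').continuous continuous_const
  continuousOn_toFun := by
    rintro _ _ ⟨i, rfl⟩ ⟨i', rfl⟩
    exact (contDiffOn_transition i i').continuousOn

instance : TopologicalSpace CP2 := chartedSpaceCore.toTopologicalSpace

instance : ChartedSpace (Fin 2 → ℂ) CP2 := chartedSpaceCore.toChartedSpace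

instance : IsManifold 𝓘(ℝ, Fin 2 → ℂ) ∞ CP2 := by
  refine isManifold_of_contDiffOn _ _ _ ?_
  rintro e e' he he'
  obtain ⟨f, hf, rfl⟩ : ∃ f, ∃ hf : f ∈ chartedSpaceCore.atlas,
      e = chartedSpaceCore.openPartialHomeomorph f hf := by
    obtain ⟨f, hf, h⟩ := mem_iUnion₂.1 he
    exact ⟨f, hf, h⟩
  obtain ⟨f', hf', rfl⟩ : ∃ f', ∃ hf' : f' ∈ chartedSpaceCore.atlas,
      e' = chartedSpaceCore.openPartialHomeomorph f' hf' := by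
    obtain ⟨f', hf', h⟩ := mem_iUnion₂.1 he'
    exact ⟨f', hf', h⟩
  obtain ⟨i, rfl⟩ := hf
  obtain ⟨i', rfl⟩ := hf'
  exact (contDiffOn_transition i i').mono fun z hz => hz.1

/-- The Hermitian form of the Fubini-Study line element
`(|Z|² |dZ|² - |⟨Z, dZ⟩|²) / |Z|⁴` on `ℂ³ \ {0}`, as a real bilinear form. -/
def fubiniStudyForm (Z : Fin 3 → ℂ) : LinearMap.BilinForm ℝ (Fin 3 → ℂ) :=
  LinearMap.mk₂ ℝ
    (fun V W => (((star Z ⬝ᵥ Z) * (star V ⬝ᵥ W) - (star V ⬝ᵥ Z) * (star Z ⬝ᵥ W)) /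
      (star Z ⬝ᵥ Z) ^ 2).re)
    (fun V V' W => by
      rw [← Complex.add_re]; congr 1; simp only [star_add, add_dotProduct]; ring)
    (fun c V W => by
      have h : star (c • V) = (c : ℂ) • star V := by
        ext i; simp
      simp only [h, smul_dotProduct, smul_eq_mul]
      rw [← Complex.re_ofReal_mul]; congr 1; ring)
    (fun V W W' => by
      rw [← Complex.add_re]; congr 1; simp only [dotProduct_add]; ring)
    (fun c V W => by
      have h : c • W = (c : ℂ) • W := by
        ext i; simp
      simp only [h, dotProduct_smul, smul_eq_mul]
      rw [← Complex.re_ofReal_mul]; congr 1; ring)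

/-- The local section `[Z] ↦ Z / Z_i` of the projection `ℂ³ \ {0} → CP²`. -/
def homogeneousLift (i : Fin 3) (p : CP2) : Fin 3 → ℂ := homogenize i (affine i p)

/-- The Fubini-Study metric on the complex projective plane: the form on `ℂ³ \ {0}`, which is
horizontal and invariant under rescaling, pulled back by a local section of the projection. -/
def fubiniStudy : MetricField (Fin 2 → ℂ) CP2 := fun p =>
  let L : TangentSpace 𝓘(ℝ, Fin 2 → ℂ) p →L[ℝ] (Fin 3 → ℂ) :=
    mfderiv 𝓘(ℝ, Fin 2 → ℂ) 𝓘(ℝ, Fin 3 → ℂ) (homogeneousLift (pivot p)) p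
  (fubiniStudyForm (homogeneousLift (pivot p) p)).compl₁₂ L.toLinearMap L.toLinearMap

end CP2

/-! ### The Kerr metrics -/

/-- The coordinate space `ℝ⁴`. -/
abbrev Coord4 := EuclideanSpace ℝ (Fin 4)

/-- The coordinate one-form `dx^i` on `ℝ⁴`. -/
def coordForm (i : Fin 4) : Coord4 →ₗ[ℝ] ℝ := (EuclideanSpace.proj i : Coord4 →L[ℝ] ℝ).toLinearMap

/-- The square `α²` of a one-form `α`, as a symmetric bilinear form. -/
def formSq (α : Coord4 →ₗ[ℝ] ℝ) : LinearMap.BilinForm ℝ Coord4 := α.smulRight α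

/-- The Lorentzian Kerr metric with mass `m` and rotation parameter `a`, of signature `(3, 1)`, in
Boyer-Lindquist coordinates `(x 0, x 1, x 2, x 3) = (t, r, θ, φ)`. -/
def lorentzianKerr (m a : ℝ) (x : Coord4) : LinearMap.BilinForm ℝ Coord4 :=
  let r := x 1
  let S := r ^ 2 + a ^ 2 * Real.cos (x 2) ^ 2
  let D := r ^ 2 - 2 * m * r + a ^ 2
  (-(D / S)) • formSq (coordForm 0 - (a * Real.sin (x 2) ^ 2) • coordForm 3)
    + (Real.sin (x 2) ^ 2 / S) • formSq ((r ^ 2 + a ^ 2) • coordForm 3 - a • coordForm 0)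
    + (S / D) • formSq (coordForm 1) + S • formSq (coordForm 2)

/-- The points at which the coordinate expression of the Lorentzian Kerr metric is regular:
off the ring singularity, the horizons and the axis. -/
def lorentzianKerrDomain (m a : ℝ) : Set Coord4 :=
  {x | x 1 ^ 2 + a ^ 2 * Real.cos (x 2) ^ 2 ≠ 0 ∧ x 1 ^ 2 - 2 * m * x 1 + a ^ 2 ≠ 0 ∧
    Real.sin (x 2) ≠ 0}

/-- The Riemannian Kerr metric with parameters `m` and `a` (the continuation `t = iτ`, `a ↦ ia` of
the Lorentzian one), in coordinates `(x 0, x 1, x 2, x 3) = (τ, r, θ, φ)`. -/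
def riemannianKerr (m a : ℝ) (x : Coord4) : LinearMap.BilinForm ℝ Coord4 :=
  let r := x 1
  let S := r ^ 2 - a ^ 2 * Real.cos (x 2) ^ 2
  let D := r ^ 2 - 2 * m * r - a ^ 2
  (D / S) • formSq (coordForm 0 - (a * Real.sin (x 2) ^ 2) • coordForm 3)
    + (Real.sin (x 2) ^ 2 / S) • formSq ((r ^ 2 - a ^ 2) • coordForm 3 + a • coordForm 0)
    + (S / D) • formSq (coordForm 1) + S • formSq (coordForm 2)

/-- The points at which the coordinate expression of the Riemannian Kerr metric is regular and
positive definite. -/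
def riemannianKerrDomain (m a : ℝ) : Set Coord4 :=
  {x | 0 < x 1 ^ 2 - a ^ 2 * Real.cos (x 2) ^ 2 ∧ 0 < x 1 ^ 2 - 2 * m * x 1 - a ^ 2 ∧
    Real.sin (x 2) ≠ 0}

/-- Some nonempty part of the open submanifold `U` of the four-manifold `(M, g)` is parametrized by
coordinates, ranging over a nonempty open subset `V` of `D`, in which `g` is given by `h`.
(Parametrizations need not be injective, so that an angular coordinate may cover a circle. Where
`h` is nondegenerate they are local diffeomorphisms.) -/
def HasCoordinateRegion {M : Type*} [TopologicalSpace M] [ChartedSpace Coord4 M]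
    (g : MetricField Coord4 M) (U : Set M)
    (h : Coord4 → LinearMap.BilinForm ℝ Coord4) (D : Set Coord4) : Prop :=
  ∃ V : Set Coord4, IsOpen V ∧ V.Nonempty ∧ V ⊆ D ∧ ∃ ψ : Coord4 → M,
    MapsTo ψ V U ∧ ContMDiffOn 𝓘(ℝ, Coord4) 𝓘(ℝ, Coord4) ∞ ψ V ∧
    ∀ x ∈ V, ∀ v w : Coord4,
      g (ψ x) (mfderiv 𝓘(ℝ, Coord4) 𝓘(ℝ, Coord4) ψ x v)
        (mfderiv 𝓘(ℝ, Coord4) 𝓘(ℝ, Coord4) ψ x w) = h x v w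

/-! ### Curvature in coordinates -/

/-- The partial derivative `∂_i f`. -/
def partialDeriv (i : Fin 4) (f : Coord4 → ℝ) (y : Coord4) : ℝ :=
  fderiv ℝ f y (EuclideanSpace.single i 1)

/-- The Christoffel symbols `Γ^k_{ij}` of the metric with component matrix `G`. -/
def christoffel (G : Coord4 → Matrix (Fin 4) (Fin 4) ℝ) (k i j : Fin 4) (y : Coord4) : ℝ :=
  (1 / 2) * ∑ l, (G y)⁻¹ k l * (partialDeriv i (fun z => G z l j) y
    + partialDeriv j (fun z => G z i l) y - partialDeriv l (fun z => G z i j) y)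

/-- The Riemann tensor `R^a_{bcd}`, with the convention
`R^a_{bcd} v^b = (∇_c ∇_d - ∇_d ∇_c) v^a`. -/
def riemannUp (G : Coord4 → Matrix (Fin 4) (Fin 4) ℝ) (a b c d : Fin 4) (y : Coord4) : ℝ :=
  partialDeriv c (christoffel G a d b) y - partialDeriv d (christoffel G a c b) y
    + ∑ e, (christoffel G a c e y * christoffel G e d b y
      - christoffel G a d e y * christoffel G e c b y)

/-- The Riemann tensor `R_{abcd}`. -/
def riemann (G : Coord4 → Matrix (Fin 4) (Fin 4) ℝ) (a b c d : Fin 4) (y : Coord4) : ℝ :=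
  ∑ e, G y a e * riemannUp G e b c d y

/-- The Ricci tensor `R_{bd} = R^a_{bad}`. -/
def ricci (G : Coord4 → Matrix (Fin 4) (Fin 4) ℝ) (b d : Fin 4) (y : Coord4) : ℝ :=
  ∑ a, riemannUp G a b a d y

/-- The scalar curvature. -/
def scalarCurvature (G : Coord4 → Matrix (Fin 4) (Fin 4) ℝ) (y : Coord4) : ℝ :=
  ∑ b, ∑ d, (G y)⁻¹ b d * ricci G b d y

/-- The Weyl tensor `C_{abcd}` in dimension four. -/
def weyl (G : Coord4 → Matrix (Fin 4) (Fin 4) ℝ) (a b c d : Fin 4) (y : Coord4) : ℝ :=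
  riemann G a b c d y
    - (1 / 2) * (G y a c * ricci G b d y - G y a d * ricci G b c y
      - G y b c * ricci G a d y + G y b d * ricci G a c y)
    + scalarCurvature G y / 6 * (G y a c * G y b d - G y a d * G y b c)

/-- The operator `F_{ab} ↦ ½ T_{ab}^{cd} F_{cd}`, where `A` is the inverse metric and
`T_{abcd}` is antisymmetric in `ab` and in `cd`. Its image consists of two-forms. -/
def twoFormOperator (A : Matrix (Fin 4) (Fin 4) ℝ) (T : Fin 4 → Fin 4 → Fin 4 → Fin 4 → ℝ) :
    Matrix (Fin 4 × Fin 4) (Fin 4 × Fin 4) ℝ :=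
  Matrix.of fun p q => (1 / 2) * ∑ c, ∑ d, T p.1 p.2 c d * A c q.1 * A d q.2

/-- The invariant `J = ψ_{AB}^{CD} ψ_{CD}^{EF} ψ_{EF}^{AB}` of the anti-self-dual Weyl spinor
of the metric with component matrix `G`, with respect to the volume form `ε`. The Weyl tensor acts
on two-forms by `F_{ab} ↦ ½ C_{ab}^{cd} F_{cd}`. Its part on anti-self-dual two-forms is
`½ (1 - ⋆) W`; these two-forms are the symmetric spinors `φ_{AB}`, on which it acts by
`φ_{AB} ↦ ψ_{AB}^{CD} φ_{CD}`. So `J` is the trace of the cube of that part. -/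
def weylInvariantJ (G : Coord4 → Matrix (Fin 4) (Fin 4) ℝ) (ε : Fin 4 → Fin 4 → Fin 4 → Fin 4 → ℝ)
    (y : Coord4) : ℝ :=
  let W := twoFormOperator (G y)⁻¹ fun a b c d => weyl G a b c d y
  let star := twoFormOperator (G y)⁻¹ ε
  ((((1 / 2 : ℝ) • (W - star * W)) ^ 3).trace)

/-! ### Hyper-Kähler four-manifolds -/

section HyperKahler

variable {M : Type*} [TopologicalSpace M] [ChartedSpace Coord4 M]

/-- A field of endomorphisms of the tangent spaces. -/
abbrev EndomorphismField (M : Type*) [TopologicalSpace M] [ChartedSpace Coord4 M] :=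
  ∀ x : M, TangentSpace 𝓘(ℝ, Coord4) x →ₗ[ℝ] TangentSpace 𝓘(ℝ, Coord4) x

/-- The coordinate vector `∂_i` of the chart `e`, at the point with coordinates `y`. -/
def coordVector (e : OpenPartialHomeomorph M Coord4) (y : Coord4) (i : Fin 4) :
    TangentSpace 𝓘(ℝ, Coord4) (e.symm y) :=
  mfderiv 𝓘(ℝ, Coord4) 𝓘(ℝ, Coord4) e.symm y (EuclideanSpace.single i (1 : ℝ) : Coord4)

/-- The components `g_{ij}` of a metric in the chart `e`. -/
def metricMatrix (g : MetricField Coord4 M) (e : OpenPartialHomeomorph M Coord4) (y : Coord4) :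
    Matrix (Fin 4) (Fin 4) ℝ :=
  Matrix.of fun i j => g (e.symm y) (coordVector e y i) (coordVector e y j)

/-- The components `I^k_j` in the chart `e` of a field of endomorphisms `I`, with
`I ∂_j = I^k_j ∂_k`. -/
def endoMatrix (I : EndomorphismField M) (e : OpenPartialHomeomorph M Coord4) (y : Coord4) :
    Matrix (Fin 4) (Fin 4) ℝ :=
  Matrix.of fun k j =>
    let w : Coord4 :=
      mfderiv 𝓘(ℝ, Coord4) 𝓘(ℝ, Coord4) e (e.symm y) (I (e.symm y) (coordVector e y j))
    w k

/-- `g` is a hyper-Kähler metric on the four-manifold `M`, with complex structures `I 0, I 1, I 2`: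
a smooth Riemannian metric, Hermitian with respect to three smooth almost complex structures which
satisfy the quaternion relations and are parallel for the Levi-Civita connection. -/
structure IsHyperKahler (g : MetricField Coord4 M) (I : Fin 3 → EndomorphismField M) : Prop where
  smooth_metric : ∀ e ∈ atlas Coord4 M, ∀ i j,
    ContDiffOn ℝ ∞ (fun y => metricMatrix g e y i j) e.target
  symm : ∀ x v w, g x v w = g x w v
  pos : ∀ x v, v ≠ 0 → 0 < g x v v
  smooth_complex : ∀ n, ∀ e ∈ atlas Coord4 M, ∀ k j,
    ContDiffOn ℝ ∞ (fun y => endoMatrix (I n) e y k j) e.target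
  sq : ∀ n x v, I n x (I n x v) = -v
  mul : ∀ x v, I 0 x (I 1 x v) = I 2 x v
  hermitian : ∀ n x v w, g x (I n x v) (I n x w) = g x v w
  parallel : ∀ n, ∀ e ∈ atlas Coord4 M, ∀ y ∈ e.target, ∀ i k j,
    partialDeriv i (fun z => endoMatrix (I n) e z k j) y
      + ∑ l, (christoffel (metricMatrix g e) k i l y * endoMatrix (I n) e y l j
        - christoffel (metricMatrix g e) l i j y * endoMatrix (I n) e y k l) = 0

/-- The components `ω_{ij} = g(I ∂_i, ∂_j)` of the fundamental two-form. -/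
def kahlerForm (g : MetricField Coord4 M) (I : EndomorphismField M)
    (e : OpenPartialHomeomorph M Coord4) (y : Coord4) (i j : Fin 4) : ℝ :=
  ∑ k, endoMatrix I e y k i * metricMatrix g e y k j

/-- The components of `½ ω ∧ ω`, the Riemannian volume form of the orientation defined by the
almost complex structure `I`. -/
def complexVolume (g : MetricField Coord4 M) (I : EndomorphismField M)
    (e : OpenPartialHomeomorph M Coord4) (y : Coord4) (a b c d : Fin 4) : ℝ :=
  kahlerForm g I e y a b * kahlerForm g I e y c d
    - kahlerForm g I e y a c * kahlerForm g I e y b d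
    + kahlerForm g I e y a d * kahlerForm g I e y b c

/-- The invariant `J` at the point `p` of a hyper-Kähler four-manifold, for the orientation given by
its complex structures (for which the metric is anti-self-dual). -/
def hyperKahlerJ (g : MetricField Coord4 M) (I : Fin 3 → EndomorphismField M) (p : M) : ℝ :=
  weylInvariantJ (metricMatrix g (chartAt Coord4 p))
    (complexVolume g (I 0) (chartAt Coord4 p) (chartAt Coord4 p p)) (chartAt Coord4 p p)

end HyperKahler

end

noncomputable section

/-! ### Algebraic curvature tensors of the form given by the Gauss equation in codimension two -/

/-! If the class were at most 2, a piece of the manifold would lie in a flat space of dimension at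
most 6. The Gauss equation would then write its curvature at each point as `R = ε₁ H₁∧H₁ + ε₂
H₂∧H₂`, where an `ε` may vanish (`exists_isGaussTensor`). Nothing else about the embedding is used;
the Codazzi and Ricci equations play no role. The proof is therefore pointwise algebra: find one
point whose curvature tensor is not of this form (`two_lt_isometricEmbeddingClass`).

Let `S₁, S₂` be the shape operators and `F = S₁S₂ - S₂S₁`. The Pontryagin density of `R` is a
multiple of the Pfaffian of the normal curvature (`pontryagin_eq`), so `F` is invertible where that
density is nonzero. If the metric is Einstein with constant `l`, bracketing the Einstein equation
with `S₁` gives `S₂F + FS₂ = tr(S₂) F`. Multiplying by `F⁻¹` and taking traces forces `tr S₂ = 0`,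
and the same holds with the roles exchanged. Both operators thus anticommute with `F`, and `F` is an
eigenvector of the curvature operator `w ↦ ε₁S₁wS₁ + ε₂S₂wS₂` with eigenvalue `l`
(`IsGaussTensor.exists_anticommute`, `curvature_normal`).

Kerr: here `l = 0`, but at a generic point the curvature operator is injective, because the type D
invariants do not degenerate (`not_isGaussTensor_of_ricci_eq_zero`, `kerr_isTypeD`).

In the two Riemannian cases the `l`-eigenvectors commuting with `F` are the multiples of `F`. A
symmetric `Q` commuting with `S₁`, `S₂` is then scalar, since `FQ` is again such an eigenvector.
Hence `S₁² = q ≠ 0` and `S₁S₂ + S₂S₁` are scalars, `S₂` is determined by `S₁` and `F`, and on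
matrices commuting with `F` the operator is `-(l/q) S₁wS₁` (`curvature_eq_of_eigenspace`).

For `CP²`, `l = 6` and `F` is a multiple of the complex structure. An anti-self-dual `w` has
eigenvalue 2, so `S₁wS₁ = -(q/3) w`; conjugating twice gives `q² = q²/9`. For hyper-Kähler metrics,
`l = 0` and the curvature operator is given by a matrix `ψ` on anti-self-dual forms and is zero on
self-dual ones. `J` is `24 det ψ` (`weylInvariantJ_eq`). If `det ψ ≠ 0` then `F` is self-dual, so it
commutes with the anti-self-dual forms and the operator must vanish on them, a contradiction. -/

/-- The tensor `R` is the curvature tensor which the Gauss equation attaches to the symmetric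
second fundamental forms `H₁, H₂` of two orthogonal normal directions, of square norms `ε₁, ε₂`. -/
structure IsGaussTensor (R : Fin 4 → Fin 4 → Fin 4 → Fin 4 → ℝ) (ε₁ ε₂ : ℝ)
    (H₁ H₂ : Matrix (Fin 4) (Fin 4) ℝ) : Prop where
  symm₁ : ∀ a b, H₁ a b = H₁ b a
  symm₂ : ∀ a b, H₂ a b = H₂ b a
  eq : ∀ a b c d, R a b c d = ε₁ * (H₁ a c * H₁ b d - H₁ a d * H₁ b c)
    + ε₂ * (H₂ a c * H₂ b d - H₂ a d * H₂ b c)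

/-- The contraction `g^{ae} g^{bf} R_{abcd} R_{efgh}`, antisymmetrized in `cdgh`, for the diagonal
inverse metric `A`: the first Pontryagin density. -/
def pontryagin (A : Fin 4 → ℝ) (R : Fin 4 → Fin 4 → Fin 4 → Fin 4 → ℝ) : ℝ :=
  ∑ a, ∑ b, A a * A b * (R a b 0 1 * R a b 2 3 - R a b 0 2 * R a b 1 3 + R a b 0 3 * R a b 1 2)

/-- The normal curvature two-form of a pair of second fundamental forms. -/
def normalCurvature (A : Fin 4 → ℝ) (H₁ H₂ : Matrix (Fin 4) (Fin 4) ℝ) :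
    Matrix (Fin 4) (Fin 4) ℝ :=
  Matrix.of fun c d => ∑ e, A e * (H₁ e c * H₂ e d - H₂ e c * H₁ e d)

/-- The Pfaffian of an antisymmetric matrix. -/
def pfaffian (F : Matrix (Fin 4) (Fin 4) ℝ) : ℝ := F 0 1 * F 2 3 - F 0 2 * F 1 3 + F 0 3 * F 1 2

/-- Contracting over the first index pair turns products of second fundamental forms into products
of the matrices `M₁`, `M₂`, `N`. The unmixed terms involve only the symmetric `M₁`, `M₂`; the mixed
ones carry `N`, whose antisymmetrization is the normal curvature. -/
lemma gauss_contraction (A : Fin 4 → ℝ) (ε₁ ε₂ : ℝ) (H₁ H₂ : Matrix (Fin 4) (Fin 4) ℝ)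
    (R : Fin 4 → Fin 4 → Fin 4 → Fin 4 → ℝ) (hR : IsGaussTensor R ε₁ ε₂ H₁ H₂) (c d e f : Fin 4)
    (M₁ M₂ N : Fin 4 → Fin 4 → ℝ)
    (h₁ : ∀ c d, M₁ c d = ∑ a, A a * (H₁ a c * H₁ a d))
    (h₂ : ∀ c d, M₂ c d = ∑ a, A a * (H₂ a c * H₂ a d))
    (hN : ∀ c d, N c d = ∑ a, A a * (H₁ a c * H₂ a d)) :
    ∑ a, ∑ b, A a * A b * (R a b c d * R a b e f) =
      2 * ε₁ ^ 2 * (M₁ c e * M₁ d f - M₁ c f * M₁ d e)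
      + 2 * ε₂ ^ 2 * (M₂ c e * M₂ d f - M₂ c f * M₂ d e)
      + 2 * ε₁ * ε₂ * (N c e * N d f - N c f * N d e + N e c * N f d - N f c * N e d) := by
  simp only [hR.eq, h₁, h₂, hN, Fin.sum_univ_four]
  ring

/-- Antisymmetrizing over the four free indices cancels the terms in the symmetric matrices `M₁`,
`M₂`, so only `N - Nᵀ` survives. This is the pointwise form of the fact that tangent and normal
bundle of a submanifold of flat space have opposite first Pontryagin forms. -/
lemma pontryagin_eq (A : Fin 4 → ℝ) {ε₁ ε₂ : ℝ} {H₁ H₂ : Matrix (Fin 4) (Fin 4) ℝ}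
    {R : Fin 4 → Fin 4 → Fin 4 → Fin 4 → ℝ} (hR : IsGaussTensor R ε₁ ε₂ H₁ H₂) :
    pontryagin A R = -(2 * ε₁ * ε₂) * pfaffian (normalCurvature A H₁ H₂) := by
  let M₁ : Fin 4 → Fin 4 → ℝ := fun c d => ∑ a, A a * (H₁ a c * H₁ a d)
  let M₂ : Fin 4 → Fin 4 → ℝ := fun c d => ∑ a, A a * (H₂ a c * H₂ a d)
  let N : Fin 4 → Fin 4 → ℝ := fun c d => ∑ a, A a * (H₁ a c * H₂ a d)
  have key := fun c d e f => gauss_contraction A ε₁ ε₂ H₁ H₂ R hR c d e f M₁ M₂ N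
    (fun _ _ => rfl) (fun _ _ => rfl) (fun _ _ => rfl)
  have hp : pontryagin A R = ∑ a, ∑ b, A a * A b * (R a b 0 1 * R a b 2 3)
      - ∑ a, ∑ b, A a * A b * (R a b 0 2 * R a b 1 3)
      + ∑ a, ∑ b, A a * A b * (R a b 0 3 * R a b 1 2) := by
    simp only [pontryagin, ← Finset.sum_sub_distrib, ← Finset.sum_add_distrib]
    exact Finset.sum_congr rfl fun a _ => Finset.sum_congr rfl fun b _ => by ring
  have hF : ∀ c d, normalCurvature A H₁ H₂ c d = N c d - N d c := by
    intro c d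
    simp only [normalCurvature, Matrix.of_apply, N, ← Finset.sum_sub_distrib]
    exact Finset.sum_congr rfl fun a _ => by ring
  have s₁ : ∀ c d, M₁ c d = M₁ d c := fun c d =>
    Finset.sum_congr rfl fun a _ => by ring
  have s₂ : ∀ c d, M₂ c d = M₂ d c := fun c d =>
    Finset.sum_congr rfl fun a _ => by ring
  rw [hp, key, key, key, pfaffian]
  simp only [hF]
  rw [s₁ 2 1, s₁ 3 1, s₁ 3 2, s₂ 2 1, s₂ 3 1, s₂ 3 2]
  ring

/-- The adjoint antisymmetric matrix, inverse to `F` up to the Pfaffian. -/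
lemma exists_mul_eq_pfaffian (F : Matrix (Fin 4) (Fin 4) ℝ) (hF : ∀ a b, F a b = -F b a) :
    ∃ F' : Matrix (Fin 4) (Fin 4) ℝ, F' * F = pfaffian F • 1 := by
  refine ⟨!![0, -F 2 3, F 1 3, -F 1 2; F 2 3, 0, -F 0 3, F 0 2; -F 1 3, F 0 3, 0, -F 0 1;
    F 1 2, -F 0 2, F 0 1, 0], ?_⟩
  have h0 := fun a => self_eq_neg.1 (hF a a)
  have e : F = !![0, F 0 1, F 0 2, F 0 3; -F 0 1, 0, F 1 2, F 1 3; -F 0 2, -F 1 2, 0, F 2 3;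
      -F 0 3, -F 1 3, -F 2 3, 0] := by
    ext i j
    fin_cases i <;> fin_cases j <;> simp [h0, ← hF]
  rw [pfaffian]
  generalize F 0 1 = p, F 0 2 = q, F 0 3 = r, F 1 2 = s, F 1 3 = t, F 2 3 = u at *
  subst e
  ext i j
  fin_cases i <;> fin_cases j <;> simp [Matrix.mul_apply, Fin.sum_univ_four] <;> ring

/-! ### Pairs of endomorphisms with an Einstein condition -/

section Einstein

variable {S₁ S₂ F : Matrix (Fin 4) (Fin 4) ℝ} {ε₁ ε₂ l : ℝ}

/-- Multiplying by `F⁻¹` and taking traces gives `2 tr S = 4 tr S`, where 4 is the dimension. -/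
lemma anticommute_of_derivation {S F F' : Matrix (Fin 4) (Fin 4) ℝ} (hF : F' * F = 1)
    (h : S * F + F * S = S.trace • F) : S.trace = 0 ∧ S * F = -(F * S) := by
  have h1 : F' * (S * F + F * S) = S.trace • 1 := by
    rw [h, Matrix.mul_smul, hF]
  have h2 : (F' * (S * F)).trace = S.trace := by
    rw [Matrix.trace_mul_comm, Matrix.mul_assoc, mul_eq_one_comm.1 hF, Matrix.mul_one]
  have h3 : F' * (F * S) = S := by rw [← Matrix.mul_assoc, hF, Matrix.one_mul]
  have h4 := congrArg Matrix.trace h1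
  rw [Matrix.mul_add, Matrix.trace_add, h2, h3, Matrix.trace_smul, Matrix.trace_one] at h4
  have ht : S.trace = 0 := by
    simp at h4; linarith
  refine ⟨ht, ?_⟩
  rw [ht, zero_smul] at h
  exact eq_neg_of_add_eq_zero_left h

/-- Two endomorphisms whose Gauss curvature is Einstein and whose commutator is invertible are
trace-free and anticommute with their commutator. -/
lemma einstein_anticommute (hF : F = S₁ * S₂ - S₂ * S₁) {F' : Matrix (Fin 4) (Fin 4) ℝ}
    (hF' : F' * F = 1) (h₁ : ε₁ ≠ 0) (h₂ : ε₂ ≠ 0)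
    (hE : ε₁ • (S₁.trace • S₁ - S₁ * S₁) + ε₂ • (S₂.trace • S₂ - S₂ * S₂) = l • 1) :
    S₁ * F = -(F * S₁) ∧ S₂ * F = -(F * S₂) ∧ ε₁ • (S₁ * S₁) + ε₂ • (S₂ * S₂) = -l • 1 := by
  -- The `S₁` part of the Einstein equation is a polynomial in `S₁`, so bracketing with `S₁` leaves
  -- only `ε₂ [S₁, tr(S₂) S₂ - S₂²]`.
  have c₂ : S₂ * F + F * S₂ = S₂.trace • F := by
    have h := congrArg (fun X => S₁ * X - X * S₁) hE
    simp only [Matrix.mul_add, Matrix.add_mul, Matrix.mul_smul, Matrix.smul_mul, Matrix.mul_sub,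
      Matrix.sub_mul, Matrix.mul_one, Matrix.one_mul, sub_self, ← Matrix.mul_assoc] at h
    have h' : ε₂ • (S₂.trace • F - (S₂ * F + F * S₂)) = 0 := by
      rw [← h, hF]
      simp only [Matrix.mul_sub, Matrix.sub_mul, ← Matrix.mul_assoc]
      module
    exact (sub_eq_zero.1 ((smul_eq_zero.1 h').resolve_left h₂)).symm
  have c₁ : S₁ * F + F * S₁ = S₁.trace • F := by
    have h := congrArg (fun X => S₂ * X - X * S₂) hE
    simp only [Matrix.mul_add, Matrix.add_mul, Matrix.mul_smul, Matrix.smul_mul, Matrix.mul_sub,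
      Matrix.sub_mul, Matrix.mul_one, Matrix.one_mul, sub_self, ← Matrix.mul_assoc] at h
    have h' : ε₁ • (S₁.trace • F - (S₁ * F + F * S₁)) = 0 := by
      rw [← neg_eq_zero, ← h, hF]
      simp only [Matrix.mul_sub, Matrix.sub_mul, ← Matrix.mul_assoc]
      module
    exact (sub_eq_zero.1 ((smul_eq_zero.1 h').resolve_left h₁)).symm
  obtain ⟨t₁, a₁⟩ := anticommute_of_derivation hF' c₁
  obtain ⟨t₂, a₂⟩ := anticommute_of_derivation hF' c₂
  refine ⟨a₁, a₂, ?_⟩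
  rw [t₁, t₂] at hE
  rw [neg_smul, ← hE]
  module

/-- Anticommutation gives `S F S = -F S²` for each operator, and the Einstein condition evaluates
the sum. The lemma also serves with `F` replaced by `F Q`, for `Q` commuting with `S₁` and `S₂`. -/
lemma curvature_normal (a₁ : S₁ * F = -(F * S₁)) (a₂ : S₂ * F = -(F * S₂))
    (hE : ε₁ • (S₁ * S₁) + ε₂ • (S₂ * S₂) = -l • 1) :
    ε₁ • (S₁ * F * S₁) + ε₂ • (S₂ * F * S₂) = l • F := by
  rw [a₁, a₂, Matrix.neg_mul, Matrix.neg_mul, Matrix.mul_assoc, Matrix.mul_assoc]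
  have := congrArg (fun X => -(F * X)) hE
  simp only [Matrix.mul_add, Matrix.mul_smul, Matrix.mul_one] at this
  rw [← neg_neg l, neg_smul (-l), ← this]
  module

end Einstein

/-- If the curvature of a pair of symmetric endomorphisms is Einstein with constant `l`, and the
eigenspace of its curvature operator for `l`, among the antisymmetric endomorphisms which
commute with the normal curvature `F`, is spanned by `F`, then the curvature operator is determined
by the first endomorphism on those antisymmetric endomorphisms. -/
lemma curvature_eq_of_eigenspace {S₁ S₂ F F' : Matrix (Fin 4) (Fin 4) ℝ} {ε₁ ε₂ l : ℝ}
    (hF : F = S₁ * S₂ - S₂ * S₁) (hF' : F' * F = 1) (s₁ : S₁.transpose = S₁)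
    (s₂ : S₂.transpose = S₂) (a₁ : S₁ * F = -(F * S₁)) (a₂ : S₂ * F = -(F * S₂))
    (hE : ε₁ • (S₁ * S₁) + ε₂ • (S₂ * S₂) = -l • 1)
    (hker : ∀ w : Matrix (Fin 4) (Fin 4) ℝ, w.transpose = -w → w * F = F * w →
      ε₁ • (S₁ * w * S₁) + ε₂ • (S₂ * w * S₂) = l • w → ∃ c : ℝ, w = c • F) :
    ∃ q : ℝ, q ≠ 0 ∧ S₁ * S₁ = q • 1 ∧ ∀ w, w * F = F * w →
      ε₁ • (S₁ * w * S₁) + ε₂ • (S₂ * w * S₂) = -(l / q) • (S₁ * w * S₁) := by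
  have tF : F.transpose = -F := by
    rw [hF]; simp [Matrix.transpose_mul, s₁, s₂]
  -- a symmetric matrix commuting with both endomorphisms is a scalar
  have scalar : ∀ Q : Matrix (Fin 4) (Fin 4) ℝ, Q.transpose = Q → Q * F = F * Q →
      S₁ * Q = Q * S₁ → S₂ * Q = Q * S₂ → ∃ c : ℝ, Q = c • 1 := by
    intro Q tQ cF c₁ c₂
    -- `F Q` is antisymmetric, commutes with `F` and anticommutes with `S₁`, `S₂`, so it is again an
    -- eigenvector.
    obtain ⟨c, hc⟩ := hker (F * Q) (by rw [Matrix.transpose_mul, tQ, tF, Matrix.mul_neg, cF])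
      (by rw [Matrix.mul_assoc, cF])
      (by
        refine curvature_normal ?_ ?_ hE
        · rw [← Matrix.mul_assoc, a₁, Matrix.neg_mul, Matrix.mul_assoc, c₁, Matrix.mul_assoc]
        · rw [← Matrix.mul_assoc, a₂, Matrix.neg_mul, Matrix.mul_assoc, c₂, Matrix.mul_assoc])
    refine ⟨c, ?_⟩
    have := congrArg (fun X => F' * X) hc
    simpa [← Matrix.mul_assoc, hF'] using this
  have cF₁ : S₁ * S₁ * F = F * (S₁ * S₁) := by
    rw [Matrix.mul_assoc, a₁, Matrix.mul_neg, ← Matrix.mul_assoc, a₁]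
    simp [Matrix.mul_assoc]
  -- `[S₁², S₂] = S₁F + FS₁`, which vanishes.
  have c₂₁ : S₂ * (S₁ * S₁) = S₁ * S₁ * S₂ := by
    have e : S₁ * S₁ * S₂ - S₂ * (S₁ * S₁) = S₁ * F + F * S₁ := by
      rw [hF]; simp only [Matrix.mul_sub, Matrix.sub_mul, ← Matrix.mul_assoc]; abel
    rw [a₁, neg_add_cancel] at e
    exact (sub_eq_zero.1 e).symm
  obtain ⟨q, hq⟩ := scalar (S₁ * S₁) (by rw [Matrix.transpose_mul, s₁]) cF₁
    (by rw [Matrix.mul_assoc]) c₂₁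
  have c₁₂ : S₁ * (S₂ * S₂) = S₂ * S₂ * S₁ := by
    have e : S₁ * (S₂ * S₂) - S₂ * S₂ * S₁ = S₂ * F + F * S₂ := by
      rw [hF]; simp only [Matrix.mul_sub, Matrix.sub_mul, ← Matrix.mul_assoc]; abel
    rw [a₂, neg_add_cancel] at e
    exact sub_eq_zero.1 e
  obtain ⟨t, ht⟩ := scalar (S₁ * S₂ + S₂ * S₁)
    (by simp [Matrix.transpose_mul, s₁, s₂, add_comm])
    (by
      have e₁ : S₁ * S₂ * F = F * (S₁ * S₂) := by
        rw [Matrix.mul_assoc, a₂, Matrix.mul_neg, ← Matrix.mul_assoc, a₁]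
        simp [Matrix.mul_assoc]
      have e₂ : S₂ * S₁ * F = F * (S₂ * S₁) := by
        rw [Matrix.mul_assoc, a₁, Matrix.mul_neg, ← Matrix.mul_assoc, a₂]
        simp [Matrix.mul_assoc]
      rw [Matrix.add_mul, Matrix.mul_add, e₁, e₂])
    (by rw [Matrix.mul_add, Matrix.add_mul, ← Matrix.mul_assoc S₁ S₁, ← c₂₁]
        simp only [← Matrix.mul_assoc]; abel)
    (by rw [Matrix.mul_add, Matrix.add_mul, ← Matrix.mul_assoc S₂ S₂, ← c₁₂]
        simp only [← Matrix.mul_assoc]; abel)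
  -- Definiteness enters here: for a real symmetric matrix, `S₁² = 0` forces `S₁ = 0`, and then `F =
  -- 0`.
  have hq0 : q ≠ 0 := by
    rintro rfl
    have h0 : S₁.transpose * S₁ = 0 := by rw [s₁, hq, zero_smul]
    have h1 : S₁ = 0 := Matrix.conjTranspose_mul_self_eq_zero.1
      (by rw [Matrix.conjTranspose_eq_transpose_of_trivial, h0])
    rw [h1] at hF
    simp only [Matrix.zero_mul, Matrix.mul_zero, sub_self] at hF
    rw [hF, Matrix.mul_zero] at hF'
    exact zero_ne_one hF'
  refine ⟨q, hq0, hq, fun w hw => ?_⟩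
  -- The anticommutator is the scalar `t` and the commutator is `F`, so both products are known.
  -- With `S₁² = q` this expresses `q S₂` as `S₁ (t + F)/2` and as `(t - F)/2 S₁`.
  have p₁₂ : S₁ * S₂ = (1 / 2 : ℝ) • (t • 1 + F) := by rw [← ht, hF]; module
  have p₂₁ : S₂ * S₁ = (1 / 2 : ℝ) • (t • 1 - F) := by rw [← ht, hF]; module
  have hS₂ : q • S₂ = S₁ * ((1 / 2 : ℝ) • (t • 1 + F)) := by
    rw [← p₁₂, ← Matrix.mul_assoc, hq]; simp
  have hS₂' : q • S₂ = ((1 / 2 : ℝ) • (t • 1 - F)) * S₁ := by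
    rw [← p₂₁, Matrix.mul_assoc, hq]; simp
  have hsq : ε₂ • (((1 / 2 : ℝ) • (t • 1 - F)) * ((1 / 2 : ℝ) • (t • 1 + F)))
      = (q * (-l - ε₁ * q)) • (1 : Matrix (Fin 4) (Fin 4) ℝ) := by
    rw [← p₁₂, ← p₂₁, Matrix.mul_assoc, ← Matrix.mul_assoc S₁, hq]
    simp only [Matrix.smul_mul, Matrix.one_mul, Matrix.mul_smul]
    rw [smul_comm, eq_sub_of_add_eq' hE, hq]
    module
  have com : ((1 / 2 : ℝ) • (t • 1 + F)) * w = w * ((1 / 2 : ℝ) • (t • 1 + F)) := by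
    simp only [Matrix.smul_mul, Matrix.mul_smul, Matrix.add_mul, Matrix.mul_add, hw,
      Matrix.mul_one, Matrix.one_mul]
  have swap : S₁ * ((1 / 2 : ℝ) • (t • 1 + F)) = ((1 / 2 : ℝ) • (t • 1 - F)) * S₁ := by
    rw [← hS₂, hS₂']
  -- Since `w` commutes with `F`, the factor `(t + F)/2` passes through it and meets `(t - F)/2`; by
  -- `hsq` their product times `ε₂` is a scalar.
  have main : (q * q) • (ε₂ • (S₂ * w * S₂)) = (q * (-l - ε₁ * q)) • (S₁ * w * S₁) := by
    calc (q * q) • (ε₂ • (S₂ * w * S₂)) = ε₂ • ((q • S₂) * w * (q • S₂)) := by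
          simp only [Matrix.smul_mul, Matrix.mul_smul]; module
      _ = ε₂ • (S₁ * (((1 / 2 : ℝ) • (t • 1 + F)) * w) * (((1 / 2 : ℝ) • (t • 1 - F)) * S₁)) := by
          nth_rewrite 1 [hS₂]; rw [hS₂']; simp only [Matrix.mul_assoc]
      _ = S₁ * w * (ε₂ • (((1 / 2 : ℝ) • (t • 1 - F)) * ((1 / 2 : ℝ) • (t • 1 + F)))) * S₁ := by
          have c : ((1 / 2 : ℝ) • (t • 1 - F)) * ((1 / 2 : ℝ) • (t • 1 + F))
              = ((1 / 2 : ℝ) • (t • 1 + F)) * ((1 / 2 : ℝ) • (t • 1 - F)) := by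
            simp only [Matrix.smul_mul, Matrix.mul_smul, Matrix.add_mul, Matrix.mul_add,
              Matrix.sub_mul, Matrix.mul_sub, Matrix.mul_one, Matrix.one_mul]
            module
          rw [com, c]
          simp only [Matrix.mul_smul, Matrix.smul_mul, Matrix.mul_assoc]
      _ = _ := by rw [hsq]; simp
  have h3 : ε₂ • (S₂ * w * S₂) = ((q * q)⁻¹ * (q * (-l - ε₁ * q))) • (S₁ * w * S₁) := by
    rw [mul_smul, ← main, smul_smul, inv_mul_cancel₀ (mul_ne_zero hq0 hq0), one_smul]
  rw [h3, ← add_smul]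
  congr 1
  field_simp
  ring

/-- The algebraic consequences of the Gauss equation for an Einstein curvature tensor with
nonvanishing Pontryagin density. -/
lemma IsGaussTensor.exists_anticommute {R : Fin 4 → Fin 4 → Fin 4 → Fin 4 → ℝ} {ε₁ ε₂ l : ℝ}
    {H₁ H₂ S₁ S₂ : Matrix (Fin 4) (Fin 4) ℝ} (hR : IsGaussTensor R ε₁ ε₂ H₁ H₂) {A : Fin 4 → ℝ}
    (hA : ∀ a, A a ≠ 0) (hE : ∀ b d, A b * ∑ a, A a * R a b a d = if b = d then l else 0)
    (hp : pontryagin A R ≠ 0) (hS₁ : S₁ = Matrix.diagonal A * H₁)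
    (hS₂ : S₂ = Matrix.diagonal A * H₂) :
    ∃ F F' : Matrix (Fin 4) (Fin 4) ℝ, F = S₁ * S₂ - S₂ * S₁ ∧
      F = Matrix.diagonal A * normalCurvature A H₁ H₂ ∧ F' * F = 1 ∧
      S₁ * F = -(F * S₁) ∧ S₂ * F = -(F * S₂) ∧ ε₁ • (S₁ * S₁) + ε₂ • (S₂ * S₂) = -l • 1 := by
  rw [pontryagin_eq A hR] at hp
  have h₁ : ε₁ ≠ 0 := by rintro rfl; simp at hp
  have h₂ : ε₂ ≠ 0 := by rintro rfl; simp at hp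
  have hpf : pfaffian (normalCurvature A H₁ H₂) ≠ 0 := right_ne_zero_of_mul hp
  obtain ⟨N', hN'⟩ := exists_mul_eq_pfaffian (normalCurvature A H₁ H₂) (fun c d => by
    simp only [normalCurvature, Matrix.of_apply, ← Finset.sum_neg_distrib]
    exact Finset.sum_congr rfl fun _ _ => by ring)
  have d₁ : ∀ a b, S₁ a b = A a * H₁ a b := fun a b => by rw [hS₁, Matrix.diagonal_mul]
  have d₂ : ∀ a b, S₂ a b = A a * H₂ a b := fun a b => by rw [hS₂, Matrix.diagonal_mul]
  have hF : Matrix.diagonal A * normalCurvature A H₁ H₂ = S₁ * S₂ - S₂ * S₁ := by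
    ext a b
    rw [Matrix.diagonal_mul]
    simp only [Matrix.sub_apply, Matrix.mul_apply, normalCurvature, d₁, d₂,
      Matrix.of_apply, Finset.mul_sum, ← Finset.sum_sub_distrib]
    refine Finset.sum_congr rfl fun e _ => ?_
    rw [hR.symm₁ e a, hR.symm₂ e a]
    ring
  have hF' : (pfaffian (normalCurvature A H₁ H₂))⁻¹ • (N' * Matrix.diagonal A⁻¹)
      * (Matrix.diagonal A * normalCurvature A H₁ H₂) = 1 := by
    have : Matrix.diagonal A⁻¹ * Matrix.diagonal A = 1 := by
      rw [Matrix.diagonal_mul_diagonal, ← Matrix.diagonal_one]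
      congr 1; ext i; simp [hA i]
    rw [Matrix.smul_mul, Matrix.mul_assoc, ← Matrix.mul_assoc (Matrix.diagonal A⁻¹), this,
      Matrix.one_mul, hN', smul_smul, inv_mul_cancel₀ hpf, one_smul]
  refine ⟨_, _, hF, rfl, hF', einstein_anticommute hF hF' h₁ h₂ ?_⟩
  ext b d
  have := hE b d
  simp only [Matrix.add_apply, Matrix.smul_apply, Matrix.sub_apply, Matrix.trace, Matrix.diag,
    d₁, d₂, smul_eq_mul, Matrix.mul_apply, Matrix.one_apply, mul_ite, mul_one,
    mul_zero]
  rw [← this]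
  simp only [hR.eq, Fin.sum_univ_four]
  rw [hR.symm₁ b 0, hR.symm₁ b 1, hR.symm₁ b 2, hR.symm₁ b 3, hR.symm₂ b 0, hR.symm₂ b 1,
    hR.symm₂ b 2, hR.symm₂ b 3]
  ring

/-- The two terms of each Gauss product are exchanged up to sign by swapping `c` and `d`, so they
contribute equally on antisymmetric `w`. Hence the factor 2 between the full contraction and the
operator `w ↦ H w H`. -/
lemma IsGaussTensor.sum_mul {R : Fin 4 → Fin 4 → Fin 4 → Fin 4 → ℝ} {ε₁ ε₂ : ℝ}
    {H₁ H₂ : Matrix (Fin 4) (Fin 4) ℝ} (hR : IsGaussTensor R ε₁ ε₂ H₁ H₂)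
    {w : Matrix (Fin 4) (Fin 4) ℝ} (hw : w.transpose = -w) (a b : Fin 4) :
    ∑ c, ∑ d, R a b c d * w c d = 2 * (ε₁ • (H₁ * w * H₁) + ε₂ • (H₂ * w * H₂)) a b := by
  have hw' : ∀ c d, w c d = -w d c := fun c d => by
    rw [← Matrix.neg_apply, ← hw, Matrix.transpose_apply]
  have h1 : ∑ c, ∑ d, R a b c d * w c d
      = ∑ c, ∑ d, (ε₁ * (H₁ a c * H₁ b d) + ε₂ * (H₂ a c * H₂ b d)) * w c d
      - ∑ c, ∑ d, (ε₁ * (H₁ a d * H₁ b c) + ε₂ * (H₂ a d * H₂ b c)) * w c d := by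
    simp only [hR.eq, ← Finset.sum_sub_distrib]
    exact Finset.sum_congr rfl fun _ _ => Finset.sum_congr rfl fun _ _ => by ring
  have h2 : ∑ c, ∑ d, (ε₁ * (H₁ a d * H₁ b c) + ε₂ * (H₂ a d * H₂ b c)) * w c d
      = - ∑ c, ∑ d, (ε₁ * (H₁ a c * H₁ b d) + ε₂ * (H₂ a c * H₂ b d)) * w c d := by
    rw [Finset.sum_comm, ← Finset.sum_neg_distrib]
    refine Finset.sum_congr rfl fun c _ => ?_
    rw [← Finset.sum_neg_distrib]
    refine Finset.sum_congr rfl fun d _ => ?_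
    rw [hw' d c]; ring
  rw [h1, h2]
  simp only [Matrix.add_apply, Matrix.smul_apply, Matrix.mul_apply, smul_eq_mul,
    Finset.sum_mul, Finset.mul_sum]
  rw [Finset.sum_comm, sub_neg_eq_add, ← two_mul, Finset.mul_sum, ← Finset.sum_add_distrib,
    Finset.mul_sum]
  refine Finset.sum_congr rfl fun c _ => ?_
  rw [Finset.mul_sum, ← Finset.sum_add_distrib, Finset.mul_sum]
  refine Finset.sum_congr rfl fun d _ => ?_
  rw [hR.symm₁ b c, hR.symm₂ b c]
  ring

/-- A Ricci-flat tensor with injective curvature operator and nonvanishing Pontryagin density does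
not satisfy a Gauss equation in codimension two. -/
lemma not_isGaussTensor_of_ricci_eq_zero {R : Fin 4 → Fin 4 → Fin 4 → Fin 4 → ℝ} {A : Fin 4 → ℝ}
    (hA : ∀ a, A a ≠ 0) (hE : ∀ b d, ∑ a, A a * R a b a d = 0) (hp : pontryagin A R ≠ 0)
    (hinj : ∀ w : Matrix (Fin 4) (Fin 4) ℝ, w.transpose = -w →
      (∀ a b, ∑ c, ∑ d, R a b c d * w c d = 0) → w = 0)
    (ε₁ ε₂ : ℝ) (H₁ H₂ : Matrix (Fin 4) (Fin 4) ℝ) : ¬ IsGaussTensor R ε₁ ε₂ H₁ H₂ := by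
  intro hR
  obtain ⟨F, F', -, hF, hF', a₁, a₂, hsq⟩ := hR.exists_anticommute (l := 0) hA
    (fun b d => by rw [hE]; simp) hp rfl rfl
  have hc := curvature_normal a₁ a₂ hsq
  have t₁ : H₁.transpose = H₁ := Matrix.ext fun a b => hR.symm₁ b a
  have t₂ : H₂.transpose = H₂ := Matrix.ext fun a b => hR.symm₂ b a
  have tN : (normalCurvature A H₁ H₂).transpose = -normalCurvature A H₁ H₂ := by
    ext c d
    simp only [Matrix.transpose_apply, Matrix.neg_apply, normalCurvature, Matrix.of_apply,
      ← Finset.sum_neg_distrib]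
    exact Finset.sum_congr rfl fun _ _ => by ring
  have hdet : Matrix.diagonal A⁻¹ * Matrix.diagonal A = 1 := by
    rw [Matrix.diagonal_mul_diagonal, ← Matrix.diagonal_one]
    congr 1; ext i; simp [hA i]
  -- Raising an index of `F` gives the antisymmetric matrix `A N A`, with `N` the normal curvature;
  -- being an eigenvector for `l = 0`, it is annihilated by the curvature operator.
  have hw := hinj (F * Matrix.diagonal A)
    (by rw [hF, Matrix.transpose_mul, Matrix.transpose_mul, Matrix.diagonal_transpose, tN]
        simp [Matrix.mul_assoc])
    (fun a b => by
      rw [hR.sum_mul (by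
        rw [hF, Matrix.transpose_mul, Matrix.transpose_mul, Matrix.diagonal_transpose, tN]
        simp [Matrix.mul_assoc])]
      have : ε₁ • (H₁ * (F * Matrix.diagonal A) * H₁) + ε₂ • (H₂ * (F * Matrix.diagonal A) * H₂)
          = 0 := by
        have h := congrArg (fun X => Matrix.diagonal A⁻¹ * X) hc
        simp only [Matrix.mul_add, Matrix.mul_smul, zero_smul, ← Matrix.mul_assoc, hdet,
          Matrix.one_mul, Matrix.mul_zero] at h
        simpa only [← Matrix.mul_assoc] using h
      rw [this]; simp)
  have h0 : F = 0 := by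
    have h := congrArg (fun X => X * Matrix.diagonal A⁻¹) hw
    rw [mul_eq_one_comm] at hdet
    simpa [Matrix.mul_assoc, hdet] using h
  rw [h0, Matrix.mul_zero] at hF'
  exact zero_ne_one hF'

/-! ### The Gauss equation -/

/-- The products of the normal components of a family of vectors `Z i`, with respect to tangent
vectors `Y a` with nondegenerate Gram matrix in a space of dimension at most six, are diagonalized
by two symmetric coordinates. -/
lemma exists_normal_coordinates {W : Type*} [AddCommGroup W] [Module ℝ W] [FiniteDimensional ℝ W]
    (hW : finrank ℝ W ≤ 6) (B : LinearMap.BilinForm ℝ W) (hB : B.IsSymm) (Y : Fin 4 → W)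
    (G : Matrix (Fin 4) (Fin 4) ℝ) (hG : ∀ a b, G a b = B (Y a) (Y b)) (hdet : G.det ≠ 0)
    {κ : Type*} (Z : κ → W) :
    ∃ (ε₁ ε₂ : ℝ) (n₁ n₂ : W → ℝ), ∀ i j, ε₁ * (n₁ (Z i) * n₁ (Z j)) + ε₂ * (n₂ (Z i) * n₂ (Z j))
      = B (Z i) (Z j) - ∑ e, ∑ f, B (Y e) (Z i) * G⁻¹ e f * B (Y f) (Z j) := by
  have hinv : G * G⁻¹ = 1 := Matrix.mul_nonsing_inv _ (isUnit_iff_ne_zero.2 hdet)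
  have hsymm : ∀ x y, B x y = B y x := fun x y => hB.eq x y
  -- `Φ` takes products with the tangent vectors and `σ` is a section of it built from the inverse
  -- Gram matrix, so `x - σ (Φ x)` is the normal component of `x`.
  let Φ : W →ₗ[ℝ] (Fin 4 → ℝ) := LinearMap.pi fun a => B (Y a)
  let σ : (Fin 4 → ℝ) → W := fun c => ∑ e, (∑ f, G⁻¹ e f * c f) • Y e
  have hΦσ : ∀ c, Φ (σ c) = c := by
    intro c
    funext a
    have := congrFun (congrArg (fun M : Matrix (Fin 4) (Fin 4) ℝ => M.mulVec c) hinv) a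
    rw [Matrix.one_mulVec, ← Matrix.mulVec_mulVec] at this
    rw [← this]
    simp only [Φ, σ, LinearMap.pi_apply, map_sum, map_smul, smul_eq_mul, Matrix.mulVec, dotProduct,
      hG]
    exact Finset.sum_congr rfl fun e _ => mul_comm _ _
  have hsurj : LinearMap.range Φ = ⊤ := LinearMap.range_eq_top.2 fun c => ⟨_, hΦσ c⟩
  have hker : finrank ℝ (LinearMap.ker Φ) ≤ 2 := by
    have h := Φ.finrank_range_add_finrank_ker
    rw [hsurj, finrank_top, finrank_fin_fun] at h
    omega
  let N := LinearMap.ker Φ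
  let p : W → N := fun x => ⟨x - σ (Φ x), by rw [LinearMap.mem_ker, map_sub, hΦσ, sub_self]⟩
  have hBp : ∀ x y, B (p x) (p y) =
      B x y - ∑ e, ∑ f, B (Y e) x * G⁻¹ e f * B (Y f) y := by
    intro x y
    have hy : Φ (p y) = 0 := (p y).2
    have h1 : B (σ (Φ x)) (p y) = 0 := by
      have : ∀ e, B (Y e) (p y) = 0 := fun e => congrFun hy e
      simp [σ, this]
    have h2 : B x (σ (Φ y)) = ∑ e, ∑ f, B (Y e) x * G⁻¹ e f * B (Y f) y := by
      simp only [σ, Φ, map_sum, map_smul, smul_eq_mul, LinearMap.pi_apply, Finset.sum_mul]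
      refine Finset.sum_congr rfl fun e _ => Finset.sum_congr rfl fun f _ => ?_
      rw [hsymm x]; ring
    calc B (p x) (p y) = B x (p y) - B (σ (Φ x)) (p y) := by simp [p]
      _ = B x (y - σ (Φ y)) := by rw [h1, sub_zero]
      _ = _ := by rw [map_sub, h2]
  have hBN : (B.restrict N).IsSymm := ⟨fun x y => hsymm _ _⟩
  obtain ⟨v, hv⟩ := LinearMap.BilinForm.exists_orthogonal_basis
    (LinearMap.BilinForm.isSymm_iff.1 hBN)
  have hexp : ∀ x y, B (p x) (p y) = ∑ i, B (v i) (v i) * (v.repr (p x) i * v.repr (p y) i) := by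
    intro x y
    have h := LinearMap.sum_repr_mul_repr_mul v v (B := B.restrict N) (p x) (p y)
    change _ = B (p x) (p y) at h
    rw [← h, Finsupp.sum_fintype _ _ (by simp)]
    refine Finset.sum_congr rfl fun i _ => ?_
    rw [Finsupp.sum_fintype _ _ (by simp), Finset.sum_eq_single i]
    · change v.repr (p x) i * (v.repr (p y) i * B (v i) (v i)) = _
      ring
    · intro j _ hj
      have : B.restrict N (v i) (v j) = 0 := hv hj.symm
      rw [this, smul_zero, smul_zero]
    · simp
  simp only [← hBp, hexp]
  have hn : finrank ℝ N ≤ 2 := hker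
  clear hexp hv
  revert v
  generalize finrank ℝ N = n at hn
  intro v
  -- The normal space has dimension 0, 1 or 2; absent directions receive the coefficient 0.
  interval_cases n
  · exact ⟨0, 0, 0, 0, by simp⟩
  · exact ⟨B (v 0) (v 0), 0, fun x => v.repr (p x) 0, 0, by simp⟩
  · exact ⟨B (v 0) (v 0), B (v 1) (v 1), fun x => v.repr (p x) 0, fun x => v.repr (p x) 1,
      by simp [Fin.sum_univ_two]⟩

/-! ### The Gauss equation for isometric maps -/

/-- The `a`-th coordinate vector of `ℝ⁴`. -/
abbrev basisVec (a : Fin 4) : Coord4 := EuclideanSpace.single a (1 : ℝ)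

/-- The partial derivatives of a vector-valued function. -/
def pderiv {W : Type*} [NormedAddCommGroup W] [NormedSpace ℝ W] (i : Fin 4) (f : Coord4 → W)
    (y : Coord4) : W := fderiv ℝ f y (basisVec i)

lemma partialDeriv_eq_pderiv (i : Fin 4) (f : Coord4 → ℝ) : partialDeriv i f = pderiv i f := rfl

section pderiv

variable {W : Type*} [NormedAddCommGroup W] [NormedSpace ℝ W]

lemma pderiv_congr {V : Set Coord4} (hV : IsOpen V) {f g : Coord4 → W} (h : ∀ z ∈ V, f z = g z)
    {y : Coord4} (hy : y ∈ V) (i : Fin 4) : pderiv i f y = pderiv i g y := by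
  have : f =ᶠ[nhds y] g := Filter.eventually_of_mem (hV.mem_nhds hy) h
  rw [pderiv, pderiv, this.fderiv_eq]

lemma ContDiffOn.pderiv {V : Set Coord4} (hV : IsOpen V) {f : Coord4 → W}
    (hf : ContDiffOn ℝ ∞ f V) (i : Fin 4) : ContDiffOn ℝ ∞ (pderiv i f) V :=
  (hf.fderiv_of_isOpen hV (by simp)).clm_apply contDiffOn_const

lemma ContDiffOn.differentiableAt_of_isOpen {V : Set Coord4} (hV : IsOpen V) {f : Coord4 → W}
    (hf : ContDiffOn ℝ ∞ f V) {y : Coord4} (hy : y ∈ V) : DifferentiableAt ℝ f y :=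
  (hf.contDiffAt (hV.mem_nhds hy)).differentiableAt (by simp)

lemma pderiv_pderiv {V : Set Coord4} (hV : IsOpen V) {f : Coord4 → W}
    (hf : ContDiffOn ℝ ∞ f V) {y : Coord4} (hy : y ∈ V) (i j : Fin 4) :
    pderiv i (pderiv j f) y = fderiv ℝ (fderiv ℝ f) y (basisVec i) (basisVec j) := by
  have hd : DifferentiableAt ℝ (fderiv ℝ f) y :=
    ((hf.fderiv_of_isOpen hV (m := ∞) (by simp)).contDiffAt (hV.mem_nhds hy)).differentiableAt
      (by simp)
  change fderiv ℝ (fun z => fderiv ℝ f z (basisVec j)) y (basisVec i) = _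
  rw [fderiv_clm_apply hd (differentiableAt_const _)]
  simp

lemma pderiv_comm {V : Set Coord4} (hV : IsOpen V) {f : Coord4 → W}
    (hf : ContDiffOn ℝ ∞ f V) {y : Coord4} (hy : y ∈ V) (i j : Fin 4) :
    pderiv i (pderiv j f) y = pderiv j (pderiv i f) y := by
  rw [pderiv_pderiv hV hf hy, pderiv_pderiv hV hf hy]
  exact ((hf.contDiffAt (hV.mem_nhds hy)).isSymmSndFDerivAt
    (by simp; exact WithTop.coe_le_coe.2 (le_top : (2 : ℕ∞) ≤ ⊤))).eq _ _

lemma pderiv_bilin (B : W →L[ℝ] W →L[ℝ] ℝ) {f g : Coord4 → W} {y : Coord4}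
    (hf : DifferentiableAt ℝ f y) (hg : DifferentiableAt ℝ g y) (i : Fin 4) :
    pderiv i (fun z => B (f z) (g z)) y = B (pderiv i f y) (g y) + B (f y) (pderiv i g y) := by
  have h := B.hasFDerivAt_of_bilinear hf.hasFDerivAt hg.hasFDerivAt
  rw [pderiv, h.fderiv]
  simp [pderiv, add_comm]

lemma pderiv_add {f g : Coord4 → W} {y : Coord4}
    (hf : DifferentiableAt ℝ f y) (hg : DifferentiableAt ℝ g y) (i : Fin 4) :
    pderiv i (fun z => f z + g z) y = pderiv i f y + pderiv i g y := by
  rw [pderiv, fderiv_fun_add hf hg]; rfl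

lemma pderiv_mul {f g : Coord4 → ℝ} {y : Coord4}
    (hf : DifferentiableAt ℝ f y) (hg : DifferentiableAt ℝ g y) (i : Fin 4) :
    pderiv i (fun z => f z * g z) y = pderiv i f y * g y + f y * pderiv i g y := by
  rw [pderiv, fderiv_fun_mul hf hg]
  simp [pderiv]; ring

lemma pderiv_sum {κ : Type*} (s : Finset κ) {f : κ → Coord4 → W} {y : Coord4}
    (hf : ∀ k ∈ s, DifferentiableAt ℝ (f k) y) (i : Fin 4) :
    pderiv i (fun z => ∑ k ∈ s, f k z) y = ∑ k ∈ s, pderiv i (f k) y := by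
  rw [pderiv, fderiv_fun_sum hf]
  simp [pderiv]

end pderiv

/-- The Christoffel symbols `Γ_{l,ij}` of the first kind. -/
def lowerChristoffel (G : Coord4 → Matrix (Fin 4) (Fin 4) ℝ) (l i j : Fin 4) (y : Coord4) : ℝ :=
  (1 / 2) * (partialDeriv i (fun z => G z l j) y + partialDeriv j (fun z => G z l i) y
    - partialDeriv l (fun z => G z i j) y)

/-- The Riemann tensor `R_{abcd}`, expressed by the second derivatives of the metric. -/
def lowerRiemann (G : Coord4 → Matrix (Fin 4) (Fin 4) ℝ) (y : Coord4) (a b c d : Fin 4) : ℝ :=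
  (1 / 2) * (partialDeriv b (partialDeriv c fun z => G z a d) y
    + partialDeriv a (partialDeriv d fun z => G z b c) y
    - partialDeriv b (partialDeriv d fun z => G z a c) y
    - partialDeriv a (partialDeriv c fun z => G z b d) y)
  - ∑ e, ∑ f, (lowerChristoffel G e a c y * (G y)⁻¹ e f * lowerChristoffel G f b d y
    - lowerChristoffel G e a d y * (G y)⁻¹ e f * lowerChristoffel G f b c y)

/-- The Gauss equation, at a point where the induced metric is nondegenerate, in codimension at most
two. -/
lemma exists_isGaussTensor {W : Type*} [NormedAddCommGroup W] [NormedSpace ℝ W]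
    [FiniteDimensional ℝ W] (hW : finrank ℝ W ≤ 6) (B : W →L[ℝ] W →L[ℝ] ℝ)
    (hB : ∀ v w, B v w = B w v) {V : Set Coord4} (hV : IsOpen V) {X : Coord4 → W}
    (hX : ContDiffOn ℝ ∞ X V) {G : Coord4 → Matrix (Fin 4) (Fin 4) ℝ}
    (hG : ∀ z ∈ V, ∀ a b, G z a b = B (pderiv a X z) (pderiv b X z)) {y : Coord4} (hy : y ∈ V)
    (hdet : (G y).det ≠ 0) :
    ∃ ε₁ ε₂ H₁ H₂, IsGaussTensor (lowerRiemann G y) ε₁ ε₂ H₁ H₂ := by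
  have h1 := fun a => hX.pderiv hV a
  have h2 := fun a b => (h1 a).pderiv hV b
  have d1 : ∀ z ∈ V, ∀ a, DifferentiableAt ℝ (pderiv a X) z :=
    fun z hz a => (h1 a).differentiableAt_of_isOpen hV hz
  have d2 : ∀ z ∈ V, ∀ a b, DifferentiableAt ℝ (pderiv b (pderiv a X)) z :=
    fun z hz a b => (h2 a b).differentiableAt_of_isOpen hV hz
  have g1 : ∀ z ∈ V, ∀ a b c, partialDeriv c (fun z => G z a b) z =
      B (pderiv c (pderiv a X) z) (pderiv b X z) + B (pderiv a X z) (pderiv c (pderiv b X) z) := by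
    intro z hz a b c
    rw [partialDeriv_eq_pderiv, pderiv_congr hV (fun z hz => hG z hz a b) hz,
      pderiv_bilin B (d1 z hz a) (d1 z hz b)]
  have g2 : ∀ a b c d, partialDeriv d (partialDeriv c fun z => G z a b) y =
      B (pderiv d (pderiv c (pderiv a X)) y) (pderiv b X y)
      + B (pderiv c (pderiv a X) y) (pderiv d (pderiv b X) y)
      + (B (pderiv d (pderiv a X) y) (pderiv c (pderiv b X) y)
      + B (pderiv a X y) (pderiv d (pderiv c (pderiv b X)) y)) := by
    intro a b c d
    have db : ∀ f g : Coord4 → W, DifferentiableAt ℝ f y → DifferentiableAt ℝ g y →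
        DifferentiableAt ℝ (fun z => B (f z) (g z)) y := fun f g hf hg =>
      (B.hasFDerivAt_of_bilinear hf.hasFDerivAt hg.hasFDerivAt).differentiableAt
    rw [partialDeriv_eq_pderiv, pderiv_congr hV (fun z hz => g1 z hz a b c) hy,
      pderiv_add (db _ _ (d2 y hy a c) (d1 y hy b)) (db _ _ (d1 y hy a) (d2 y hy b c)),
      pderiv_bilin B (d2 y hy a c) (d1 y hy b), pderiv_bilin B (d1 y hy a) (d2 y hy b c)]
  have c2 : ∀ z ∈ V, ∀ a b, pderiv a (pderiv b X) z = pderiv b (pderiv a X) z :=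
    fun z hz a b => pderiv_comm hV hX hz a b
  have c3 : ∀ a b c, pderiv a (pderiv b (pderiv c X)) y = pderiv a (pderiv c (pderiv b X)) y :=
    fun a b c => pderiv_congr hV (fun z hz => c2 z hz b c) hy a
  have c3' : ∀ a b c, pderiv a (pderiv b (pderiv c X)) y = pderiv b (pderiv a (pderiv c X)) y :=
    fun a b c => pderiv_comm hV (h1 c) hy a b
  -- The Christoffel symbols of the first kind are the tangential components of the second
  -- derivatives of `X`; the normal components will be `H₁` and `H₂`.
  have hΓ : ∀ e a b, lowerChristoffel G e a b y = B (pderiv e X y) (pderiv a (pderiv b X) y) := by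
    intro e a b
    rw [lowerChristoffel, g1 y hy, g1 y hy, g1 y hy, c2 y hy a e, c2 y hy b e, c2 y hy b a,
      hB (pderiv e (pderiv b X) y)]
    ring
  obtain ⟨ε₁, ε₂, n₁, n₂, hn⟩ := exists_normal_coordinates hW
    (LinearMap.mk₂ ℝ (fun v w => B v w) (by simp) (by simp) (by simp) (by simp)) ⟨fun v w => hB v w⟩
    (fun a => pderiv a X y) (G y) (hG y hy) hdet
    (fun p : Fin 4 × Fin 4 => pderiv p.1 (pderiv p.2 X) y)
  simp only [LinearMap.mk₂_apply] at hn
  have hn' : ∀ a b c d, ε₁ * (n₁ (pderiv a (pderiv b X) y) * n₁ (pderiv c (pderiv d X) y))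
      + ε₂ * (n₂ (pderiv a (pderiv b X) y) * n₂ (pderiv c (pderiv d X) y))
      = B (pderiv a (pderiv b X) y) (pderiv c (pderiv d X) y)
      - ∑ e, ∑ f, lowerChristoffel G e a b y * (G y)⁻¹ e f * lowerChristoffel G f c d y := by
    intro a b c d
    simp only [hΓ]
    exact hn (a, b) (c, d)
  refine ⟨ε₁, ε₂, Matrix.of fun a b => n₁ (pderiv a (pderiv b X) y),
    Matrix.of fun a b => n₂ (pderiv a (pderiv b X) y), ?_, ?_, ?_⟩
  · intro a b; simp only [Matrix.of_apply]; rw [c2 y hy]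
  · intro a b; simp only [Matrix.of_apply]; rw [c2 y hy]
  · intro a b c d
    have e1 := hn' a c b d
    have e2 := hn' a d b c
    simp only [Matrix.of_apply, lowerRiemann, Finset.sum_sub_distrib]
    -- The third derivatives of `X` cancel in this combination of second derivatives of the metric.
    have hs : (1 / 2) * (partialDeriv b (partialDeriv c fun z => G z a d) y
        + partialDeriv a (partialDeriv d fun z => G z b c) y
        - partialDeriv b (partialDeriv d fun z => G z a c) y
        - partialDeriv a (partialDeriv c fun z => G z b d) y) =
        B (pderiv a (pderiv c X) y) (pderiv b (pderiv d X) y)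
        - B (pderiv a (pderiv d X) y) (pderiv b (pderiv c X) y) := by
      simp only [g2]
      rw [c3 b c a, c3' b a c, c3 a b c, c3 b c d, c3 a d b, c3' a b d, c3 b a d, c3 a d c,
        c2 y hy c a, c2 y hy d b, c2 y hy c b, c2 y hy d a, c2 y hy b a, c2 y hy d c,
        hB (pderiv b (pderiv d X) y), hB (pderiv b (pderiv c X) y)]
      ring
    rw [hs]
    linear_combination e2 - e1

/-! ### A criterion for the embedding class to be greater than two -/

/-- The flat metric of `ℝ^{r,s}` as a continuous bilinear map. -/
def pseudoEuclideanCLM (r s : ℕ) :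
    PseudoEuclidean r s →L[ℝ] PseudoEuclidean r s →L[ℝ] ℝ :=
  LinearMap.toContinuousLinearMap <| LinearMap.toContinuousLinearMap.toLinearMap.comp <|
    LinearMap.mk₂ ℝ (fun v w : PseudoEuclidean r s => pseudoEuclideanForm v w)
      (fun v v' w => by
        simp only [pseudoEuclideanForm, Prod.fst_add, Prod.snd_add, Pi.add_apply, add_mul,
          Finset.sum_add_distrib]; ring)
      (fun c v w => by
        simp only [pseudoEuclideanForm, Prod.smul_fst, Prod.smul_snd, Pi.smul_apply, smul_eq_mul,
          mul_assoc, ← Finset.mul_sum]; ring)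
      (fun v w w' => by
        simp only [pseudoEuclideanForm, Prod.fst_add, Prod.snd_add, Pi.add_apply, mul_add,
          Finset.sum_add_distrib]; ring)
      (fun c v w => by
        simp only [pseudoEuclideanForm, Prod.smul_fst, Prod.smul_snd, Pi.smul_apply, smul_eq_mul,
          mul_left_comm _ c, ← Finset.mul_sum]; ring)

lemma pseudoEuclideanCLM_apply {r s : ℕ} (v w : PseudoEuclidean r s) :
    pseudoEuclideanCLM r s v w = pseudoEuclideanForm v w := rfl

lemma pseudoEuclideanCLM_comm {r s : ℕ} (v w : PseudoEuclidean r s) :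
    pseudoEuclideanCLM r s v w = pseudoEuclideanCLM r s w v := by
  simp only [pseudoEuclideanCLM_apply, pseudoEuclideanForm, mul_comm]

/-- If in some parametrization of a part of `U` the curvature tensor at a point does not satisfy a
Gauss equation in codimension two, then the embedding class of `U` is greater than two. -/
theorem two_lt_isometricEmbeddingClass {E : Type*} [NormedAddCommGroup E] [NormedSpace ℝ E]
    (hE : finrank ℝ E = 4) {M : Type*} [TopologicalSpace M] [ChartedSpace E M]
    {g : MetricField E M} {U : Set M} (hU : IsOpen U) {V : Set Coord4} (hV : IsOpen V)
    {ψ : Coord4 → M} (hψU : MapsTo ψ V U) (hψ : ContMDiffOn 𝓘(ℝ, Coord4) 𝓘(ℝ, E) ∞ ψ V)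
    {G : Coord4 → Matrix (Fin 4) (Fin 4) ℝ}
    (hG : ∀ z ∈ V, ∀ a b, G z a b = g (ψ z) (mfderiv 𝓘(ℝ, Coord4) 𝓘(ℝ, E) ψ z (basisVec a))
      (mfderiv 𝓘(ℝ, Coord4) 𝓘(ℝ, E) ψ z (basisVec b)))
    {y : Coord4} (hy : y ∈ V) (hdet : (G y).det ≠ 0)
    (hR : ∀ ε₁ ε₂ H₁ H₂, ¬ IsGaussTensor (lowerRiemann G y) ε₁ ε₂ H₁ H₂) :
    2 < isometricEmbeddingClass g U := by
  -- In `ℕ∞` the strict bound follows from the bound by 3, and that only requires excluding each `k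
  -- ≤ 2`.
  have h3 : (3 : ℕ∞) ≤ isometricEmbeddingClass g U := by
    refine le_sInf ?_
    rintro _ ⟨k, ⟨r, s, hrs, ι, hι⟩, rfl⟩
    by_contra hk
    have hk' : k ≤ 2 := by
      by_contra h
      exact hk (Nat.cast_le.2 (by omega : 3 ≤ k))
    have hfin : finrank ℝ (PseudoEuclidean r s) ≤ 6 := by
      rw [finrank_prod, finrank_fin_fun, finrank_fin_fun]; omega
    have hX : ContDiffOn ℝ ∞ (ι ∘ ψ) V := by
      rw [← contMDiffOn_iff_contDiffOn]
      exact hι.contMDiffOn.comp hψ hψU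
    obtain ⟨ε₁, ε₂, H₁, H₂, h⟩ := exists_isGaussTensor hfin (pseudoEuclideanCLM r s)
      pseudoEuclideanCLM_comm hV hX (G := G) (fun z hz a b => by
        have hd : mfderiv 𝓘(ℝ, Coord4) 𝓘(ℝ, PseudoEuclidean r s) (ι ∘ ψ) z =
            (mfderiv 𝓘(ℝ, E) 𝓘(ℝ, PseudoEuclidean r s) ι (ψ z)).comp
              (mfderiv 𝓘(ℝ, Coord4) 𝓘(ℝ, E) ψ z) :=
          mfderiv_comp z
            ((hι.contMDiffOn.contMDiffAt (hU.mem_nhds (hψU hz))).mdifferentiableAt (by simp))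
            ((hψ.contMDiffAt (hV.mem_nhds hz)).mdifferentiableAt (by simp))
        rw [mfderiv_eq_fderiv] at hd
        rw [hG z hz, ← hι.isometric _ (hψU hz), pseudoEuclideanCLM_apply]
        have e : ∀ a, pderiv a (ι ∘ ψ) z = mfderiv 𝓘(ℝ, E) 𝓘(ℝ, PseudoEuclidean r s) ι (ψ z)
            (mfderiv 𝓘(ℝ, Coord4) 𝓘(ℝ, E) ψ z (basisVec a)) := fun a => by
          rw [pderiv, hd]; rfl
        rw [e, e]) hy hdet
    exact hR _ _ _ _ h
  exact lt_of_lt_of_le (by norm_num) h3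

/-! ### Two-jets -/

/-- The function `f` is twice continuously differentiable at `y`, with value `v`, gradient `p` and
Hessian `q` there. -/
structure HasJet (f : Coord4 → ℝ) (y : Coord4) (v : ℝ) (p : Fin 4 → ℝ) (q : Fin 4 → Fin 4 → ℝ) :
    Prop where
  contDiffAt : ContDiffAt ℝ 2 f y
  value : f y = v
  grad : ∀ i, pderiv i f y = p i
  hess : ∀ i j, pderiv i (pderiv j f) y = q i j

namespace HasJet

variable {f g : Coord4 → ℝ} {y : Coord4} {v v' : ℝ} {p p' : Fin 4 → ℝ} {q q' : Fin 4 → Fin 4 → ℝ}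

lemma eventually_differentiableAt (hf : ContDiffAt ℝ 2 f y) :
    ∀ᶠ z in nhds y, DifferentiableAt ℝ f z := by
  have := hf.eventually (by simp)
  filter_upwards [this] with z hz using hz.differentiableAt (by simp)

lemma differentiableAt_pderiv (hf : ContDiffAt ℝ 2 f y) (i : Fin 4) :
    DifferentiableAt ℝ (pderiv i f) y :=
  ((hf.fderiv_right (m := 1) (by norm_num)).differentiableAt (by simp)).clm_apply
    (differentiableAt_const _)

/-- The Hessian is the derivative of the gradient, so the formula for the gradient must hold near
`y`, whereas its values and derivatives are needed only at `y`. -/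
lemma of_eventually (hf : ContDiffAt ℝ 2 f y) (hv : f y = v) {f' : Fin 4 → Coord4 → ℝ}
    (h : ∀ i, ∀ᶠ z in nhds y, pderiv i f z = f' i z) (hp : ∀ i, f' i y = p i)
    (hq : ∀ i j, pderiv i (f' j) y = q i j) : HasJet f y v p q where
  contDiffAt := hf
  value := hv
  grad i := by rw [(h i).self_of_nhds, hp]
  hess i j := by
    rw [← hq, pderiv, Filter.EventuallyEq.fderiv_eq (h j)]; rfl

lemma congr (hf : HasJet f y v p q) (hv : v = v') (hp : p = p') (hq : q = q') :
    HasJet f y v' p' q' := by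
  subst hv hp hq; exact hf

lemma congr_of_eventuallyEq (hf : HasJet f y v p q) (h : ∀ᶠ z in nhds y, g z = f z) :
    HasJet g y v p q where
  contDiffAt := hf.contDiffAt.congr_of_eventuallyEq h
  value := by rw [h.self_of_nhds, hf.value]
  grad i := by rw [pderiv, Filter.EventuallyEq.fderiv_eq h]; exact hf.grad i
  hess i j := by
    rw [← hf.hess]
    have : pderiv j g =ᶠ[nhds y] pderiv j f := by
      filter_upwards [h.eventually_nhds] with z hz
      rw [pderiv, Filter.EventuallyEq.fderiv_eq hz]; rfl
    rw [pderiv, this.fderiv_eq]; rfl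

lemma pderiv_const (i : Fin 4) (c : ℝ) (z : Coord4) : pderiv i (fun _ => c) z = 0 := by
  simp [pderiv]

lemma const (c : ℝ) (y : Coord4) : HasJet (fun _ => c) y c 0 0 :=
  of_eventually contDiffAt_const rfl (fun i => .of_forall (pderiv_const i c)) (fun _ => rfl)
    fun i _ => pderiv_const i 0 y

lemma coord (k : Fin 4) (y : Coord4) : HasJet (fun z => z k) y (y k) (Pi.single k 1) 0 := by
  have h : ∀ i z, pderiv i (fun z : Coord4 => z k) z = (Pi.single k 1 : Fin 4 → ℝ) i := by
    intro i z
    have : HasFDerivAt (fun z : Coord4 => z k) (EuclideanSpace.proj k : Coord4 →L[ℝ] ℝ) z :=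
      (EuclideanSpace.proj k : Coord4 →L[ℝ] ℝ).hasFDerivAt
    rw [pderiv, this.fderiv]
    simp [Pi.single_apply, eq_comm]
  exact of_eventually (EuclideanSpace.proj k : Coord4 →L[ℝ] ℝ).contDiff.contDiffAt rfl
    (fun i => .of_forall (h i)) (fun _ => rfl) fun i _ => pderiv_const i _ y

lemma add (hf : HasJet f y v p q) (hg : HasJet g y v' p' q') :
    HasJet (fun z => f z + g z) y (v + v') (p + p') (q + q') := by
  refine of_eventually (hf.contDiffAt.add hg.contDiffAt) (by rw [hf.value, hg.value])
    (f' := fun i z => pderiv i f z + pderiv i g z) (fun i => ?_)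
    (fun i => by rw [hf.grad, hg.grad]; rfl) (fun i j => ?_)
  · filter_upwards [eventually_differentiableAt hf.contDiffAt,
      eventually_differentiableAt hg.contDiffAt] with z h1 h2 using pderiv_add h1 h2 i
  · rw [pderiv_add (differentiableAt_pderiv hf.contDiffAt j)
      (differentiableAt_pderiv hg.contDiffAt j), hf.hess, hg.hess]; rfl

lemma mul (hf : HasJet f y v p q) (hg : HasJet g y v' p' q') :
    HasJet (fun z => f z * g z) y (v * v') (fun i => p i * v' + v * p' i)
      (fun i j => q i j * v' + p j * p' i + (p i * p' j + v * q' i j)) := by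
  refine of_eventually (hf.contDiffAt.mul hg.contDiffAt) (by rw [hf.value, hg.value])
    (f' := fun i z => pderiv i f z * g z + f z * pderiv i g z) (fun i => ?_)
    (fun i => by rw [hf.grad, hg.grad, hf.value, hg.value]) (fun i j => ?_)
  · filter_upwards [eventually_differentiableAt hf.contDiffAt,
      eventually_differentiableAt hg.contDiffAt] with z h1 h2 using pderiv_mul h1 h2 i
  · have d1 := (eventually_differentiableAt hf.contDiffAt).self_of_nhds
    have d2 := (eventually_differentiableAt hg.contDiffAt).self_of_nhds
    have e1 := differentiableAt_pderiv hf.contDiffAt j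
    have e2 := differentiableAt_pderiv hg.contDiffAt j
    rw [pderiv_add (f := fun z => pderiv j f z * g z) (g := fun z => f z * pderiv j g z)
      (e1.mul d2) (d1.mul e2), pderiv_mul e1 d2, pderiv_mul d1 e2, hf.hess, hg.hess,
      hf.grad, hg.grad, hf.grad, hg.grad, hf.value, hg.value]

lemma comp (hf : HasJet f y v p q) {φ φ' : ℝ → ℝ} {φ'' : ℝ} (hφ : ContDiffAt ℝ 2 φ v)
    (h1 : ∀ᶠ t in nhds v, HasDerivAt φ (φ' t) t) (h2 : HasDerivAt φ' φ'' v) :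
    HasJet (fun z => φ (f z)) y (φ v) (fun i => φ' v * p i)
      (fun i j => φ'' * p i * p j + φ' v * q i j) := by
  have hv := hf.value
  have d1 := (eventually_differentiableAt hf.contDiffAt).self_of_nhds
  refine of_eventually ?_ (by rw [hv])
    (f' := fun i z => φ' (f z) * pderiv i f z) (fun i => ?_)
    (fun i => by rw [hf.grad, hv]) (fun i j => ?_)
  · exact ContDiffAt.comp y (hv ▸ hφ) hf.contDiffAt
  · have hc : Filter.Tendsto f (nhds y) (nhds v) := hv ▸ hf.contDiffAt.continuousAt
    filter_upwards [eventually_differentiableAt hf.contDiffAt, hc.eventually h1] with z hz hz'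
    have h : HasFDerivAt (fun z => φ (f z)) (φ' (f z) • fderiv ℝ f z) z :=
      hz'.comp_hasFDerivAt z hz.hasFDerivAt
    rw [pderiv, h.fderiv]
    simp [pderiv]
  · have h2' : HasFDerivAt (fun z => φ' (f z)) (φ'' • fderiv ℝ f y) y :=
      (hv ▸ h2 : HasDerivAt φ' φ'' (f y)).comp_hasFDerivAt y d1.hasFDerivAt
    rw [pderiv_mul h2'.differentiableAt (differentiableAt_pderiv hf.contDiffAt j), hf.hess, hv,
      hf.grad, pderiv, h2'.fderiv]
    have := hf.grad i
    rw [pderiv] at this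
    simp [this]

lemma const_mul (c : ℝ) (hf : HasJet f y v p q) :
    HasJet (fun z => c * f z) y (c * v) (fun i => c * p i) (fun i j => c * q i j) := by
  simpa using (const c y).mul hf

lemma sub (hf : HasJet f y v p q) (hg : HasJet g y v' p' q') :
    HasJet (fun z => f z - g z) y (v - v') (p - p') (q - q') := by
  have h := hf.add (hg.const_mul (-1))
  refine (h.congr_of_eventuallyEq (.of_forall fun z => by ring)).congr (by ring) ?_ ?_
  · funext i; simp; ring
  · funext i j; simp; ring

lemma pow_two (hf : HasJet f y v p q) : HasJet (fun z => f z ^ 2) y (v ^ 2)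
    (fun i => 2 * v * p i) (fun i j => 2 * p i * p j + 2 * v * q i j) := by
  refine ((hf.mul hf).congr_of_eventuallyEq (.of_forall fun z => by ring)).congr (by ring) ?_ ?_
  · funext i; ring
  · funext i j; ring

lemma inv (hf : HasJet f y v p q) (hv : v ≠ 0) : HasJet (fun z => (f z)⁻¹) y v⁻¹
    (fun i => -(v ^ 2)⁻¹ * p i) (fun i j => 2 * (v ^ 3)⁻¹ * p i * p j + -(v ^ 2)⁻¹ * q i j) := by
  refine hf.comp (φ := fun t => t⁻¹) (φ' := fun t => -(t ^ 2)⁻¹) (contDiffAt_inv ℝ hv) ?_ ?_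
  · filter_upwards [isOpen_ne.mem_nhds hv] with t ht using hasDerivAt_inv ht
  · have h := ((hasDerivAt_pow 2 v).inv (pow_ne_zero 2 hv)).neg
    refine h.congr_deriv ?_
    field_simp
    norm_num [mul_comm]

lemma sin (hf : HasJet f y v p q) : HasJet (fun z => Real.sin (f z)) y (Real.sin v)
    (fun i => Real.cos v * p i) (fun i j => -Real.sin v * p i * p j + Real.cos v * q i j) :=
  hf.comp Real.contDiff_sin.contDiffAt (.of_forall Real.hasDerivAt_sin) (Real.hasDerivAt_cos v)

end HasJet

/-- The Riemann tensor from the two-jets of the components of the metric. -/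
lemma lowerRiemann_eq_of_hasJet {G : Coord4 → Matrix (Fin 4) (Fin 4) ℝ} {y : Coord4}
    {v : Fin 4 → Fin 4 → ℝ} {p : Fin 4 → Fin 4 → Fin 4 → ℝ}
    {q : Fin 4 → Fin 4 → Fin 4 → Fin 4 → ℝ} {D : Fin 4 → ℝ}
    (h : ∀ a b, HasJet (fun z => G z a b) y (v a b) (p a b) (q a b))
    (hD : (G y)⁻¹ = Matrix.diagonal D)
    (a b c d : Fin 4) : lowerRiemann G y a b c d =
      (1 / 2) * (q a d b c + q b c a d - q a c b d - q b d a c)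
      - (1 / 4) * ∑ e, D e * ((p e c a + p e a c - p a c e) * (p e d b + p e b d - p b d e)
        - (p e d a + p e a d - p a d e) * (p e c b + p e b c - p b c e)) := by
  have h1 : ∀ a b i, partialDeriv i (fun z => G z a b) y = p a b i := fun a b i => (h a b).grad i
  have h2 : ∀ a b i j, partialDeriv i (partialDeriv j fun z => G z a b) y = q a b i j :=
    fun a b i j => (h a b).hess i j
  simp only [lowerRiemann, lowerChristoffel, h1, h2, hD]
  congr 1
  rw [Finset.mul_sum]
  refine Finset.sum_congr rfl fun e _ => ?_
  rw [Finset.sum_eq_single e]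
  · rw [Matrix.diagonal_apply_eq]; ring
  · intro f _ hf
    rw [Matrix.diagonal_apply_ne _ hf.symm]; ring
  · simp

/-! ### The Kerr metrics -/

/-- The gradient of a function of the second and third coordinates. -/
def grad₂ (p₁ p₂ : ℝ) : Fin 4 → ℝ := ![0, p₁, p₂, 0]

/-- The Hessian of a function of the second and third coordinates. -/
def hess₂ (q₁₁ q₁₂ q₂₂ : ℝ) : Fin 4 → Fin 4 → ℝ :=
  ![![0, 0, 0, 0], ![0, q₁₁, q₁₂, 0], ![0, q₁₂, q₂₂, 0], ![0, 0, 0, 0]]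

/-- The two-jet of a function which depends on the second and third coordinates only. -/
abbrev HasJet₂ (f : Coord4 → ℝ) (y : Coord4) (v p₁ p₂ q₁₁ q₁₂ q₂₂ : ℝ) : Prop :=
  HasJet f y v (grad₂ p₁ p₂) (hess₂ q₁₁ q₁₂ q₂₂)

namespace HasJet₂

variable {f g : Coord4 → ℝ} {y : Coord4} {v p₁ p₂ q₁₁ q₁₂ q₂₂ v' p₁' p₂' q₁₁' q₁₂' q₂₂' : ℝ}

lemma const (c : ℝ) (y : Coord4) : HasJet₂ (fun _ => c) y c 0 0 0 0 0 := by
  refine (HasJet.const c y).congr rfl ?_ ?_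
  · funext i; fin_cases i <;> rfl
  · funext i j; fin_cases i <;> fin_cases j <;> rfl

lemma mul (hf : HasJet₂ f y v p₁ p₂ q₁₁ q₁₂ q₂₂) (hg : HasJet₂ g y v' p₁' p₂' q₁₁' q₁₂' q₂₂') :
    HasJet₂ (fun z => f z * g z) y (v * v') (p₁ * v' + v * p₁') (p₂ * v' + v * p₂')
      (q₁₁ * v' + 2 * p₁ * p₁' + v * q₁₁') (q₁₂ * v' + p₁ * p₂' + p₂ * p₁' + v * q₁₂')
      (q₂₂ * v' + 2 * p₂ * p₂' + v * q₂₂') := by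
  refine (HasJet.mul hf hg).congr rfl ?_ ?_
  · funext i; fin_cases i <;> simp [grad₂]
  · funext i j; fin_cases i <;> fin_cases j <;> simp [grad₂, hess₂] <;> ring

lemma add (hf : HasJet₂ f y v p₁ p₂ q₁₁ q₁₂ q₂₂) (hg : HasJet₂ g y v' p₁' p₂' q₁₁' q₁₂' q₂₂') :
    HasJet₂ (fun z => f z + g z) y (v + v') (p₁ + p₁') (p₂ + p₂')
      (q₁₁ + q₁₁') (q₁₂ + q₁₂') (q₂₂ + q₂₂') := by
  refine (HasJet.add hf hg).congr rfl ?_ ?_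
  · funext i; fin_cases i <;> simp [grad₂]
  · funext i j; fin_cases i <;> fin_cases j <;> simp [hess₂]

lemma const_mul (c : ℝ) (hf : HasJet₂ f y v p₁ p₂ q₁₁ q₁₂ q₂₂) :
    HasJet₂ (fun z => c * f z) y (c * v) (c * p₁) (c * p₂) (c * q₁₁) (c * q₁₂) (c * q₂₂) := by
  refine (HasJet.const_mul c hf).congr rfl ?_ ?_
  · funext i; fin_cases i <;> simp [grad₂]
  · funext i j; fin_cases i <;> fin_cases j <;> simp [hess₂]

lemma pow_two (hf : HasJet₂ f y v p₁ p₂ q₁₁ q₁₂ q₂₂) :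
    HasJet₂ (fun z => f z ^ 2) y (v ^ 2) (2 * v * p₁) (2 * v * p₂) (2 * p₁ ^ 2 + 2 * v * q₁₁)
      (2 * p₁ * p₂ + 2 * v * q₁₂) (2 * p₂ ^ 2 + 2 * v * q₂₂) := by
  refine (HasJet.pow_two hf).congr rfl ?_ ?_
  · funext i; fin_cases i <;> simp [grad₂]
  · funext i j; fin_cases i <;> fin_cases j <;> simp [grad₂, hess₂] <;> ring

lemma inv (hf : HasJet₂ f y v p₁ p₂ q₁₁ q₁₂ q₂₂) (hv : v ≠ 0) :
    HasJet₂ (fun z => (f z)⁻¹) y v⁻¹ (-p₁ / v ^ 2) (-p₂ / v ^ 2)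
      (2 * p₁ ^ 2 / v ^ 3 - q₁₁ / v ^ 2) (2 * p₁ * p₂ / v ^ 3 - q₁₂ / v ^ 2)
      (2 * p₂ ^ 2 / v ^ 3 - q₂₂ / v ^ 2) := by
  refine (HasJet.inv hf hv).congr rfl ?_ ?_
  · funext i; fin_cases i <;> simp [grad₂] <;> ring
  · funext i j; fin_cases i <;> fin_cases j <;> simp [grad₂, hess₂] <;> ring

lemma congr (hf : HasJet₂ f y v p₁ p₂ q₁₁ q₁₂ q₂₂) (hfg : ∀ z, g z = f z) (hv : v = v')
    (h₁ : p₁ = p₁') (h₂ : p₂ = p₂') (h₁₁ : q₁₁ = q₁₁') (h₁₂ : q₁₂ = q₁₂') (h₂₂ : q₂₂ = q₂₂') :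
    HasJet₂ g y v' p₁' p₂' q₁₁' q₁₂' q₂₂' := by
  subst hv h₁ h₂ h₁₁ h₁₂ h₂₂
  exact hf.congr_of_eventuallyEq (.of_forall hfg)

lemma congr_fun (hf : HasJet₂ f y v p₁ p₂ q₁₁ q₁₂ q₂₂) (hfg : ∀ z, g z = f z) :
    HasJet₂ g y v p₁ p₂ q₁₁ q₁₂ q₂₂ := hf.congr_of_eventuallyEq (.of_forall hfg)

end HasJet₂

/-- The two Kerr metrics: the Lorentzian one for `κ = 1`, and the Riemannian one for `κ = -1`. -/
def kerrForm (κ m a : ℝ) (x v w : Coord4) : ℝ :=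
  let S := x 1 ^ 2 + κ * a ^ 2 * Real.cos (x 2) ^ 2
  let D := x 1 ^ 2 - 2 * m * x 1 + κ * a ^ 2
  let α : Coord4 → ℝ := fun v => v 0 - a * Real.sin (x 2) ^ 2 * v 3
  let β : Coord4 → ℝ := fun v => (x 1 ^ 2 + κ * a ^ 2) * v 3 - κ * a * v 0
  Real.sin (x 2) ^ 2 * S⁻¹ * (β v * β w) - κ * D * S⁻¹ * (α v * α w)
    + S * D⁻¹ * (v 1 * w 1) + S * (v 2 * w 2)

lemma lorentzianKerr_eq (m a : ℝ) (x v w : Coord4) :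
    lorentzianKerr m a x v w = kerrForm 1 m a x v w := by
  simp [lorentzianKerr, kerrForm, formSq, coordForm]
  ring

lemma riemannianKerr_eq (m a : ℝ) (x v w : Coord4) :
    riemannianKerr m a x v w = kerrForm (-1) m a x v w := by
  simp [riemannianKerr, kerrForm, formSq, coordForm]
  ring

/-- An orthogonal frame at the point `x` for the Kerr metric. -/
def kerrFrame (κ m a : ℝ) (x : Coord4) : Fin 4 → Coord4 :=
  ![!₂[x 1 ^ 2 + κ * a ^ 2, 0, 0, κ * a], !₂[0, x 1 ^ 2 - 2 * m * x 1 + κ * a ^ 2, 0, 0],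
    !₂[0, 0, Real.sin (x 2), 0], !₂[a * Real.sin (x 2) ^ 2, 0, 0, 1]]

/-- The linear coordinates centered at `x` given by the orthogonal frame of the Kerr metric. -/
def kerrCoord (κ m a : ℝ) (x z : Coord4) : Coord4 := x + ∑ i, z i • kerrFrame κ m a x i

/-- The components of the Kerr metric in the coordinates `kerrCoord`. -/
def kerrMatrix (κ m a : ℝ) (x z : Coord4) : Matrix (Fin 4) (Fin 4) ℝ :=
  Matrix.of fun i j => kerrForm κ m a (kerrCoord κ m a x z) (kerrFrame κ m a x i)
    (kerrFrame κ m a x j)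

lemma kerrCoord_one (κ m a : ℝ) (x z : Coord4) :
    kerrCoord κ m a x z 1 = x 1 + (x 1 ^ 2 - 2 * m * x 1 + κ * a ^ 2) * z 1 := by
  simp [kerrCoord, kerrFrame, Fin.sum_univ_four, mul_comm]

lemma kerrCoord_two (κ m a : ℝ) (x z : Coord4) :
    kerrCoord κ m a x z 2 = x 2 + Real.sin (x 2) * z 2 := by
  simp [kerrCoord, kerrFrame, Fin.sum_univ_four, mul_comm]

/-! ### Two-jets of the Kerr components in frame coordinates. -/

section jets

variable {κ m a r c S D P : ℝ} {x : Coord4}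

/-- The two-jet of the radial coordinate. -/
lemma kerr_jet_radius (hr : x 1 = r) (hD : D = r ^ 2 - 2 * m * r + κ * a ^ 2) :
    HasJet₂ (fun z => kerrCoord κ m a x z 1) 0 r D 0 0 0 0 := by
  subst hr
  refine (((HasJet.const (x 1) 0).add ((HasJet.coord 1 0).const_mul D)).congr_of_eventuallyEq
    (.of_forall fun z => ?_)).congr (by simp) ?_ ?_
  · rw [kerrCoord_one, hD]
  · funext i; fin_cases i <;> simp [grad₂]
  · funext i j; fin_cases i <;> fin_cases j <;> simp [hess₂]

/-- The two-jet of `sin² θ`. -/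
lemma kerr_jet_sinSq (hc : Real.cos (x 2) = c) (hP : P = 1 - c ^ 2) :
    HasJet₂ (fun z => Real.sin (kerrCoord κ m a x z 2) ^ 2) 0 P 0 (2 * P * c) 0 0
      (2 * P * (1 - 2 * P)) := by
  have hs : Real.sin (x 2) ^ 2 = P := by rw [Real.sin_sq, hc, hP]
  have h2 : HasJet₂ (fun z => kerrCoord κ m a x z 2) 0 (x 2) 0 (Real.sin (x 2)) 0 0 0 := by
    refine (((HasJet.const (x 2) 0).add
      ((HasJet.coord 2 0).const_mul (Real.sin (x 2)))).congr_of_eventuallyEq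
      (.of_forall fun z => ?_)).congr (by simp) ?_ ?_
    · rw [kerrCoord_two]
    · funext i; fin_cases i <;> simp [grad₂]
    · funext i j; fin_cases i <;> fin_cases j <;> simp [hess₂]
  refine ((HasJet.sin h2).pow_two).congr hs ?_ ?_
  · funext i; fin_cases i <;> simp [grad₂]
    rw [← hs, ← hc]; ring
  · funext i j; fin_cases i <;> fin_cases j <;> simp [grad₂, hess₂]
    have : 1 - 2 * P = c ^ 2 - P := by rw [hP]; ring
    rw [this, ← hs, ← hc]; ring

lemma kerr_jet_S (hr : x 1 = r) (hD : D = r ^ 2 - 2 * m * r + κ * a ^ 2)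
    (hc : Real.cos (x 2) = c) (hP : P = 1 - c ^ 2) (hS : S = r ^ 2 + κ * a ^ 2 * c ^ 2) :
    HasJet₂ (fun z => kerrCoord κ m a x z 1 ^ 2
        + κ * a ^ 2 * Real.cos (kerrCoord κ m a x z 2) ^ 2) 0
      S (2 * r * D) (-2 * κ * a ^ 2 * P * c) (2 * D ^ 2) 0
      (-2 * κ * a ^ 2 * P * (1 - 2 * P)) := by
  refine ((kerr_jet_radius hr hD).pow_two.add ((HasJet₂.const (κ * a ^ 2) 0).add
    ((kerr_jet_sinSq (κ := κ) (m := m) (a := a) hc hP).const_mul (-(κ * a ^ 2))))).congr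
    (fun z => ?_) ?_ ?_ ?_ ?_ ?_ ?_
  -- Writing `cos²` as `1 - sin²` leaves only the jets of `r` and `sin² θ` to be combined.
  · rw [Real.cos_sq']; ring
  · rw [hP, hS]; ring
  all_goals ring

lemma kerr_jet_D (hr : x 1 = r) (hD : D = r ^ 2 - 2 * m * r + κ * a ^ 2) :
    HasJet₂ (fun z => kerrCoord κ m a x z 1 ^ 2 - 2 * m * kerrCoord κ m a x z 1 + κ * a ^ 2) 0
      D (2 * (r - m) * D) 0 (2 * D ^ 2) 0 0 := by
  refine ((kerr_jet_radius hr hD).pow_two.add (((kerr_jet_radius hr hD).const_mul (-2 * m)).add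
    (HasJet₂.const (κ * a ^ 2) 0))).congr (fun z => ?_) ?_ ?_ ?_ ?_ ?_ ?_
  · ring
  · rw [hD]; ring
  all_goals ring

/-- The gradient and the Hessian of the Kerr metric in the frame coordinates. -/
def kerrJet (κ m a r c S D P : ℝ) : Fin 4 → Fin 4 → Fin 6 → ℝ :=
  let j₀₃ := ![0, 2 * κ * a * r * D * P, 2 * κ * a * D * P * c, 2 * κ * a * P * D ^ 2,
    2 * κ * a * D * P * c * (2 * (r - m) + 4 * m * r ^ 2 / S), 2 * κ * a * D * P * (1 - 2 * P)]
  let S₂ := -2 * κ * a ^ 2 * P * c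
  let S₂₂ := -2 * κ * a ^ 2 * P * (1 - 2 * P)
  let D' := 2 * (r - m)
  ![![![-κ * D * S, -κ * D * (D' * S - 2 * r * D), -κ * D * S₂,
      -κ * D ^ 2 * (2 * S - 4 * r * D' - 2 * D) - 8 * κ * r ^ 2 * D ^ 2 * (S - 2 * m * r) / S,
      -κ * D * D' * S₂, -κ * D * S₂₂], 0, 0, j₀₃],
    ![0, ![S * D, D * (2 * r * D - S * D'), D * S₂, 2 * D ^ 3 - 4 * r * D ^ 2 * D'
      - 2 * S * D ^ 2 + 2 * S * D * D' ^ 2, -D * D' * S₂, D * S₂₂], 0, 0],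
    ![0, 0, ![S * P, 2 * r * P * D, P * S₂, 2 * P * D ^ 2, 0, P * S₂₂], 0],
    ![j₀₃, 0, 0, ![P * S, 2 * r * D * P, 2 * P * c * S - P * S₂, 2 * P * D ^ 2,
      4 * r * D * P * c, 2 * P * (1 - 2 * P) * S - 4 * P * c * S₂ - P * S₂₂
      - 8 * κ * a ^ 2 * P ^ 2 * c ^ 2 * (S - 2 * m * r) / S]]]

/-- The frame is the Carter frame rescaled to avoid square roots. At the centre the one-form `α` of
`kerrForm` vanishes on vector 3 and `β` on vector 0, so the metric is diagonal there; elsewhere its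
components depend only on the coordinates 1 and 2. -/
lemma kerrMatrix_hasJet (hr : x 1 = r) (hD : D = r ^ 2 - 2 * m * r + κ * a ^ 2)
    (hc : Real.cos (x 2) = c) (hP : P = 1 - c ^ 2) (hS : S = r ^ 2 + κ * a ^ 2 * c ^ 2)
    (hS0 : S ≠ 0) (hD0 : D ≠ 0) (i j : Fin 4) :
    HasJet₂ (fun z => kerrMatrix κ m a x z i j) 0 (kerrJet κ m a r c S D P i j 0)
      (kerrJet κ m a r c S D P i j 1) (kerrJet κ m a r c S D P i j 2)
      (kerrJet κ m a r c S D P i j 3) (kerrJet κ m a r c S D P i j 4)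
      (kerrJet κ m a r c S D P i j 5) := by
  have hs : Real.sin (x 2) ^ 2 = P := by rw [Real.sin_sq, hc, hP]
  have jr := kerr_jet_radius (κ := κ) (m := m) (a := a) hr hD
  have jP := kerr_jet_sinSq (κ := κ) (m := m) (a := a) hc hP
  have jS := kerr_jet_S hr hD hc hP hS
  have jD := kerr_jet_D hr hD
  have jSi := jS.inv hS0
  have jDi := jD.inv hD0
  -- `ja0`, `ja3` are the jets of `α` on the frame vectors 0 and 3; `jb0`, `jb3` are those of `β`.
  have ja0 : HasJet₂ (fun z => r ^ 2 + κ * a ^ 2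
      - a * Real.sin (kerrCoord κ m a x z 2) ^ 2 * (κ * a)) 0
      S 0 (-2 * κ * a ^ 2 * P * c) 0 0 (-2 * κ * a ^ 2 * P * (1 - 2 * P)) := by
    refine ((HasJet₂.const (r ^ 2 + κ * a ^ 2) 0).add
      (jP.const_mul (-(κ * a ^ 2)))).congr (fun z => by ring) ?_ ?_ ?_ ?_ ?_ ?_
    · rw [hP, hS]; ring
    all_goals ring
  have ja3 : HasJet₂ (fun z => a * P
      - a * Real.sin (kerrCoord κ m a x z 2) ^ 2 * 1) 0
      0 0 (-2 * a * P * c) 0 0 (-2 * a * P * (1 - 2 * P)) := by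
    refine ((HasJet₂.const (a * P) 0).add
      (jP.const_mul (-a))).congr (fun z => by ring) ?_ ?_ ?_ ?_ ?_ ?_
    all_goals ring
  have jb0 : HasJet₂ (fun z => (kerrCoord κ m a x z 1 ^ 2 + κ * a ^ 2) * (κ * a)
      - κ * a * (r ^ 2 + κ * a ^ 2)) 0
      0 (2 * κ * a * r * D) 0 (2 * κ * a * D ^ 2) 0 0 := by
    refine ((jr.pow_two.const_mul (κ * a)).add
      (HasJet₂.const (-(κ * a * r ^ 2)) 0)).congr (fun z => by ring) ?_ ?_ ?_ ?_ ?_ ?_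
    all_goals ring
  have jb3 : HasJet₂ (fun z => (kerrCoord κ m a x z 1 ^ 2 + κ * a ^ 2) * 1
      - κ * a * (a * P)) 0
      S (2 * r * D) 0 (2 * D ^ 2) 0 0 := by
    refine (jr.pow_two.add
      (HasJet₂.const (κ * a ^ 2 - κ * a ^ 2 * P) 0)).congr (fun z => by ring) ?_ ?_ ?_ ?_ ?_ ?_
    · rw [hP, hS]; ring
    all_goals ring
  have jA := (jD.mul jSi).const_mul (-κ)
  have jB := jP.mul jSi
  have zero : ∀ f : Coord4 → ℝ, (∀ z, f z = 0) → HasJet₂ f 0 0 0 0 0 0 0 := fun f hf =>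
    (HasJet₂.const 0 0).congr_fun hf
  have e00 := (jA.mul (ja0.mul ja0)).add (jB.mul (jb0.mul jb0))
  have e03 := (jA.mul (ja0.mul ja3)).add (jB.mul (jb0.mul jb3))
  have e33 := (jA.mul (ja3.mul ja3)).add (jB.mul (jb3.mul jb3))
  have e11 := (jS.mul jDi).const_mul (D * D)
  have e22 := jS.const_mul P
  have j03 : HasJet₂ (fun z => kerrMatrix κ m a x z 0 3) 0 0 (2 * κ * a * r * D * P)
      (2 * κ * a * D * P * c) (2 * κ * a * P * D ^ 2)
      (2 * κ * a * D * P * c * (2 * (r - m) + 4 * m * r ^ 2 / S))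
      (2 * κ * a * D * P * (1 - 2 * P)) := by
    refine e03.congr (fun z => ?_) ?_ ?_ ?_ ?_ ?_ ?_
    · simp [kerrMatrix, kerrForm, kerrFrame, hr, hs]; ring
    all_goals field_simp
    all_goals subst hP hS hD
    all_goals ring
  have symm : ∀ z, kerrMatrix κ m a x z 3 0 = kerrMatrix κ m a x z 0 3 := fun z => by
    simp only [kerrMatrix, kerrForm, Matrix.of_apply]; ring
  fin_cases i <;> fin_cases j
  -- The entry `(i, j)` is goal `4 i + j + 1`. Treating the nonzero entries from the last to the
  -- first keeps the numbers of the open ones valid.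
  on_goal 16 =>
    refine e33.congr (fun z => ?_) ?_ ?_ ?_ ?_ ?_ ?_
    · simp [kerrMatrix, kerrForm, kerrFrame, hs]; ring
    all_goals simp [kerrJet]
    all_goals field_simp
    all_goals subst hP hS hD
    all_goals ring
  on_goal 13 => exact j03.congr_fun symm
  on_goal 11 =>
    refine e22.congr (fun z => ?_) ?_ ?_ ?_ ?_ ?_ ?_
    · simp [kerrMatrix, kerrForm, kerrFrame, ← hs]; ring
    all_goals simp [kerrJet]
    all_goals ring
  on_goal 6 =>
    refine e11.congr (fun z => ?_) ?_ ?_ ?_ ?_ ?_ ?_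
    · simp [kerrMatrix, kerrForm, kerrFrame, hr, hD]; ring
    all_goals simp [kerrJet]
    all_goals field_simp
    all_goals ring
  on_goal 4 => exact j03
  on_goal 1 =>
    refine e00.congr (fun z => ?_) ?_ ?_ ?_ ?_ ?_ ?_
    · simp [kerrMatrix, kerrForm, kerrFrame, hr]; ring
    all_goals simp [kerrJet]
    all_goals field_simp
    all_goals subst hP hS hD
    all_goals ring
  all_goals exact zero _ fun z => by simp [kerrMatrix, kerrForm, kerrFrame]

end jets

/-! ### The curvature of the Kerr metrics. -/

section KerrCurvature

variable {κ m a r c S D P : ℝ} {x : Coord4}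

lemma kerrMatrix_zero_eq (hr : x 1 = r) (hD : D = r ^ 2 - 2 * m * r + κ * a ^ 2)
    (hc : Real.cos (x 2) = c) (hP : P = 1 - c ^ 2) (hS : S = r ^ 2 + κ * a ^ 2 * c ^ 2)
    (hS0 : S ≠ 0) (hD0 : D ≠ 0) :
    kerrMatrix κ m a x 0 = Matrix.diagonal ![-κ * D * S, S * D, S * P, P * S] := by
  ext i j
  rw [(kerrMatrix_hasJet hr hD hc hP hS hS0 hD0 i j).value]
  fin_cases i <;> fin_cases j <;> simp [kerrJet]

/-- The Riemann tensor of the Kerr metrics at the center of the frame coordinates. -/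
lemma kerr_lowerRiemann (hr : x 1 = r) (hD : D = r ^ 2 - 2 * m * r + κ * a ^ 2)
    (hc : Real.cos (x 2) = c) (hP : P = 1 - c ^ 2) (hS : S = r ^ 2 + κ * a ^ 2 * c ^ 2)
    (hS0 : S ≠ 0) (hD0 : D ≠ 0) (hP0 : P ≠ 0) (hκ : κ ≠ 0) (i j k l : Fin 4) :
    lowerRiemann (kerrMatrix κ m a x) 0 i j k l =
      let p := fun i j => grad₂ (kerrJet κ m a r c S D P i j 1) (kerrJet κ m a r c S D P i j 2)
      let q := fun i j => hess₂ (kerrJet κ m a r c S D P i j 3) (kerrJet κ m a r c S D P i j 4)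
        (kerrJet κ m a r c S D P i j 5)
      (1 / 2) * (q i l j k + q j k i l - q i k j l - q j l i k)
      - (1 / 4) * ∑ e, (![-κ * D * S, S * D, S * P, P * S] e)⁻¹ *
        ((p e k i + p e i k - p i k e) * (p e l j + p e j l - p j l e)
        - (p e l i + p e i l - p i l e) * (p e k j + p e j k - p j k e)) := by
  refine lowerRiemann_eq_of_hasJet (kerrMatrix_hasJet hr hD hc hP hS hS0 hD0) ?_ i j k l
  refine Matrix.inv_eq_right_inv ?_
  rw [kerrMatrix_zero_eq hr hD hc hP hS hS0 hD0, Matrix.diagonal_mul_diagonal,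
    ← Matrix.diagonal_one]
  congr 1
  funext e
  refine mul_inv_cancel₀ ?_
  fin_cases e <;> simp [hκ, hS0, hD0, hP0]

/-- An algebraic curvature tensor of the form of that of the Kerr metrics in the frame
coordinates: its pattern is that of Petrov type D. -/
structure IsTypeD (R : Fin 4 → Fin 4 → Fin 4 → Fin 4 → ℝ) (g₀ g₁ g₂ g₃ e n : ℝ) : Prop where
  h₀₁₀₁ : R 0 1 0 1 = 2 * e * (g₀ * g₁)
  h₀₁₀₂ : R 0 1 0 2 = 0
  h₀₁₀₃ : R 0 1 0 3 = 0
  h₀₁₁₂ : R 0 1 1 2 = 0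
  h₀₁₁₃ : R 0 1 1 3 = 0
  h₀₁₂₃ : R 0 1 2 3 = 2 * n
  h₀₂₀₂ : R 0 2 0 2 = -e * (g₀ * g₂)
  h₀₂₀₃ : R 0 2 0 3 = 0
  h₀₂₁₂ : R 0 2 1 2 = 0
  h₀₂₁₃ : R 0 2 1 3 = n
  h₀₂₂₃ : R 0 2 2 3 = 0
  h₀₃₀₃ : R 0 3 0 3 = -e * (g₀ * g₃)
  h₀₃₁₂ : R 0 3 1 2 = -n
  h₀₃₁₃ : R 0 3 1 3 = 0
  h₀₃₂₃ : R 0 3 2 3 = 0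
  h₁₂₁₂ : R 1 2 1 2 = -e * (g₁ * g₂)
  h₁₂₁₃ : R 1 2 1 3 = 0
  h₁₂₂₃ : R 1 2 2 3 = 0
  h₁₃₁₃ : R 1 3 1 3 = -e * (g₁ * g₃)
  h₁₃₂₃ : R 1 3 2 3 = 0
  h₂₃₂₃ : R 2 3 2 3 = 2 * e * (g₂ * g₃)

-- For `κ = 1` the electric part is the real part of `m / (r - i a cos θ)³`, and the magnetic part
-- is its imaginary part times `D P S²`. For `κ = -1` the half-sum and half-difference of `m / (r ∓
-- a cos θ)³` take their place, up to sign.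
set_option maxHeartbeats 4000000 in
lemma kerr_isTypeD (hr : x 1 = r) (hD : D = r ^ 2 - 2 * m * r + κ * a ^ 2)
    (hc : Real.cos (x 2) = c) (hP : P = 1 - c ^ 2) (hS : S = r ^ 2 + κ * a ^ 2 * c ^ 2)
    (hS0 : S ≠ 0) (hD0 : D ≠ 0) (hP0 : P ≠ 0) (hκ : κ ≠ 0) :
    IsTypeD (lowerRiemann (kerrMatrix κ m a x) 0) (-κ * D * S) (S * D) (S * P) (P * S)
      (m * r * (r ^ 2 - 3 * κ * a ^ 2 * c ^ 2) / S ^ 3)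
      (κ * m * a * c * (3 * r ^ 2 - κ * a ^ 2 * c ^ 2) * D * P / S) := by
  constructor
  all_goals rw [kerr_lowerRiemann hr hD hc hP hS hS0 hD0 hP0 hκ]
  all_goals simp [Fin.sum_univ_four, kerrJet, grad₂, hess₂]
  all_goals field_simp
  all_goals subst hP hS hD
  all_goals ring

end KerrCurvature

/-! ### Type D tensors and the Gauss equation. -/

lemma IsGaussTensor.antisymm₁ {R : Fin 4 → Fin 4 → Fin 4 → Fin 4 → ℝ} {ε₁ ε₂ : ℝ}
    {H₁ H₂ : Matrix (Fin 4) (Fin 4) ℝ} (hR : IsGaussTensor R ε₁ ε₂ H₁ H₂) (a b c d : Fin 4) :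
    R a b c d = -R b a c d := by
  rw [hR.eq, hR.eq]; ring

lemma IsGaussTensor.antisymm₂ {R : Fin 4 → Fin 4 → Fin 4 → Fin 4 → ℝ} {ε₁ ε₂ : ℝ}
    {H₁ H₂ : Matrix (Fin 4) (Fin 4) ℝ} (hR : IsGaussTensor R ε₁ ε₂ H₁ H₂) (a b c d : Fin 4) :
    R a b c d = -R a b d c := by
  rw [hR.eq, hR.eq]; ring

lemma IsGaussTensor.pair_symm {R : Fin 4 → Fin 4 → Fin 4 → Fin 4 → ℝ} {ε₁ ε₂ : ℝ}
    {H₁ H₂ : Matrix (Fin 4) (Fin 4) ℝ} (hR : IsGaussTensor R ε₁ ε₂ H₁ H₂) (a b c d : Fin 4) :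
    R a b c d = R c d a b := by
  rw [hR.eq, hR.eq, hR.symm₁ a c, hR.symm₁ b d, hR.symm₁ a d, hR.symm₁ b c, hR.symm₂ a c,
    hR.symm₂ b d, hR.symm₂ a d, hR.symm₂ b c]; ring

/-- A type D Ricci-flat curvature tensor with nonzero electric and magnetic parts is not that of a
submanifold of codimension two. -/
lemma IsTypeD.not_isGaussTensor {R : Fin 4 → Fin 4 → Fin 4 → Fin 4 → ℝ} {g₀ g₁ g₂ g₃ e n : ℝ}
    (hT : IsTypeD R g₀ g₁ g₂ g₃ e n) (h₀ : g₀ ≠ 0) (h₁ : g₁ ≠ 0) (h₂ : g₂ ≠ 0) (h₃ : g₃ ≠ 0)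
    (he : e ≠ 0) (hn : n ≠ 0) (hdet : e ^ 2 * (g₀ * g₁ * g₂ * g₃) - n ^ 2 ≠ 0)
    (ε₁ ε₂ : ℝ) (H₁ H₂ : Matrix (Fin 4) (Fin 4) ℝ) : ¬ IsGaussTensor R ε₁ ε₂ H₁ H₂ := by
  intro hR
  obtain ⟨t1, t2, t3, t4, t5, t6, t7, t8, t9, t10, t11, t12, t13, t14, t15, t16, t17, t18, t19,
    t20, t21⟩ := hT
  have z₁ : ∀ a c d, R a a c d = 0 := fun a c d => self_eq_neg.1 (hR.antisymm₁ a a c d)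
  have z₂ : ∀ a b c, R a b c c = 0 := fun a b c => self_eq_neg.1 (hR.antisymm₂ a b c c)
  have s₁ := fun c d => hR.antisymm₁ 1 0 c d
  have s₂ := fun c d => hR.antisymm₁ 2 0 c d
  have s₃ := fun c d => hR.antisymm₁ 3 0 c d
  have s₄ := fun c d => hR.antisymm₁ 2 1 c d
  have s₅ := fun c d => hR.antisymm₁ 3 1 c d
  have s₆ := fun c d => hR.antisymm₁ 3 2 c d
  have r₁ := fun c d => hR.antisymm₂ c d 1 0
  have r₂ := fun c d => hR.antisymm₂ c d 2 0
  have r₃ := fun c d => hR.antisymm₂ c d 3 0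
  have r₄ := fun c d => hR.antisymm₂ c d 2 1
  have r₅ := fun c d => hR.antisymm₂ c d 3 1
  have r₆ := fun c d => hR.antisymm₂ c d 3 2
  have p₁ := hR.pair_symm 0 2 0 1
  have p₂ := hR.pair_symm 0 3 0 1
  have p₃ := hR.pair_symm 1 2 0 1
  have p₄ := hR.pair_symm 1 3 0 1
  have p₅ := hR.pair_symm 2 3 0 1
  have p₆ := hR.pair_symm 0 3 0 2
  have p₇ := hR.pair_symm 1 2 0 2
  have p₈ := hR.pair_symm 1 3 0 2
  have p₉ := hR.pair_symm 2 3 0 2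
  have p₁₀ := hR.pair_symm 1 2 0 3
  have p₁₁ := hR.pair_symm 1 3 0 3
  have p₁₂ := hR.pair_symm 2 3 0 3
  have p₁₃ := hR.pair_symm 1 3 1 2
  have p₁₄ := hR.pair_symm 2 3 1 2
  have p₁₅ := hR.pair_symm 2 3 1 3
  refine not_isGaussTensor_of_ricci_eq_zero (A := ![g₀⁻¹, g₁⁻¹, g₂⁻¹, g₃⁻¹]) ?_ ?_ ?_ ?_
    ε₁ ε₂ H₁ H₂ hR
  · intro a; fin_cases a <;> simp [h₀, h₁, h₂, h₃]
  -- Each diagonal Ricci component is a multiple of `2e - e - e`.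
  · intro b d
    fin_cases b <;> fin_cases d <;>
      simp only [Fin.sum_univ_four, Fin.zero_eta, Fin.mk_one, Fin.reduceFinMk, z₁, z₂, s₁, s₂, s₃,
        s₄, s₅, s₆, r₁, r₂, r₃, r₄, r₅, r₆, p₁, p₂, p₃, p₄, p₆, p₇, p₉, p₁₁, p₁₂,
        p₁₃, p₁₄, p₁₅, t1, t2, t3, t4, t5, t7, t8, t9, t11, t12, t14, t15, t16, t17,
        t18, t19, t20, t21, mul_zero, neg_zero, add_zero, neg_neg] <;>
      simp <;> field_simp <;> ring
  · have : pontryagin ![g₀⁻¹, g₁⁻¹, g₂⁻¹, g₃⁻¹] R = 24 * e * n := by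
      simp only [pontryagin, Fin.sum_univ_four, z₁, s₁, s₂, s₃,
        s₄, s₅, s₆, p₁, p₂, p₃, p₄, p₅, p₆, p₇, p₈, p₉, p₁₀, p₁₁, p₁₂,
        p₁₃, p₁₄, p₁₅, t1, t2, t3, t4, t5, t6, t7, t8, t9, t10, t11, t12, t13, t14, t15, t16, t17,
        t18, t19, t20, t21]
      simp
      field_simp
      ring
    rw [this]
    exact mul_ne_zero (mul_ne_zero (by norm_num) he) hn
  · intro w hw hRw
    have w' : ∀ a b, w a b = -w b a := fun a b => by
      rw [← Matrix.neg_apply, ← hw, Matrix.transpose_apply]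
    have w0 : ∀ a, w a a = 0 := fun a => self_eq_neg.1 (w' a a)
    have k01 := hRw 0 1
    have k02 := hRw 0 2
    have k03 := hRw 0 3
    have k12 := hRw 1 2
    have k13 := hRw 1 3
    have k23 := hRw 2 3
    simp only [Fin.sum_univ_four, z₂, r₁, r₂, r₃, r₄, r₅, r₆, p₁, p₂, p₃, p₄, p₅, p₆, p₇, p₈, p₉,
      p₁₀, p₁₁, p₁₂, p₁₃, p₁₄, p₁₅, t1, t2, t3, t4, t5, t6, t7, t8, t9, t10, t11, t12, t13, t14,
      t15, t16, t17, t18, t19, t20, t21, w0, w' 1 0, w' 2 0, w' 3 0, w' 2 1, w' 3 1, w' 3 2]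
      at k01 k02 k03 k12 k13 k23
    -- The curvature operator splits into 2×2 blocks on the index pairs (01, 23), (02, 13), (03,
    -- 12), each with determinant a nonzero multiple of the quantity in `hdet`. The combinations
    -- below are Cramer's rule.
    have solve : ∀ X : ℝ, (e ^ 2 * (g₀ * g₁ * g₂ * g₃) - n ^ 2) * X = 0 → X = 0 := fun X h =>
      (mul_eq_zero.1 h).resolve_left hdet
    have w01 : w 0 1 = 0 := solve _ (by
      linear_combination (e * g₂ * g₃ / 4) * k01 - n / 4 * k23)
    have w23 : w 2 3 = 0 := solve _ (by
      linear_combination (e * g₀ * g₁ / 4) * k23 - n / 4 * k01)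
    have w02 : w 0 2 = 0 := solve _ (by
      linear_combination (-e * g₁ * g₃ / 2) * k02 - n / 2 * k13)
    have w13 : w 1 3 = 0 := solve _ (by
      linear_combination (-e * g₀ * g₂ / 2) * k13 - n / 2 * k02)
    have w03 : w 0 3 = 0 := solve _ (by
      linear_combination (-e * g₁ * g₂ / 2) * k03 + n / 2 * k12)
    have w12 : w 1 2 = 0 := solve _ (by
      linear_combination (-e * g₀ * g₃ / 2) * k12 + n / 2 * k03)
    ext a b
    fin_cases a <;> fin_cases b <;>
      simp [w0, w' 1 0, w' 2 0, w' 3 0, w' 2 1, w' 3 1, w' 3 2, w01, w23, w02, w13, w03, w12]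

/-! ### Generic points, and the embedding class of the Kerr metrics. -/

/-- The points at which the coordinate expression of the Kerr metrics is regular. -/
def kerrDomain (κ m a : ℝ) : Set Coord4 :=
  {x | x 1 ^ 2 + κ * a ^ 2 * Real.cos (x 2) ^ 2 ≠ 0 ∧ x 1 ^ 2 - 2 * m * x 1 + κ * a ^ 2 ≠ 0 ∧
    Real.sin (x 2) ≠ 0}

lemma exists_generic_real {O : Set ℝ} (hO : IsOpen O) (hne : O.Nonempty) (T : Finset ℝ) :
    ∃ t ∈ O, t ∉ T := by
  have hd : Dense ((T : Set ℝ)ᶜ) := T.countable_toSet.dense_compl ℝ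
  obtain ⟨t, ht, ht'⟩ := hd.inter_open_nonempty O hO hne
  exact ⟨t, ht, by simpa using ht'⟩

/-- A nonempty open set of regular points contains one at which the Kerr curvature is generic. -/
lemma exists_generic_point {κ m a : ℝ} {V : Set Coord4} (hV : IsOpen V) (hne : V.Nonempty)
    (hVD : V ⊆ kerrDomain κ m a) :
    ∃ x ∈ V, Real.cos (x 2) ≠ 0 ∧ x 1 ≠ 0 ∧ x 1 ^ 2 - 3 * κ * a ^ 2 * Real.cos (x 2) ^ 2 ≠ 0 ∧
      3 * x 1 ^ 2 - κ * a ^ 2 * Real.cos (x 2) ^ 2 ≠ 0 := by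
  obtain ⟨x, hx⟩ := hne
  have hline : ∀ (i : Fin 4) (x : Coord4), x ∈ V →
      ∃ O : Set ℝ, IsOpen O ∧ (0 : ℝ) ∈ O ∧ ∀ t ∈ O, x + t • basisVec i ∈ V := by
    intro i x hx
    have hc : Continuous fun t : ℝ => x + t • basisVec i := by fun_prop
    exact ⟨_, hV.preimage hc, by simpa using hx, fun t ht => ht⟩
  obtain ⟨O, hO, h0, hOV⟩ := hline 2 x hx
  -- The derivative of `cos θ` is `-sin θ ≠ 0`, so a small change of `θ` makes `cos θ` nonzero.
  have hcos : ∃ t ∈ O, Real.cos (x 2 + t) ≠ 0 := by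
    have hd : HasDerivAt (fun t => Real.cos (x 2 + t)) (-Real.sin (x 2 + 0)) 0 := by
      simpa using (Real.hasDerivAt_cos (x 2 + 0)).comp_const_add (x 2) 0
    have hev := hd.eventually_ne (c := 0) (by simpa using (hVD hx).2.2)
    have hO' : ∀ᶠ t in nhdsWithin (0 : ℝ) {0}ᶜ, t ∈ O :=
      nhdsWithin_le_nhds (hO.mem_nhds h0)
    obtain ⟨t, h1, h2⟩ := (hev.and hO').exists
    exact ⟨t, h2, h1⟩
  obtain ⟨t, htO, htc⟩ := hcos
  set x' := x + t • basisVec 2 with hx'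
  have hx'V : x' ∈ V := hOV t htO
  have hx'2 : x' 2 = x 2 + t := by simp [hx']
  obtain ⟨O', hO', h0', hOV'⟩ := hline 1 x' hx'V
  set A := 3 * κ * a ^ 2 * Real.cos (x' 2) ^ 2 with hA
  set B := κ * a ^ 2 * Real.cos (x' 2) ^ 2 / 3 with hB
  -- With `θ` fixed, the remaining conditions exclude `r = 0` and the roots of `r² = A` and `r² =
  -- B`. If `A` or `B` is negative, its square root is 0 by convention and the exclusion is
  -- harmless.
  obtain ⟨u, huO, huT⟩ := exists_generic_real hO' ⟨0, h0'⟩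
    {-x' 1, √A - x' 1, -√A - x' 1, √B - x' 1, -√B - x' 1}
  simp only [Finset.mem_insert, Finset.mem_singleton, not_or] at huT
  obtain ⟨n1, n2, n3, n4, n5⟩ := huT
  have sq : ∀ A y : ℝ, y ^ 2 = A → y = √A ∨ y = -√A := by
    intro A y h
    have hA : 0 ≤ A := h ▸ sq_nonneg y
    rw [← sq_eq_sq_iff_eq_or_eq_neg, h, Real.sq_sqrt hA]
  have e1 : (x' + u • basisVec 1) 1 = x' 1 + u := by simp
  have e2 : (x' + u • basisVec 1) 2 = x' 2 := by simp
  refine ⟨x' + u • basisVec 1, hOV' u huO, ?_, ?_, ?_, ?_⟩ <;> simp only [e1, e2]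
  · rwa [hx'2]
  · intro h
    exact n1 (by linarith)
  · intro h
    rcases sq A (x' 1 + u) (by rw [hA]; linarith) with h | h
    · exact n2 (by linarith)
    · exact n3 (by linarith)
  · intro h
    rcases sq B (x' 1 + u) (by rw [hB]; linarith) with h | h
    · exact n4 (by linarith)
    · exact n5 (by linarith)

/-- Composing the parametrization with the frame coordinates at a generic point gives the form of
the metric in which the curvature is known. Keeping `κ ≠ 0` arbitrary treats both signatures at
once. -/
lemma two_lt_of_kerrForm {κ m a : ℝ} (hκ : κ ≠ 0) (hm : m ≠ 0) (ha : a ≠ 0) {M : Type*}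
    [TopologicalSpace M] [ChartedSpace Coord4 M] {g : MetricField Coord4 M} {U : Set M}
    (hU : IsOpen U) {h : Coord4 → LinearMap.BilinForm ℝ Coord4} {D : Set Coord4}
    (hh : ∀ x v w, h x v w = kerrForm κ m a x v w) (hD : D ⊆ kerrDomain κ m a)
    (hreg : HasCoordinateRegion g U h D) : 2 < isometricEmbeddingClass g U := by
  obtain ⟨V, hV, hne, hVD, ψ, hψU, hψ, hg⟩ := hreg
  obtain ⟨x, hxV, hc0, hr0, he0, hn0⟩ := exists_generic_point hV hne (hVD.trans hD)
  obtain ⟨hS0, hD0, hs0⟩ := hD (hVD hxV)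
  have hcoord : ContDiff ℝ ∞ (kerrCoord κ m a x) := by
    refine contDiff_const.add (ContDiff.sum fun i _ => ?_)
    exact ((EuclideanSpace.proj i : Coord4 →L[ℝ] ℝ).smulRight (kerrFrame κ m a x i)).contDiff
  have h0 : kerrCoord κ m a x 0 = x := by simp [kerrCoord]
  have hder : ∀ z i, fderiv ℝ (kerrCoord κ m a x) z (basisVec i) = kerrFrame κ m a x i := by
    intro z i
    have : HasFDerivAt (kerrCoord κ m a x)
        (∑ i, (EuclideanSpace.proj i : Coord4 →L[ℝ] ℝ).smulRight (kerrFrame κ m a x i)) z := by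
      refine HasFDerivAt.const_add x (HasFDerivAt.fun_sum fun i _ => ?_)
      exact (EuclideanSpace.proj i : Coord4 →L[ℝ] ℝ).hasFDerivAt.smul_const (kerrFrame κ m a x i)
    rw [this.fderiv]
    simp
  set V' := kerrCoord κ m a x ⁻¹' V with hV'
  have hV'o : IsOpen V' := hV.preimage hcoord.continuous
  set r := x 1 with hr
  set c := Real.cos (x 2) with hc
  set S := r ^ 2 + κ * a ^ 2 * c ^ 2 with hS
  set d := r ^ 2 - 2 * m * r + κ * a ^ 2 with hd
  have hP0 : 1 - c ^ 2 ≠ 0 := by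
    rw [hc, ← Real.sin_sq]
    exact pow_ne_zero 2 hs0
  refine two_lt_isometricEmbeddingClass (by simp) hU hV'o (ψ := ψ ∘ kerrCoord κ m a x)
    (hψU.comp (mapsTo_preimage _ _))
    (hψ.comp (contMDiffOn_iff_contDiffOn.2 hcoord.contDiffOn) (mapsTo_preimage _ _))
    (G := kerrMatrix κ m a x) ?_ (y := 0) (by simpa [hV', h0] using hxV) ?_ ?_
  · intro z hz i j
    have hcomp : mfderiv 𝓘(ℝ, Coord4) 𝓘(ℝ, Coord4) (ψ ∘ kerrCoord κ m a x) z =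
        (mfderiv 𝓘(ℝ, Coord4) 𝓘(ℝ, Coord4) ψ (kerrCoord κ m a x z)).comp
          (mfderiv 𝓘(ℝ, Coord4) 𝓘(ℝ, Coord4) (kerrCoord κ m a x) z) :=
      mfderiv_comp z ((hψ.contMDiffAt (hV.mem_nhds hz)).mdifferentiableAt (by simp))
        (hcoord.differentiable (by simp) z).mdifferentiableAt
    have e : ∀ i, mfderiv 𝓘(ℝ, Coord4) 𝓘(ℝ, Coord4) (ψ ∘ kerrCoord κ m a x) z (basisVec i) =
        mfderiv 𝓘(ℝ, Coord4) 𝓘(ℝ, Coord4) ψ (kerrCoord κ m a x z) (kerrFrame κ m a x i) := by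
      intro i
      rw [hcomp, ← hder z i, mfderiv_eq_fderiv]; rfl
    rw [e, e, kerrMatrix, Matrix.of_apply, ← hh]
    exact (hg _ hz _ _).symm
  · rw [kerrMatrix_zero_eq hr.symm hd hc.symm rfl hS hS0 hD0, Matrix.det_diagonal,
      Finset.prod_ne_zero_iff]
    intro i _
    fin_cases i <;> simp [hκ, hS0, hD0, hP0]
  · have hT := kerr_isTypeD (m := m) hr.symm hd hc.symm rfl hS hS0 hD0 hP0 hκ
    refine fun ε₁ ε₂ H₁ H₂ => hT.not_isGaussTensor ?_ ?_ ?_ ?_ ?_ ?_ ?_ ε₁ ε₂ H₁ H₂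
    · simp [hκ, hS0, hD0]
    · simp [hS0, hD0]
    · exact mul_ne_zero hS0 hP0
    · exact mul_ne_zero hP0 hS0
    · exact div_ne_zero (mul_ne_zero (mul_ne_zero hm hr0) he0) (pow_ne_zero 3 hS0)
    · exact div_ne_zero (mul_ne_zero (mul_ne_zero (mul_ne_zero (mul_ne_zero (mul_ne_zero
        (mul_ne_zero hκ hm) ha) hc0) hn0) hD0) hP0) hS0
    -- With `u = κ a² c²`, the identity `r²(r² - 3u)² + u(3r² - u)² = (r² + u)³` reduces the
    -- determinant to a product of nonzero factors.
    · have : (m * r * (r ^ 2 - 3 * κ * a ^ 2 * c ^ 2) / S ^ 3) ^ 2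
          * (-κ * d * S * (S * d) * (S * (1 - c ^ 2)) * ((1 - c ^ 2) * S))
          - (κ * m * a * c * (3 * r ^ 2 - κ * a ^ 2 * c ^ 2) * d * (1 - c ^ 2) / S) ^ 2
          = -(κ * m ^ 2 * d ^ 2 * (1 - c ^ 2) ^ 2 * S) := by
        clear_value d
        field_simp
        rw [hS]
        ring
      rw [this]
      simp [hκ, hm, hS0, hD0, hP0]

/-- The Kerr metrics have embedding class greater than two. -/
theorem two_lt_of_kerr {m a : ℝ} (hm : m ≠ 0) (ha : a ≠ 0) {M : Type*}
    [TopologicalSpace M] [ChartedSpace Coord4 M] {g : MetricField Coord4 M} {U : Set M}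
    (hU : IsOpen U)
    (hreg : HasCoordinateRegion g U (lorentzianKerr m a) (lorentzianKerrDomain m a) ∨
      HasCoordinateRegion g U (riemannianKerr m a) (riemannianKerrDomain m a)) :
    2 < isometricEmbeddingClass g U := by
  rcases hreg with h | h
  · refine two_lt_of_kerrForm one_ne_zero hm ha hU (lorentzianKerr_eq m a) (fun x hx => ?_) h
    simpa [kerrDomain, lorentzianKerrDomain] using hx
  · refine two_lt_of_kerrForm (neg_ne_zero.2 one_ne_zero) hm ha hU (riemannianKerr_eq m a)
      (fun x hx => ⟨?_, ?_, hx.2.2⟩) h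
    · have := hx.1.ne'
      intro h0; exact this (by linarith)
    · have := hx.2.1.ne'
      intro h0; exact this (by linarith)

/-! ### The curvature tensor of constant holomorphic sectional curvature -/

/-- The standard complex structure of `ℝ⁴ = ℂ²`. -/
def complexJ : Matrix (Fin 4) (Fin 4) ℝ := !![0, 1, 0, 0; -1, 0, 0, 0; 0, 0, 0, 1; 0, 0, -1, 0]

lemma complexJ_antisymm (a b : Fin 4) : complexJ a b = -complexJ b a := by
  fin_cases a <;> fin_cases b <;> simp [complexJ]

/-- The curvature tensor of constant holomorphic sectional curvature `4`. -/
def holomorphicTensor (a b c d : Fin 4) : ℝ :=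
  let δ : Matrix (Fin 4) (Fin 4) ℝ := 1
  δ a c * δ b d - δ a d * δ b c + complexJ a c * complexJ b d - complexJ a d * complexJ b c
    + 2 * complexJ a b * complexJ c d

/-- Half of this contraction has eigenvalue 6 on `complexJ`, 2 on the antisymmetric matrices
commuting with and orthogonal to it, and 0 on those anticommuting with it. -/
lemma sum_holomorphicTensor_mul (w : Matrix (Fin 4) (Fin 4) ℝ) (hw : w.transpose = -w)
    (a b : Fin 4) : ∑ c, ∑ d, holomorphicTensor a b c d * w c d =
      2 * (w - complexJ * w * complexJ) a b
        + 4 * (w 0 1 + w 2 3) * complexJ a b := by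
  have w' : ∀ a b, w a b = -w b a := fun a b => by
    rw [← Matrix.neg_apply, ← hw, Matrix.transpose_apply]
  have w0 : ∀ a, w a a = 0 := fun a => self_eq_neg.1 (w' a a)
  fin_cases a <;> fin_cases b <;>
    simp only [Fin.zero_eta, Fin.mk_one, Fin.reduceFinMk, holomorphicTensor, Fin.sum_univ_four,
      Matrix.mul_apply, Matrix.sub_apply] <;>
    simp [complexJ, Matrix.one_apply, w0, w' 1 0, w' 2 0, w' 3 0, w' 2 1, w' 3 1, w' 3 2] <;> ring

/-- The Einstein constant 6 is a simple eigenvalue of the curvature operator, so the normal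
curvature must be a multiple of `complexJ`. The resulting formula for the operator is incompatible
with its eigenvalue 2. -/
lemma holomorphicTensor_not_isGaussTensor (ε₁ ε₂ : ℝ) (H₁ H₂ : Matrix (Fin 4) (Fin 4) ℝ) :
    ¬ IsGaussTensor holomorphicTensor ε₁ ε₂ H₁ H₂ := by
  intro hR
  have t₁ : H₁.transpose = H₁ := Matrix.ext fun a b => hR.symm₁ b a
  have t₂ : H₂.transpose = H₂ := Matrix.ext fun a b => hR.symm₂ b a
  obtain ⟨F, F', hF, -, hF', a₁, a₂, hsq⟩ := hR.exists_anticommute (A := 1) (l := 6)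
    (S₁ := H₁) (S₂ := H₂) (by simp)
    (fun b d => by
      fin_cases b <;> fin_cases d <;>
        simp [holomorphicTensor, Fin.sum_univ_four, complexJ, Matrix.one_apply] <;> norm_num)
    (by
      simp [pontryagin, holomorphicTensor, Fin.sum_univ_four, complexJ]
      try norm_num)
    (by simp [Pi.one_def]) (by simp [Pi.one_def])
  have tF : F.transpose = -F := by
    rw [hF]; simp [Matrix.transpose_mul, t₁, t₂]
  -- the eigenspace is spanned by the complex structure
  have eig : ∀ w : Matrix (Fin 4) (Fin 4) ℝ, w.transpose = -w →
      ε₁ • (H₁ * w * H₁) + ε₂ • (H₂ * w * H₂) = (6 : ℝ) • w → w = w 0 1 • complexJ := by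
    intro w hw h
    have w' : ∀ a b, w a b = -w b a := fun a b => by
      rw [← Matrix.neg_apply, ← hw, Matrix.transpose_apply]
    have w0 : ∀ a, w a a = 0 := fun a => self_eq_neg.1 (w' a a)
    have key : ∀ a b, 2 * (w - complexJ * w * complexJ) a b
        + 4 * (w 0 1 + w 2 3) * complexJ a b = 12 * w a b := by
      intro a b
      rw [← sum_holomorphicTensor_mul w hw, hR.sum_mul hw, h, Matrix.smul_apply, smul_eq_mul]
      ring
    have k01 := key 0 1
    have k02 := key 0 2
    have k03 := key 0 3
    have k12 := key 1 2
    have k13 := key 1 3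
    have k23 := key 2 3
    simp only [Fin.sum_univ_four, Matrix.mul_apply, Matrix.sub_apply]
      at k01 k02 k03 k12 k13 k23
    simp [complexJ, w0, w' 1 0, w' 2 0, w' 3 0, w' 2 1, w' 3 1, w' 3 2] at k01 k02 k03 k12 k13 k23
    have e1 : w 2 3 = w 0 1 := by linarith
    have e2 : w 0 2 = 0 := by linarith
    have e3 : w 0 3 = 0 := by linarith
    have e4 : w 1 2 = 0 := by linarith
    have e5 : w 1 3 = 0 := by linarith
    ext a b
    fin_cases a <;> fin_cases b <;>
      simp [complexJ, w0, w' 1 0, w' 2 0, w' 3 0, w' 2 1, w' 3 1, w' 3 2, e1, e2, e3, e4, e5]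
  have hFJ := eig F tF (curvature_normal a₁ a₂ hsq)
  have hf : F 0 1 ≠ 0 := by
    intro h0
    rw [h0, zero_smul] at hFJ
    rw [hFJ, Matrix.mul_zero] at hF'
    exact zero_ne_one hF'
  obtain ⟨q, hq0, hq, hop⟩ := curvature_eq_of_eigenspace hF hF' t₁ t₂ a₁ a₂ hsq
    (fun w hw _ h => ⟨w 0 1 / F 0 1, by
      rw [eig w hw h, hFJ]
      simp [hf, complexJ]⟩)
  -- A form of the opposite duality: it commutes with `complexJ` and has eigenvalue 2.
  let w : Matrix (Fin 4) (Fin 4) ℝ := !![0, 1, 0, 0; -1, 0, 0, 0; 0, 0, 0, -1; 0, 0, 1, 0]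
  have tw : w.transpose = -w := by
    ext a b; fin_cases a <;> fin_cases b <;> simp [w]
  have cw : w * F = F * w := by
    rw [hFJ, Matrix.mul_smul, Matrix.smul_mul]
    congr 1
    ext a b
    simp only [Matrix.mul_apply, Fin.sum_univ_four]
    fin_cases a <;> fin_cases b <;> simp [w, complexJ]
  have hw2 : ε₁ • (H₁ * w * H₁) + ε₂ • (H₂ * w * H₂) = (2 : ℝ) • w := by
    ext a b
    have h := hR.sum_mul tw a b
    rw [sum_holomorphicTensor_mul w tw] at h
    have h' : (ε₁ • (H₁ * w * H₁) + ε₂ • (H₂ * w * H₂)) a b = (w - complexJ * w * complexJ) a b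
        + 2 * (w 0 1 + w 2 3) * complexJ a b := by linarith
    rw [h']
    simp only [Matrix.mul_apply, Matrix.sub_apply, Fin.sum_univ_four]
    fin_cases a <;> fin_cases b <;> simp [w, complexJ] <;> norm_num
  rw [hop w cw] at hw2
  have h3 : H₁ * w * H₁ = (-(q / 3)) • w := by
    have h := congrArg (fun X => (-(q / 6)) • X) hw2
    simp only [smul_smul] at h
    have e1 : -(q / 6) * -(6 / q) = 1 := by field_simp
    rw [e1, one_smul] at h
    rw [h]; congr 1; ring
  -- Conjugating twice multiplies `w` by `q²` because `H₁² = q`, but by `(q/3)²` according to `h3`.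
  have h4 : H₁ * (H₁ * w * H₁) * H₁ = (q * q) • w := by
    calc H₁ * (H₁ * w * H₁) * H₁ = (H₁ * H₁) * w * (H₁ * H₁) := by simp only [Matrix.mul_assoc]
      _ = _ := by rw [hq]; simp [smul_smul]
  rw [h3, Matrix.mul_smul, Matrix.smul_mul, h3, smul_smul] at h4
  have h5 := congrFun (congrFun h4 0) 1
  simp [w] at h5
  have : q * q = 0 := by linarith
  exact hq0 (mul_self_eq_zero.1 this)

/-- The components of the Fubini-Study metric in affine coordinates at the origin. -/
def affineFubiniStudy (y : Coord4) : Matrix (Fin 4) (Fin 4) ℝ :=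
  Matrix.of fun a b => (((1 : Matrix (Fin 4) (Fin 4) ℝ) a b * (1 + ∑ i, y i * y i) - y a * y b
    - (∑ i, complexJ a i * y i) * (∑ i, complexJ b i * y i)))
    * ((1 + ∑ i, y i * y i) ^ 2)⁻¹

/-- The first derivatives of the metric vanish at the origin, so the Christoffel terms drop out and
the curvature is read off from the Hessian. -/
lemma lowerRiemann_affineFubiniStudy :
    lowerRiemann affineFubiniStudy 0 = holomorphicTensor := by
  have jn : HasJet (fun y : Coord4 => 1 + ∑ i, y i * y i) 0 1 0
      (fun i j => 2 * (1 : Matrix (Fin 4) (Fin 4) ℝ) i j) := by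
    have h := (HasJet.const 1 0).add ((((HasJet.coord 0 0).mul (HasJet.coord 0 0)).add
      ((HasJet.coord 1 0).mul (HasJet.coord 1 0))).add (((HasJet.coord 2 0).mul
      (HasJet.coord 2 0)).add ((HasJet.coord 3 0).mul (HasJet.coord 3 0))))
    refine (h.congr_of_eventuallyEq (.of_forall fun z => ?_)).congr (by simp) ?_ ?_
    · rw [Fin.sum_univ_four]; ring
    · funext i; simp
    · funext i j
      fin_cases i <;> fin_cases j <;> simp <;> norm_num
  have jJ : ∀ a, HasJet (fun y : Coord4 => ∑ i, complexJ a i * y i) 0 0 (complexJ a) 0 := by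
    intro a
    have h := (((HasJet.coord 0 0).const_mul (complexJ a 0)).add
      ((HasJet.coord 1 0).const_mul (complexJ a 1))).add
      (((HasJet.coord 2 0).const_mul (complexJ a 2)).add
      ((HasJet.coord 3 0).const_mul (complexJ a 3)))
    refine (h.congr_of_eventuallyEq (.of_forall fun z => ?_)).congr (by simp) ?_ ?_
    · rw [Fin.sum_univ_four]; ring
    · funext i; fin_cases i <;> simp
    · funext i j; simp
  have jG : ∀ a b, HasJet (fun y => affineFubiniStudy y a b) 0
      ((1 : Matrix (Fin 4) (Fin 4) ℝ) a b) 0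
      (fun i j => -2 * (1 : Matrix (Fin 4) (Fin 4) ℝ) a b * (1 : Matrix (Fin 4) (Fin 4) ℝ) i j
        - ((1 : Matrix (Fin 4) (Fin 4) ℝ) a i * (1 : Matrix (Fin 4) (Fin 4) ℝ) b j
          + (1 : Matrix (Fin 4) (Fin 4) ℝ) a j * (1 : Matrix (Fin 4) (Fin 4) ℝ) b i)
        - (complexJ a i * complexJ b j + complexJ a j * complexJ b i)) := by
    intro a b
    have h := (((jn.const_mul ((1 : Matrix (Fin 4) (Fin 4) ℝ) a b)).sub
      ((HasJet.coord a 0).mul (HasJet.coord b 0))).sub ((jJ a).mul (jJ b))).mul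
      ((jn.pow_two).inv (by norm_num))
    refine (h.congr_of_eventuallyEq (.of_forall fun z => rfl)).congr (by simp) ?_ ?_
    · funext i; simp
    · funext i j
      have hs : ∀ a i : Fin 4, (Pi.single a 1 : Fin 4 → ℝ) i = (1 : Matrix (Fin 4) (Fin 4) ℝ) a i :=
        fun a i => by simp [Pi.single_apply, Matrix.one_apply, eq_comm]
      simp only [Pi.sub_apply, Pi.zero_apply, hs, PiLp.zero_apply]
      ring
  have h1 : affineFubiniStudy 0 = 1 := by
    ext a b; exact (jG a b).value
  funext a b c d
  rw [lowerRiemann_eq_of_hasJet jG (D := 1) (by rw [h1]; simp [Pi.one_def])]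
  have sδ : ∀ a b, (1 : Matrix (Fin 4) (Fin 4) ℝ) a b = (1 : Matrix (Fin 4) (Fin 4) ℝ) b a :=
    fun a b => by simp [Matrix.one_apply, eq_comm]
  simp only [holomorphicTensor, Pi.zero_apply]
  rw [sδ d c, sδ d b, sδ b a, sδ c a, sδ c b, sδ d a, complexJ_antisymm d c, complexJ_antisymm d b,
    complexJ_antisymm b a,
    complexJ_antisymm c a, complexJ_antisymm c b, complexJ_antisymm d a]
  simp only [add_zero, sub_zero, mul_zero, Finset.sum_const_zero]
  ring

/-! ### The complex projective plane -/

namespace CP2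

/-- The Fubini-Study form is horizontal and invariant under rescaling. -/
lemma fubiniStudyForm_smul_add {Z : Fin 3 → ℂ} (hZ : star Z ⬝ᵥ Z ≠ 0) {c : ℂ} (hc : c ≠ 0)
    (V W : Fin 3 → ℂ) (μ ν : ℂ) :
    fubiniStudyForm (c • Z) (c • V + μ • Z) (c • W + ν • Z) = fubiniStudyForm Z V W := by
  simp only [fubiniStudyForm, LinearMap.mk₂_apply]
  congr 1
  have hc' : star c ≠ 0 := star_ne_zero.2 hc
  simp only [star_add, star_smul, add_dotProduct, dotProduct_add, smul_dotProduct, dotProduct_smul,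
    smul_eq_mul]
  field_simp
  ring

/-- The affine chart of the complex projective plane, as an element of its atlas. -/
def affineChart (i : Fin 3) : OpenPartialHomeomorph CP2 (Fin 2 → ℂ) :=
  chartedSpaceCore.openPartialHomeomorph (affineEquiv i) ⟨i, rfl⟩

lemma affineChart_mem_atlas (i : Fin 3) : affineChart i ∈ atlas (Fin 2 → ℂ) CP2 :=
  mem_iUnion₂.2 ⟨affineEquiv i, ⟨i, rfl⟩, rfl⟩

lemma contDiff_homogenize_vec (i : Fin 3) : ContDiff ℝ ∞ (homogenize i) :=
  contDiff_pi.2 fun k => contDiff_homogenize i k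

lemma homogeneousLift_mk (i : Fin 3) (Z : Fin 3 → ℂ) (hZ : Z ≠ 0) (hi : Z i ≠ 0) :
    homogeneousLift i (mk Z hZ) = (Z i)⁻¹ • Z := by
  funext k
  refine Fin.succAboveCases i ?_ (fun j => ?_) k
  · simp [homogeneousLift, homogenize_self, hi]
  · rw [homogeneousLift, homogenize_succAbove, affine_mk, Pi.smul_apply, smul_eq_mul,
      div_eq_inv_mul]

lemma contMDiffAt_homogeneousLift (i : Fin 3) {p : CP2} (hp : p ∈ affineDomain i) :
    ContMDiffAt 𝓘(ℝ, Fin 2 → ℂ) 𝓘(ℝ, Fin 3 → ℂ) ∞ (homogeneousLift i) p := by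
  have h : ContMDiffAt 𝓘(ℝ, Fin 2 → ℂ) 𝓘(ℝ, Fin 2 → ℂ) ∞ (affineChart i) p :=
    contMDiffAt_of_mem_maximalAtlas
      (IsManifold.subset_maximalAtlas (affineChart_mem_atlas i)) hp
  exact (contDiff_homogenize_vec i).contMDiff.contMDiffAt.comp p h

open scoped ComplexOrder in
/-- A smooth map in homogeneous coordinates gives one to the projective plane, and the
Fubini-Study form computes the pulled back metric. -/
lemma exists_projection {s : Coord4 → Fin 3 → ℂ} (hs : ContDiff ℝ ∞ s)
    (hs0 : ∀ y, s y ≠ 0) :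
    ContMDiff 𝓘(ℝ, Coord4) 𝓘(ℝ, Fin 2 → ℂ) ∞ (fun y => mk (s y) (hs0 y)) ∧
    ∀ y v w, fubiniStudy (mk (s y) (hs0 y))
      (mfderiv 𝓘(ℝ, Coord4) 𝓘(ℝ, Fin 2 → ℂ) (fun y => mk (s y) (hs0 y)) y v)
      (mfderiv 𝓘(ℝ, Coord4) 𝓘(ℝ, Fin 2 → ℂ) (fun y => mk (s y) (hs0 y)) y w) =
      fubiniStudyForm (s y) (fderiv ℝ s y v) (fderiv ℝ s y w) := by
  have hcomp : ∀ k, ContDiff ℝ ∞ fun y => s y k := fun k => contDiff_pi.1 hs k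
  have hopen : ∀ k, IsOpen {y | s y k ≠ 0} := fun k =>
    isOpen_ne_fun (hcomp k).continuous continuous_const
  have hsm : ContMDiff 𝓘(ℝ, Coord4) 𝓘(ℝ, Fin 2 → ℂ) ∞ (fun y => mk (s y) (hs0 y)) := by
    intro y
    obtain ⟨i, hi⟩ : ∃ i, s y i ≠ 0 := by
      by_contra! h
      exact hs0 y (funext h)
    have hq : ContDiffAt ℝ ∞ (fun y (j : Fin 2) => s y (i.succAbove j) / s y i) y := by
      refine contDiffAt_pi.2 fun j => ?_
      simp only [div_eq_mul_inv]
      exact (hcomp _).contDiffAt.mul ((hcomp i).contDiffAt.inv hi)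
    have he : ContMDiffAt 𝓘(ℝ, Fin 2 → ℂ) 𝓘(ℝ, Fin 2 → ℂ) ∞ (affineChart i).symm
        (fun (j : Fin 2) => s y (i.succAbove j) / s y i) :=
      contMDiffAt_symm_of_mem_maximalAtlas
        (IsManifold.subset_maximalAtlas (affineChart_mem_atlas i)) (mem_univ _)
    refine (he.comp y hq.contMDiffAt).congr_of_eventuallyEq ?_
    filter_upwards [(hopen i).mem_nhds hi] with z hz
    exact ((affineEquiv i).left_inv' ((mk_mem_affineDomain i _ (hs0 z)).2 hz)).symm
  refine ⟨hsm, fun y v w => ?_⟩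
  set p := mk (s y) (hs0 y) with hp
  set k := pivot p with hk
  have hkp : p ∈ affineDomain k := mem_affineDomain_pivot p
  have hk0 : s y k ≠ 0 := (mk_mem_affineDomain k _ (hs0 y)).1 hkp
  have hN : star (s y) ⬝ᵥ s y ≠ 0 := fun h => hs0 y (dotProduct_star_self_eq_zero.1 h)
  -- Near `y` the lift of `[s]` is `s / s_k`. Its derivative is the derivative of `s` rescaled plus
  -- a multiple of `s`, precisely a change that does not affect the Fubini-Study form.
  have hD : ∀ v, mfderiv 𝓘(ℝ, Fin 2 → ℂ) 𝓘(ℝ, Fin 3 → ℂ) (homogeneousLift k) p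
      (mfderiv 𝓘(ℝ, Coord4) 𝓘(ℝ, Fin 2 → ℂ) (fun y => mk (s y) (hs0 y)) y v) =
      (s y k)⁻¹ • fderiv ℝ s y v + (-(fderiv ℝ s y v k) / s y k ^ 2) • s y := by
    intro v
    have h1 := mfderiv_comp y
      ((contMDiffAt_homogeneousLift k hkp).mdifferentiableAt (by simp))
      ((hsm y).mdifferentiableAt (by simp))
    have h2 : homogeneousLift k ∘ (fun y => mk (s y) (hs0 y)) =ᶠ[nhds y]
        fun z => (s z k)⁻¹ • s z := by
      filter_upwards [(hopen k).mem_nhds hk0] with z hz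
      exact homogeneousLift_mk k (s z) (hs0 z) hz
    rw [mfderiv_eq_fderiv, h2.fderiv_eq] at h1
    have h3 := congrArg (fun L : Coord4 →L[ℝ] (Fin 3 → ℂ) => L v) h1
    refine Eq.trans h3.symm ?_
    have hsd : HasFDerivAt s (fderiv ℝ s y) y := (hs.differentiable (by simp) y).hasFDerivAt
    have hskd : HasFDerivAt (fun z => s z k)
        ((ContinuousLinearMap.proj k : (Fin 3 → ℂ) →L[ℝ] ℂ).comp (fderiv ℝ s y)) y :=
      hasFDerivAt_pi'.1 hsd k
    have hinv := (hasDerivAt_inv hk0).hasFDerivAt.restrictScalars ℝ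
    have h4 := (HasFDerivAt.comp y hinv hskd).smul hsd
    have h5 : fderiv ℝ (fun z => (s z k)⁻¹ • s z) y = _ := h4.fderiv
    rw [h5]
    change (s y k)⁻¹ • fderiv ℝ s y v + (fderiv ℝ s y v k • -(s y k ^ 2)⁻¹) • s y = _
    rw [smul_eq_mul, mul_neg, neg_div, div_eq_mul_inv]
  change fubiniStudyForm (homogeneousLift k p)
    (mfderiv 𝓘(ℝ, Fin 2 → ℂ) 𝓘(ℝ, Fin 3 → ℂ) (homogeneousLift k) p
      (mfderiv 𝓘(ℝ, Coord4) 𝓘(ℝ, Fin 2 → ℂ) (fun y => mk (s y) (hs0 y)) y v))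
    (mfderiv 𝓘(ℝ, Fin 2 → ℂ) 𝓘(ℝ, Fin 3 → ℂ) (homogeneousLift k) p
      (mfderiv 𝓘(ℝ, Coord4) 𝓘(ℝ, Fin 2 → ℂ) (fun y => mk (s y) (hs0 y)) y w)) = _
  rw [hD v, hD w, homogeneousLift_mk k _ _ hk0,
    fubiniStudyForm_smul_add hN (inv_ne_zero hk0)]

/-- Every point of the projective plane is represented by the first vector of an orthonormal
basis. -/
lemma exists_unitary_frame (p : CP2) : ∃ (u : Fin 3 → Fin 3 → ℂ) (h : u 0 ≠ 0),
    (∀ i j, star (u i) ⬝ᵥ u j = if i = j then 1 else 0) ∧ p = mk (u 0) h := by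
  induction p using Projectivization.ind with
  | h Z hZ =>
    let E := EuclideanSpace ℂ (Fin 3)
    let z : E := WithLp.toLp 2 Z
    have hz : ‖z‖ ≠ 0 := norm_ne_zero_iff.2 fun h => hZ (congrArg WithLp.ofLp h)
    -- A one-element orthonormal family, indexed so that it extends to a basis with this vector in
    -- position 0.
    have ho : Orthonormal ℂ (({0} : Set (Fin 3)).domRestrict fun _ => ((‖z‖ : ℂ)⁻¹ • z : E)) := by
      constructor
      · rintro ⟨i, hi⟩
        change ‖(‖z‖ : ℂ)⁻¹ • z‖ = 1
        rw [norm_smul, norm_inv, Complex.norm_real, norm_norm, inv_mul_cancel₀ hz]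
      · rintro ⟨i, hi⟩ ⟨j, hj⟩ hij
        simp only [mem_singleton_iff] at hi hj
        subst hi hj
        exact absurd rfl hij
    obtain ⟨b, hb⟩ := ho.exists_orthonormalBasis_extension_of_card_eq
      (by rw [finrank_euclideanSpace_fin]; rfl)
    have hb0 : b 0 = (‖z‖ : ℂ)⁻¹ • z := hb 0 rfl
    have h0 : WithLp.ofLp (b 0) ≠ 0 := fun h => by
      have : b 0 = 0 := congrArg (WithLp.toLp 2) h
      exact b.orthonormal.ne_zero 0 this
    refine ⟨fun i => WithLp.ofLp (b i), h0, fun i j => ?_, ?_⟩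
    · rw [← orthonormal_iff_ite.1 b.orthonormal i j, EuclideanSpace.inner_eq_star_dotProduct,
        dotProduct_comm]
    · refine (Projectivization.mk_eq_mk_iff' ℂ _ _ _ _).2 ⟨‖z‖, ?_⟩
      change (‖z‖ : ℂ) • WithLp.ofLp (b 0) = Z
      rw [hb0]
      have : (‖z‖ : ℂ) ≠ 0 := by exact_mod_cast hz
      change (‖z‖ : ℂ) • ((‖z‖ : ℂ)⁻¹ • Z) = Z
      rw [smul_smul, mul_inv_cancel₀ this, one_smul]

end CP2

/-- By unitary homogeneity, affine coordinates from an orthonormal basis starting at any given point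
of `U` put the metric in the same form `affineFubiniStudy`, so the curvature at the origin suffices.
-/
theorem two_lt_of_fubiniStudy {U : Set CP2} (hU : IsOpen U) (hne : U.Nonempty) :
    2 < isometricEmbeddingClass CP2.fubiniStudy U := by
  obtain ⟨p, hp⟩ := hne
  obtain ⟨u, hu0, hu, rfl⟩ := CP2.exists_unitary_frame p
  let L : Coord4 →ₗ[ℝ] (Fin 3 → ℂ) :=
    { toFun := fun y => ((y 0 + y 1 * Complex.I) • u 1 + (y 2 + y 3 * Complex.I) • u 2)
      map_add' := fun y z => by
        ext k; simp; ring
      map_smul' := fun c y => by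
        ext k; simp; ring }
  let s : Coord4 → Fin 3 → ℂ := fun y => u 0 + L.toContinuousLinearMap y
  have hs : ContDiff ℝ ∞ s := contDiff_const.add L.toContinuousLinearMap.contDiff
  have hL : ∀ y, L.toContinuousLinearMap y =
    ((y 0 + y 1 * Complex.I) • u 1 + (y 2 + y 3 * Complex.I) • u 2) := fun y => rfl
  have hds : ∀ y v, fderiv ℝ s y v = L.toContinuousLinearMap v := by
    intro y v
    have : HasFDerivAt s L.toContinuousLinearMap y :=
      HasFDerivAt.const_add _ L.toContinuousLinearMap.hasFDerivAt
    rw [this.fderiv]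
  have hss : ∀ y, star (s y) ⬝ᵥ s y = ((1 + ∑ i, y i * y i : ℝ) : ℂ) := by
    intro y
    simp only [s, hL, star_add, star_smul, add_dotProduct, dotProduct_add, smul_dotProduct,
      dotProduct_smul, hu, smul_eq_mul, Fin.sum_univ_four]
    apply Complex.ext <;> simp <;> ring
  have hVs : ∀ y a, star (L.toContinuousLinearMap (basisVec a)) ⬝ᵥ s y =
      ((y a : ℝ) : ℂ) + ((∑ i, complexJ a i * y i : ℝ) : ℂ) * Complex.I := by
    intro y a
    simp only [s, hL, star_add, star_smul, add_dotProduct, dotProduct_add, smul_dotProduct,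
      dotProduct_smul, hu, smul_eq_mul, Fin.sum_univ_four]
    fin_cases a <;> apply Complex.ext <;> simp [complexJ]
  have hsV : ∀ y a, star (s y) ⬝ᵥ L.toContinuousLinearMap (basisVec a) =
      ((y a : ℝ) : ℂ) - ((∑ i, complexJ a i * y i : ℝ) : ℂ) * Complex.I := by
    intro y a
    simp only [s, hL, star_add, star_smul, add_dotProduct, dotProduct_add, smul_dotProduct,
      dotProduct_smul, hu, smul_eq_mul, Fin.sum_univ_four]
    fin_cases a <;> apply Complex.ext <;> simp [complexJ]
  have hVV : ∀ a b, (star (L.toContinuousLinearMap (basisVec a)) ⬝ᵥ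
      L.toContinuousLinearMap (basisVec b)).re = (1 : Matrix (Fin 4) (Fin 4) ℝ) a b := by
    intro a b
    simp only [hL, star_add, star_smul, add_dotProduct, dotProduct_add, smul_dotProduct,
      dotProduct_smul, hu, smul_eq_mul]
    fin_cases a <;> fin_cases b <;> simp
  have hpos : ∀ y : Coord4, 1 + ∑ i, y i * y i ≠ 0 := fun y => by
    have : 0 ≤ ∑ i, y i * y i := Finset.sum_nonneg fun i _ => mul_self_nonneg _
    positivity
  have hs0 : ∀ y, s y ≠ 0 := fun y h => by
    have := hss y
    rw [h, dotProduct_zero] at this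
    exact hpos y (by exact_mod_cast this.symm)
  obtain ⟨hsm, hmet⟩ := CP2.exists_projection hs hs0
  set ψ : Coord4 → CP2 := fun y => CP2.mk (s y) (hs0 y) with hψ
  have hψ0 : ψ 0 = CP2.mk (u 0) hu0 := by
    have e : s 0 = u 0 := by simp [s]
    simp only [hψ, e]
  have hG0 : affineFubiniStudy 0 = 1 := by
    ext a b
    rw [affineFubiniStudy, Matrix.of_apply]
    simp
  have hE : finrank ℝ (Fin 2 → ℂ) = 4 := by
    rw [finrank_pi_fintype]; simp [Complex.finrank_real_complex]
  refine two_lt_isometricEmbeddingClass hE hU (hU.preimage hsm.continuous) (ψ := ψ)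
    (mapsTo_preimage _ _) hsm.contMDiffOn (G := affineFubiniStudy) ?_ (y := 0)
    (by rw [mem_preimage, hψ0]; exact hp) (by rw [hG0, Matrix.det_one]; exact one_ne_zero) ?_
  · intro y _ a b
    refine Eq.trans ?_ (hmet y (basisVec a) (basisVec b)).symm
    rw [hds, hds]
    simp only [CP2.fubiniStudyForm, LinearMap.mk₂_apply, hss, hVs, hsV]
    rw [← Complex.ofReal_pow, Complex.div_ofReal_re, Complex.sub_re, Complex.re_ofReal_mul, hVV,
      affineFubiniStudy, Matrix.of_apply, div_eq_mul_inv]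
    congr 1
    simp
    ring
  · intro ε₁ ε₂ H₁ H₂
    rw [lowerRiemann_affineFubiniStudy]
    exact holomorphicTensor_not_isGaussTensor ε₁ ε₂ H₁ H₂

/-! ### The Riemann tensor of a smooth metric -/

section SmoothMetric

variable {V : Set Coord4} {G : Coord4 → Matrix (Fin 4) (Fin 4) ℝ}

lemma contDiffOn_det {n : Type*} [Fintype n] [DecidableEq n] {M : Coord4 → Matrix n n ℝ}
    (hM : ∀ i j, ContDiffOn ℝ ∞ (fun z => M z i j) V) :
    ContDiffOn ℝ ∞ (fun z => (M z).det) V := by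
  simp only [Matrix.det_apply]
  exact ContDiffOn.sum fun σ _ => (contDiffOn_prod fun i _ => hM _ _).const_smul _

lemma contDiffOn_matrix_inv (hG : ∀ i j, ContDiffOn ℝ ∞ (fun z => G z i j) V)
    (hdet : ∀ z ∈ V, (G z).det ≠ 0) (i j : Fin 4) :
    ContDiffOn ℝ ∞ (fun z => (G z)⁻¹ i j) V := by
  have h : ∀ z, (G z)⁻¹ i j = ((G z).det)⁻¹ * (G z).adjugate i j := fun z => by
    rw [Matrix.inv_def, Matrix.smul_apply, smul_eq_mul, Ring.inverse_eq_inv']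
  simp only [h]
  refine ((contDiffOn_det hG).inv hdet).mul ?_
  simp only [Matrix.adjugate_apply]
  refine contDiffOn_det fun k l => ?_
  simp only [Matrix.updateRow_apply]
  split_ifs
  · exact contDiffOn_const
  · exact hG k l

lemma contDiffOn_lowerChristoffel (hV : IsOpen V)
    (hG : ∀ i j, ContDiffOn ℝ ∞ (fun z => G z i j) V) (l i j : Fin 4) :
    ContDiffOn ℝ ∞ (lowerChristoffel G l i j) V :=
  contDiffOn_const.mul ((((hG l j).pderiv hV i).add ((hG l i).pderiv hV j)).sub
    ((hG i j).pderiv hV l))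

lemma christoffel_eq (hV : IsOpen V) (hsymm : ∀ z ∈ V, ∀ i j, G z i j = G z j i) {z : Coord4}
    (hz : z ∈ V) (k i j : Fin 4) :
    christoffel G k i j z = ∑ l, (G z)⁻¹ k l * lowerChristoffel G l i j z := by
  simp only [christoffel, lowerChristoffel, Finset.mul_sum]
  refine Finset.sum_congr rfl fun l _ => ?_
  simp only [partialDeriv_eq_pderiv]
  rw [pderiv_congr hV (fun z hz => hsymm z hz i l) hz j]
  ring

lemma contDiffOn_christoffel (hV : IsOpen V) (hG : ∀ i j, ContDiffOn ℝ ∞ (fun z => G z i j) V)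
    (hsymm : ∀ z ∈ V, ∀ i j, G z i j = G z j i) (hdet : ∀ z ∈ V, (G z).det ≠ 0) (k i j : Fin 4) :
    ContDiffOn ℝ ∞ (christoffel G k i j) V :=
  ContDiffOn.congr (ContDiffOn.sum fun l _ => (contDiffOn_matrix_inv hG hdet k l).mul
    (contDiffOn_lowerChristoffel hV hG l i j)) fun _ hz => christoffel_eq hV hsymm hz k i j

lemma sum_mul_christoffel (hV : IsOpen V) (hsymm : ∀ z ∈ V, ∀ i j, G z i j = G z j i)
    (hdet : ∀ z ∈ V, (G z).det ≠ 0) {z : Coord4}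
    (hz : z ∈ V) (a i j : Fin 4) :
    ∑ k, G z a k * christoffel G k i j z = lowerChristoffel G a i j z := by
  have hinv : G z * (G z)⁻¹ = 1 := Matrix.mul_nonsing_inv _ (isUnit_iff_ne_zero.2 (hdet z hz))
  have h := congrFun (congrArg
    (fun M : Matrix (Fin 4) (Fin 4) ℝ => M.mulVec fun l => lowerChristoffel G l i j z) hinv) a
  simp only [← Matrix.mulVec_mulVec, Matrix.one_mulVec] at h
  rw [← h]
  simp only [christoffel_eq hV hsymm hz, Matrix.mulVec, dotProduct]

/-- Lowering the index under the derivative of `Γ` costs `∂g · Γ`, and `∂g` is a sum of two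
Christoffel symbols. One of the two resulting terms cancels the quadratic part of `riemannUp`; the
other is the quadratic part of `lowerRiemann`. -/
lemma riemann_eq_lowerRiemann (hV : IsOpen V) (hG : ∀ i j, ContDiffOn ℝ ∞ (fun z => G z i j) V)
    (hsymm : ∀ z ∈ V, ∀ i j, G z i j = G z j i) (hdet : ∀ z ∈ V, (G z).det ≠ 0)
    {y : Coord4} (hy : y ∈ V) (a b c d : Fin 4) :
    riemann G a b c d y = lowerRiemann G y a b c d := by
  have dG : ∀ i j, DifferentiableAt ℝ (fun z => G z i j) y :=
    fun i j => (hG i j).differentiableAt_of_isOpen hV hy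
  have dΓ : ∀ k i j, DifferentiableAt ℝ (christoffel G k i j) y :=
    fun k i j => (contDiffOn_christoffel hV hG hsymm hdet k i j).differentiableAt_of_isOpen hV hy
  have dp : ∀ i j k, DifferentiableAt ℝ (pderiv k fun z => G z i j) y :=
    fun i j k => ((hG i j).pderiv hV k).differentiableAt_of_isOpen hV hy
  have sp : ∀ i j k, pderiv k (fun z => G z i j) y = pderiv k (fun z => G z j i) y :=
    fun i j k => pderiv_congr hV (fun z hz => hsymm z hz i j) hy k
  have spp : ∀ i j k l, pderiv l (pderiv k fun z => G z i j) y
      = pderiv l (pderiv k fun z => G z j i) y := fun i j k l =>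
    pderiv_congr hV (fun z hz => pderiv_congr hV (fun z hz => hsymm z hz i j) hz k) hy l
  have cpp : ∀ i j k l, pderiv l (pderiv k fun z => G z i j) y
      = pderiv k (pderiv l fun z => G z i j) y := fun i j k l => pderiv_comm hV (hG i j) hy l k
  have s1 : ∀ l i j, lowerChristoffel G l i j y = lowerChristoffel G l j i y := by
    intro l i j
    simp only [lowerChristoffel, partialDeriv_eq_pderiv]
    rw [sp i j]; ring
  -- Metric compatibility, for the symbols of the first kind.
  have hp : ∀ a e c, pderiv c (fun z => G z a e) y =
      lowerChristoffel G a c e y + lowerChristoffel G e c a y := by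
    intro a e c
    simp only [lowerChristoffel, partialDeriv_eq_pderiv]
    rw [sp e a c, sp c a e, sp c e a]; ring
  -- the derivative of the Christoffel symbols of the second kind
  have h1 : ∀ a i j c, ∑ e, G y a e * pderiv c (christoffel G e i j) y =
      pderiv c (lowerChristoffel G a i j) y
      - ∑ e, (lowerChristoffel G a c e y + lowerChristoffel G e c a y)
        * christoffel G e i j y := by
    intro a i j c
    have h := pderiv_congr hV (fun z hz => (sum_mul_christoffel hV hsymm hdet hz a i j).symm) hy c
    rw [h, pderiv_sum _ (f := fun e z => G z a e * christoffel G e i j z)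
      (fun e _ => (dG a e).mul (dΓ e i j))]
    rw [← Finset.sum_sub_distrib]
    refine Finset.sum_congr rfl fun e _ => ?_
    rw [pderiv_mul (dG a e) (dΓ e i j), hp]
    ring
  have h2 : ∀ a c d b, ∑ e, G y a e * ∑ f, christoffel G e c f y * christoffel G f d b y =
      ∑ f, lowerChristoffel G a c f y * christoffel G f d b y := by
    intro a c d b
    simp only [Finset.mul_sum]
    rw [Finset.sum_comm]
    refine Finset.sum_congr rfl fun f _ => ?_
    rw [← sum_mul_christoffel hV hsymm hdet hy a c f, Finset.sum_mul]
    exact Finset.sum_congr rfl fun e _ => by ring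
  have h3 : ∀ a i j c, pderiv c (lowerChristoffel G a i j) y = (1 / 2) *
      (pderiv c (pderiv i fun z => G z a j) y + pderiv c (pderiv j fun z => G z a i) y
      - pderiv c (pderiv a fun z => G z i j) y) := by
    intro a i j c
    have : HasFDerivAt (lowerChristoffel G a i j) _ y := HasFDerivAt.const_mul
      (((dp a j i).hasFDerivAt.add (dp a i j).hasFDerivAt).sub (dp i j a).hasFDerivAt) (1 / 2 : ℝ)
    rw [pderiv, this.fderiv]
    rfl
  have h4 : ∀ a c d b, ∑ e, lowerChristoffel G e c a y * christoffel G e d b y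
      = ∑ e, ∑ f, lowerChristoffel G e a c y * (G y)⁻¹ e f * lowerChristoffel G f b d y := by
    intro a c d b
    refine Finset.sum_congr rfl fun e _ => ?_
    rw [christoffel_eq hV hsymm hy, Finset.mul_sum]
    refine Finset.sum_congr rfl fun f _ => ?_
    rw [s1 e c a, s1 f d b]; ring
  have expand : riemann G a b c d y = ∑ e, G y a e * pderiv c (christoffel G e d b) y
      - ∑ e, G y a e * pderiv d (christoffel G e c b) y
      + (∑ e, G y a e * ∑ f, christoffel G e c f y * christoffel G f d b y
      - ∑ e, G y a e * ∑ f, christoffel G e d f y * christoffel G f c b y) := by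
    simp only [riemann, riemannUp, Finset.sum_sub_distrib, mul_add, mul_sub,
      Finset.sum_add_distrib]
    rfl
  rw [expand, h1, h1, h2, h2, h3, h3]
  simp only [add_mul, Finset.sum_add_distrib]
  rw [h4, h4]
  simp only [lowerRiemann, Finset.sum_sub_distrib, partialDeriv_eq_pderiv]
  rw [cpp a b c d, cpp a d b c, cpp d b a c, spp d b c a, cpp a c b d, cpp c b a d, spp c b d a]
  ring

end SmoothMetric

/-! ### Anti-self-dual curvature tensors -/

/-- A basis of the anti-self-dual two-forms on Euclidean four-space. -/
def asdBasis : Fin 3 → Matrix (Fin 4) (Fin 4) ℝ :=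
  ![!![0, 1, 0, 0; -1, 0, 0, 0; 0, 0, 0, -1; 0, 0, 1, 0],
    !![0, 0, 1, 0; 0, 0, 0, 1; -1, 0, 0, 0; 0, -1, 0, 0],
    !![0, 0, 0, 1; 0, 0, -1, 0; 0, 1, 0, 0; -1, 0, 0, 0]]

/-- The curvature tensor whose curvature operator is `ψ` on the anti-self-dual two-forms. -/
def asdTensor (ψ : Matrix (Fin 3) (Fin 3) ℝ) (a b c d : Fin 4) : ℝ :=
  ∑ i, ∑ j, ψ i j * (asdBasis i a b * asdBasis j c d)

/-- The components of the anti-self-dual part of a two-form. -/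
def asdPart (w : Matrix (Fin 4) (Fin 4) ℝ) : Fin 3 → ℝ :=
  ![w 0 1 - w 2 3, w 0 2 + w 1 3, w 0 3 - w 1 2]

lemma asdBasis_transpose (i : Fin 3) : (asdBasis i).transpose = -asdBasis i := by
  ext a b
  fin_cases i <;> fin_cases a <;> fin_cases b <;> simp [asdBasis]

lemma asdPart_asdBasis (i : Fin 3) : asdPart (asdBasis i) = Pi.single i 2 := by
  ext j
  fin_cases i <;> fin_cases j <;> simp [asdBasis, asdPart] <;> norm_num

lemma asdTensor_zero_succ (ψ : Matrix (Fin 3) (Fin 3) ℝ) (i j : Fin 3) :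
    asdTensor ψ 0 i.succ 0 j.succ = ψ i j := by
  fin_cases i <;> fin_cases j <;> simp [asdTensor, asdBasis, Fin.sum_univ_three]

lemma sum_asdTensor_mul (ψ : Matrix (Fin 3) (Fin 3) ℝ) {w : Matrix (Fin 4) (Fin 4) ℝ}
    (hw : w.transpose = -w) (a b : Fin 4) : ∑ c, ∑ d, asdTensor ψ a b c d * w c d
      = 2 * ∑ i, (ψ.mulVec (asdPart w)) i * asdBasis i a b := by
  have w' : ∀ a b, w a b = -w b a := fun a b => by
    rw [← Matrix.neg_apply, ← hw, Matrix.transpose_apply]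
  have w0 : ∀ a, w a a = 0 := fun a => self_eq_neg.1 (w' a a)
  have h : ∀ j, ∑ c, ∑ d, asdBasis j c d * w c d = 2 * asdPart w j := by
    intro j
    fin_cases j <;> simp [asdBasis, asdPart, Fin.sum_univ_four, w' 1 0, w' 2 0, w' 3 0,
      w' 2 1, w' 3 1, w' 3 2] <;> ring
  have e : ∀ c d, asdTensor ψ a b c d * w c d
      = ∑ i, ∑ j, ψ i j * asdBasis i a b * (asdBasis j c d * w c d) := by
    intro c d
    simp only [asdTensor, Finset.sum_mul]
    exact Finset.sum_congr rfl fun i _ => Finset.sum_congr rfl fun j _ => by ring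
  have e2 : ∑ c, ∑ d, asdTensor ψ a b c d * w c d
      = ∑ i, ∑ j, ψ i j * asdBasis i a b * (∑ c, ∑ d, asdBasis j c d * w c d) := by
    simp only [e, Finset.mul_sum]
    rw [Finset.sum_comm' (t' := Finset.univ) (s' := fun _ => Finset.univ) (by simp)]
    simp only [Fin.sum_univ_three, Finset.sum_add_distrib]
    simp only [Fin.sum_univ_four]
    ring
  rw [e2]
  simp only [h, Matrix.mulVec, dotProduct, Finset.sum_mul, Finset.mul_sum]
  exact Finset.sum_congr rfl fun i _ => Finset.sum_congr rfl fun j _ => by ring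

lemma sum_asdBasis_eq_zero {x : Fin 3 → ℝ} (h : ∀ a b, ∑ i, x i * asdBasis i a b = 0) : x = 0 := by
  ext i
  have := h 0 i.succ
  fin_cases i <;> simpa [asdBasis, Fin.sum_univ_three] using this

/-- Self-dual two-forms commute with anti-self-dual ones. -/
lemma commute_of_asdPart_eq_zero {w : Matrix (Fin 4) (Fin 4) ℝ} (hw : w.transpose = -w)
    (h : asdPart w = 0) (i : Fin 3) : asdBasis i * w = w * asdBasis i := by
  have w' : ∀ a b, w a b = -w b a := fun a b => by
    rw [← Matrix.neg_apply, ← hw, Matrix.transpose_apply]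
  have w0 : ∀ a, w a a = 0 := fun a => self_eq_neg.1 (w' a a)
  have h0 : w 0 1 = w 2 3 := by simpa [asdPart, sub_eq_zero] using congrFun h 0
  have h1 : w 0 2 = -w 1 3 := by simpa [asdPart, add_eq_zero_iff_eq_neg] using congrFun h 1
  have h2 : w 0 3 = w 1 2 := by simpa [asdPart, sub_eq_zero] using congrFun h 2
  ext a b
  simp only [Matrix.mul_apply, Fin.sum_univ_four]
  fin_cases i <;> fin_cases a <;> fin_cases b <;>
    simp [asdBasis, w0, w' 1 0, w' 2 0, w' 3 0, w' 2 1, w' 3 1, w' 3 2, h0, h1, h2]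

/-- Commuting self-dual two-forms are proportional. -/
lemma exists_eq_smul_of_asdPart_eq_zero {w F : Matrix (Fin 4) (Fin 4) ℝ}
    (hw : w.transpose = -w) (hF : F.transpose = -F) (pw : asdPart w = 0) (pF : asdPart F = 0)
    (hF0 : F ≠ 0) (hc : w * F = F * w) : ∃ c : ℝ, w = c • F := by
  have w' : ∀ a b, w a b = -w b a := fun a b => by
    rw [← Matrix.neg_apply, ← hw, Matrix.transpose_apply]
  have w0 : ∀ a, w a a = 0 := fun a => self_eq_neg.1 (w' a a)
  have f' : ∀ a b, F a b = -F b a := fun a b => by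
    rw [← Matrix.neg_apply, ← hF, Matrix.transpose_apply]
  have f0 : ∀ a, F a a = 0 := fun a => self_eq_neg.1 (f' a a)
  have h0 : w 2 3 = w 0 1 := by
    have := congrFun pw 0
    simp [asdPart] at this; linarith
  have h1 : w 1 3 = -w 0 2 := by
    have := congrFun pw 1
    simp [asdPart] at this; linarith
  have h2 : w 1 2 = w 0 3 := by
    have := congrFun pw 2
    simp [asdPart] at this; linarith
  have k0 : F 2 3 = F 0 1 := by
    have := congrFun pF 0
    simp [asdPart] at this; linarith
  have k1 : F 1 3 = -F 0 2 := by
    have := congrFun pF 1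
    simp [asdPart] at this; linarith
  have k2 : F 1 2 = F 0 3 := by
    have := congrFun pF 2
    simp [asdPart] at this; linarith
  -- The commutator of two self-dual forms is, up to a factor, the cross product of their
  -- coefficient vectors. It vanishes only for parallel vectors; the ratio is taken at a nonzero
  -- coefficient of `F`.
  have c : ∀ a b, (w * F) a b = (F * w) a b := fun a b => by rw [hc]
  have c1 := c 0 1
  have c2 := c 0 2
  have c3 := c 0 3
  simp [Matrix.mul_apply, Fin.sum_univ_four, w0, w' 2 1, w' 3 1, w' 3 2, f0, f' 2 1,
    f' 3 1, f' 3 2, h0, h1, h2, k0, k1, k2] at c1 c2 c3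
  have ext' : ∀ c, w 0 1 = c * F 0 1 → w 0 2 = c * F 0 2 → w 0 3 = c * F 0 3 → w = c • F := by
    intro c e1 e2 e3
    ext a b
    fin_cases a <;> fin_cases b <;> simp [w0, w' 1 0, w' 2 0, w' 3 0, w' 2 1, w' 3 1, w' 3 2,
      f0, f' 1 0, f' 2 0, f' 3 0, f' 2 1, f' 3 1, f' 3 2, h0, h1, h2, k0, k1, k2, e1, e2, e3]
  by_cases z1 : F 0 1 = 0
  · by_cases z2 : F 0 2 = 0
    · by_cases z3 : F 0 3 = 0
      · refine absurd ?_ hF0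
        ext a b
        fin_cases a <;> fin_cases b <;> simp [f0, f' 1 0, f' 2 0, f' 3 0, f' 2 1, f' 3 1, f' 3 2,
          k0, k1, k2, z1, z2, z3]
      · refine ⟨w 0 3 / F 0 3, ext' _ ?_ ?_ ?_⟩ <;> field_simp <;> linarith
    · refine ⟨w 0 2 / F 0 2, ext' _ ?_ ?_ ?_⟩ <;> field_simp <;> linarith
  · refine ⟨w 0 1 / F 0 1, ext' _ ?_ ?_ ?_⟩ <;> field_simp <;> linarith

/-- The symmetric part of `(asdBasis i)ᵀ * asdBasis j` is `δ_ij` times the identity, so for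
symmetric `ψ` the Ricci tensor is `tr ψ` times the metric. -/
lemma asdTensor_ricci {ψ : Matrix (Fin 3) (Fin 3) ℝ} (hψ : ∀ i j, ψ i j = ψ j i)
    (ht : ψ.trace = 0) (b d : Fin 4) : ∑ a, asdTensor ψ a b a d = 0 := by
  have h : ψ 2 2 = -ψ 0 0 - ψ 1 1 := by
    rw [Matrix.trace_fin_three] at ht; linarith
  fin_cases b <;> fin_cases d <;>
    simp [asdTensor, asdBasis, Fin.sum_univ_four, Fin.sum_univ_three, hψ 1 0, hψ 2 0, hψ 2 1,
      h]
  ring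

/-- The wedge pairing is negative definite on anti-self-dual forms, so the density vanishes only for
`ψ = 0`. -/
lemma pontryagin_asdTensor (ψ : Matrix (Fin 3) (Fin 3) ℝ) :
    pontryagin 1 (asdTensor ψ) = -4 * ∑ i, ∑ j, ψ i j ^ 2 := by
  simp [pontryagin, asdTensor, asdBasis, Fin.sum_univ_four, Fin.sum_univ_three]
  ring

/-- A tensor of Gauss form satisfies the first Bianchi identity, whose totally antisymmetric
component is here a multiple of the trace. -/
lemma IsGaussTensor.trace_eq_zero {ψ : Matrix (Fin 3) (Fin 3) ℝ} {ε₁ ε₂ : ℝ}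
    {H₁ H₂ : Matrix (Fin 4) (Fin 4) ℝ} (hR : IsGaussTensor (asdTensor ψ) ε₁ ε₂ H₁ H₂) :
    ψ.trace = 0 := by
  have h : asdTensor ψ 0 1 2 3 + asdTensor ψ 0 2 3 1 + asdTensor ψ 0 3 1 2 = 0 := by
    simp only [hR.eq]
    rw [hR.symm₁ 2 1, hR.symm₁ 3 1, hR.symm₁ 3 2, hR.symm₂ 2 1, hR.symm₂ 3 1, hR.symm₂ 3 2]
    ring
  simp [asdTensor, asdBasis, Fin.sum_univ_three] at h
  rw [Matrix.trace_fin_three]; linarith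

lemma IsGaussTensor.asdTensor_symm {ψ : Matrix (Fin 3) (Fin 3) ℝ} {ε₁ ε₂ : ℝ}
    {H₁ H₂ : Matrix (Fin 4) (Fin 4) ℝ} (hR : IsGaussTensor (asdTensor ψ) ε₁ ε₂ H₁ H₂)
    (i j : Fin 3) : ψ i j = ψ j i := by
  rw [← asdTensor_zero_succ ψ i j, hR.pair_symm, asdTensor_zero_succ]

/-- An anti-self-dual Ricci-flat curvature tensor with nondegenerate Weyl operator is not that of a
submanifold of codimension two. -/
theorem asdTensor_not_isGaussTensor {ψ : Matrix (Fin 3) (Fin 3) ℝ} (hψ : ψ.det ≠ 0) (ε₁ ε₂ : ℝ)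
    (H₁ H₂ : Matrix (Fin 4) (Fin 4) ℝ) : ¬ IsGaussTensor (asdTensor ψ) ε₁ ε₂ H₁ H₂ := by
  intro hR
  have t₁ : H₁.transpose = H₁ := Matrix.ext fun a b => hR.symm₁ b a
  have t₂ : H₂.transpose = H₂ := Matrix.ext fun a b => hR.symm₂ b a
  have hψ0 : ψ ≠ 0 := by
    rintro rfl
    simp at hψ
  obtain ⟨F, F', hF, -, hF', a₁, a₂, hsq⟩ := hR.exists_anticommute (A := 1) (l := 0)
    (S₁ := H₁) (S₂ := H₂) (by simp)
    (fun b d => by simpa using asdTensor_ricci hR.asdTensor_symm hR.trace_eq_zero b d)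
    (by
      rw [pontryagin_asdTensor]
      refine mul_ne_zero (by norm_num) fun h => hψ0 ?_
      ext i j
      have h' := (Finset.sum_eq_zero_iff_of_nonneg
        (fun i _ => Finset.sum_nonneg fun j _ => sq_nonneg (ψ i j))).1 h i (Finset.mem_univ _)
      simpa using (Finset.sum_eq_zero_iff_of_nonneg
        (fun j _ => sq_nonneg (ψ i j))).1 h' j (Finset.mem_univ _))
    (by simp [Pi.one_def]) (by simp [Pi.one_def])
  have tF : F.transpose = -F := by
    rw [hF]; simp [Matrix.transpose_mul, t₁, t₂]
  have ker : ∀ w : Matrix (Fin 4) (Fin 4) ℝ, w.transpose = -w →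
      ε₁ • (H₁ * w * H₁) + ε₂ • (H₂ * w * H₂) = 0 → asdPart w = 0 := by
    intro w hw h
    have h2 := sum_asdBasis_eq_zero (x := ψ.mulVec (asdPart w)) fun a b => by
      have := hR.sum_mul hw a b
      rw [sum_asdTensor_mul ψ hw, h, Matrix.zero_apply] at this
      linarith
    exact Matrix.eq_zero_of_mulVec_eq_zero hψ h2
  have pF : asdPart F = 0 := ker F tF (by simpa using curvature_normal a₁ a₂ hsq)
  have hF0 : F ≠ 0 := by
    rintro rfl
    rw [Matrix.mul_zero] at hF'
    exact zero_ne_one hF'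
  -- Among the self-dual forms, which make up the kernel, only the multiples of `F` commute with
  -- `F`. Since `l = 0`, the conclusion is that the operator vanishes on everything commuting with
  -- `F`, in particular on the anti-self-dual forms.
  obtain ⟨q, -, -, hop⟩ := curvature_eq_of_eigenspace hF hF' t₁ t₂ a₁ a₂ hsq
    fun w hw hc h => exists_eq_smul_of_asdPart_eq_zero hw tF (ker w hw (by simpa using h)) pF
      hF0 hc
  have := ker (asdBasis 0) (asdBasis_transpose 0)
    (by rw [hop _ (commute_of_asdPart_eq_zero tF pF 0)]; simp)
  rw [asdPart_asdBasis] at this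
  simpa using congrFun this 0

/-! ### Change of frame, and curvature commuting with the quaternions. -/

open Matrix in
/-- The components `E^i_a E^j_b E^k_c E^l_d R_{ijkl}` of a curvature tensor in a frame. -/
def frameTensor (E : Matrix (Fin 4) (Fin 4) ℝ) (R : Fin 4 → Fin 4 → Fin 4 → Fin 4 → ℝ)
    (a b c d : Fin 4) : ℝ :=
  ∑ k, ∑ l, E k c * E l d * (Eᵀ * Matrix.of (fun i j => R i j k l) * E) a b

/-- The multiplication by the first two quaternion units, on the basis formed by the unit vector and
its images under the three units. -/
def quatMatrix : Fin 2 → Matrix (Fin 4) (Fin 4) ℝ :=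
  ![!![0, -1, 0, 0; 1, 0, 0, 0; 0, 0, 0, -1; 0, 0, 1, 0],
    !![0, 0, -1, 0; 0, 0, 0, 1; 1, 0, 0, 0; 0, -1, 0, 0]]

section Frame

open Matrix

lemma frame_sum_mul_sum (E X Y : Matrix (Fin 4) (Fin 4) ℝ) (a b c d : Fin 4) :
    ∑ k, ∑ l, E k c * E l d * ∑ j, (∑ i, E i a * (X i k * Y j l)) * E j b
      = (Eᵀ * X * E) a c * (Eᵀ * Y * E) b d := by
  have h : ∀ (Z : Matrix (Fin 4) (Fin 4) ℝ) a c,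
      (Eᵀ * Z * E) a c = ∑ k, (∑ i, E i a * Z i k) * E k c := fun Z a c => by
    simp only [Matrix.mul_apply, Matrix.transpose_apply]
  rw [h, h, Finset.sum_mul_sum]
  refine Finset.sum_congr rfl fun k _ => Finset.sum_congr rfl fun l _ => ?_
  have e : (∑ i, E i a * X i k) * E k c * ((∑ i, E i b * Y i l) * E l d)
      = E k c * E l d * ((∑ i, E i b * Y i l) * ∑ i, E i a * X i k) := by ring
  rw [e, Finset.sum_mul]
  congr 1
  refine Finset.sum_congr rfl fun j _ => ?_
  rw [Finset.sum_mul, Finset.mul_sum]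
  exact Finset.sum_congr rfl fun i _ => by ring

lemma IsGaussTensor.frame {R : Fin 4 → Fin 4 → Fin 4 → Fin 4 → ℝ} {ε₁ ε₂ : ℝ}
    {H₁ H₂ : Matrix (Fin 4) (Fin 4) ℝ} (hR : IsGaussTensor R ε₁ ε₂ H₁ H₂)
    (E : Matrix (Fin 4) (Fin 4) ℝ) :
    IsGaussTensor (frameTensor E R) ε₁ ε₂ (Eᵀ * H₁ * E) (Eᵀ * H₂ * E) := by
  have symm : ∀ H : Matrix (Fin 4) (Fin 4) ℝ, (∀ a b, H a b = H b a) →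
      ∀ a b, (Eᵀ * H * E) a b = (Eᵀ * H * E) b a := by
    intro H hH a b
    have hH' : Hᵀ = H := Matrix.ext fun a b => hH b a
    have : (Eᵀ * H * E)ᵀ = Eᵀ * H * E := by
      simp [Matrix.transpose_mul, hH', Matrix.mul_assoc]
    rw [← Matrix.transpose_apply (Eᵀ * H * E), this]
  refine ⟨symm _ hR.symm₁, symm _ hR.symm₂, fun a b c d => ?_⟩
  have swap : ∀ X : Matrix (Fin 4) (Fin 4) ℝ,
      ∑ k, ∑ l, E k c * E l d * ∑ j, (∑ i, E i a * (X i l * X j k)) * E j b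
      = (Eᵀ * X * E) a d * (Eᵀ * X * E) b c := by
    intro X
    rw [← frame_sum_mul_sum, Finset.sum_comm]
    exact Finset.sum_congr rfl fun k _ => Finset.sum_congr rfl fun l _ => by ring
  rw [← swap H₁, ← swap H₂, ← frame_sum_mul_sum, ← frame_sum_mul_sum]
  simp only [frameTensor, Matrix.mul_apply, Matrix.transpose_apply, Matrix.of_apply, hR.eq]
  simp only [Finset.mul_sum, Finset.sum_mul, ← Finset.sum_sub_distrib, ← Finset.sum_add_distrib]
  refine Finset.sum_congr rfl fun k _ => Finset.sum_congr rfl fun l _ =>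
    Finset.sum_congr rfl fun j _ => Finset.sum_congr rfl fun i _ => ?_
  ring

/-- The commutant of the left quaternion multiplications consists of the right ones, and the
antisymmetric ones among these are the anti-self-dual forms. Two units suffice, since they generate
the third. -/
lemma eq_sum_asdBasis {M : Matrix (Fin 4) (Fin 4) ℝ} (hM : Mᵀ = -M)
    (hc : ∀ n, M * quatMatrix n = quatMatrix n * M) : M = ∑ i, M 0 i.succ • asdBasis i := by
  have M' : ∀ a b, M a b = -M b a := fun a b => by
    rw [← Matrix.neg_apply, ← hM, Matrix.transpose_apply]
  have M0 : ∀ a, M a a = 0 := fun a => self_eq_neg.1 (M' a a)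
  have c : ∀ n a b, (M * quatMatrix n) a b = (quatMatrix n * M) a b := fun n a b => by rw [hc]
  have c1 := c 0 0 2
  have c2 := c 0 0 3
  have c3 := c 1 0 3
  simp [Matrix.mul_apply, Fin.sum_univ_four, quatMatrix] at c1 c2 c3
  have e1 : M 2 3 = -M 0 1 := by linarith
  have e2 : M 1 3 = M 0 2 := by linarith
  have e3 : M 1 2 = -M 0 3 := by linarith
  ext a b
  fin_cases a <;> fin_cases b <;>
    simp [Fin.sum_univ_three, asdBasis, M0, M' 1 0, M' 2 0, M' 3 0, M' 2 1, M' 3 1, M' 3 2,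
      e1, e2, e3]

/-- A curvature tensor whose endomorphisms commute with the quaternion units, and which satisfies
the Gauss equation, is anti-self-dual. -/
theorem exists_asdTensor {E P : Matrix (Fin 4) (Fin 4) ℝ} (hPE : P * E = 1)
    {R : Fin 4 → Fin 4 → Fin 4 → Fin 4 → ℝ} {T : Fin 4 → Fin 4 → Matrix (Fin 4) (Fin 4) ℝ}
    (hT : ∀ c d, Matrix.of (fun a b => R a b c d) = Pᵀ * P * T c d)
    (hc : ∀ c d n, T c d * (E * quatMatrix n * P) = E * quatMatrix n * P * T c d)
    {ε₁ ε₂ : ℝ} {H₁ H₂ : Matrix (Fin 4) (Fin 4) ℝ} (hR : IsGaussTensor R ε₁ ε₂ H₁ H₂) :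
    ∃ ψ, IsGaussTensor (asdTensor ψ) ε₁ ε₂ (Eᵀ * H₁ * E) (Eᵀ * H₂ * E) ∧
      ∀ a b c d, T c d a b
        = ∑ i, ∑ j, ψ i j * ((E * asdBasis i * P) a b * (Pᵀ * asdBasis j * P) c d) := by
  have hEP : E * P = 1 := mul_eq_one_comm.1 hPE
  have hEPt : Eᵀ * Pᵀ = 1 := by rw [← Matrix.transpose_mul, hPE, Matrix.transpose_one]
  have hPEt : Pᵀ * Eᵀ = 1 := mul_eq_one_comm.1 hEPt
  set M : Fin 4 → Fin 4 → Matrix (Fin 4) (Fin 4) ℝ := fun c d => P * T c d * E with hM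
  have hM' : ∀ c d, M c d = Eᵀ * Matrix.of (fun a b => R a b c d) * E := fun c d => by
    rw [hT, hM]
    simp only [← Matrix.mul_assoc, hEPt, Matrix.one_mul]
  have hMt : ∀ c d, (M c d)ᵀ = -M c d := fun c d => by
    rw [hM']
    have : (Matrix.of fun a b => R a b c d)ᵀ = -Matrix.of fun a b => R a b c d :=
      Matrix.ext fun a b => hR.antisymm₁ b a c d
    rw [Matrix.transpose_mul, Matrix.transpose_mul, Matrix.transpose_transpose, this,
      Matrix.neg_mul, Matrix.mul_neg, Matrix.mul_assoc]
  have hMc : ∀ c d n, M c d * quatMatrix n = quatMatrix n * M c d := fun c d n => by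
    have h := congrArg (fun X => P * X * E) (hc c d n)
    simp only [Matrix.mul_assoc, hPE, Matrix.mul_one] at h
    rw [hM]
    simp only [Matrix.mul_assoc]
    rw [h, ← Matrix.mul_assoc P, hPE, Matrix.one_mul]
  have hMs : ∀ c d, M c d = ∑ i : Fin 3, M c d 0 i.succ • asdBasis i :=
    fun c d => eq_sum_asdBasis (hMt c d) (hMc c d)
  set m : Fin 3 → Matrix (Fin 4) (Fin 4) ℝ := fun i => Matrix.of fun c d => M c d 0 i.succ with hm
  have hR' : ∀ a b c d, frameTensor E R a b c d = ∑ i, asdBasis i a b * (Eᵀ * m i * E) c d := by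
    intro a b c d
    have h1 : ∀ k l, (Eᵀ * Matrix.of (fun i j => R i j k l) * E) a b
        = ∑ i, m i k l * asdBasis i a b := fun k l => by
      rw [← hM', hMs, Matrix.sum_apply]; rfl
    simp only [frameTensor, h1]
    have h2 : ∀ i, (Eᵀ * m i * E) c d = ∑ k, ∑ l, E k c * E l d * m i k l := fun i => by
      simp only [Matrix.mul_apply, Matrix.transpose_apply, Finset.sum_mul]
      rw [Finset.sum_comm]
      exact Finset.sum_congr rfl fun k _ => Finset.sum_congr rfl fun l _ => by ring
    simp only [h2, Fin.sum_univ_three, Finset.mul_sum, ← Finset.sum_add_distrib]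
    exact Finset.sum_congr rfl fun k _ => Finset.sum_congr rfl fun l _ => by ring
  have hR0 : ∀ (i : Fin 3) c d, frameTensor E R 0 i.succ c d = (Eᵀ * m i * E) c d := by
    intro i c d
    rw [hR']
    fin_cases i <;> simp [Fin.sum_univ_three, asdBasis]
  have hG := hR.frame E
  -- Commutation with the units has made the first index pair anti-self-dual. The pair symmetry,
  -- supplied by the Gauss form, carries this over to the second pair.
  set ψ : Matrix (Fin 3) (Fin 3) ℝ := Matrix.of fun i j => (Eᵀ * m j * E) 0 i.succ with hψ
  have hmψ : ∀ i, Eᵀ * m i * E = ∑ j, ψ i j • asdBasis j := by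
    intro i
    ext c d
    rw [← hR0, hG.pair_symm, hR', Matrix.sum_apply]
    refine Finset.sum_congr rfl fun j _ => ?_
    rw [← hR0, hG.pair_symm, hR0, mul_comm]
    simp only [Matrix.smul_apply, smul_eq_mul, hψ, Matrix.of_apply]
    congr 1
    rw [← hR0, hG.pair_symm, hR0]
  refine ⟨ψ, ?_, fun a b c d => ?_⟩
  · have : frameTensor E R = asdTensor ψ := by
      funext a b c d
      rw [hR']
      simp only [asdTensor, hmψ, Matrix.sum_apply, Matrix.smul_apply, smul_eq_mul, Finset.mul_sum]
      exact Finset.sum_congr rfl fun i _ => Finset.sum_congr rfl fun j _ => by ring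
    rwa [← this]
  · have h1 : T c d = ∑ i, m i c d • (E * asdBasis i * P) := by
      have : T c d = E * M c d * P := by
        rw [hM]
        simp only [Matrix.mul_assoc, hEP, Matrix.mul_one]
        rw [← Matrix.mul_assoc, hEP, Matrix.one_mul]
      rw [this, hMs, Matrix.mul_sum, Matrix.sum_mul]
      exact Finset.sum_congr rfl fun i _ => by
        rw [Matrix.mul_smul, Matrix.smul_mul]; rfl
    have h2 : ∀ i, m i = ∑ j, ψ i j • (Pᵀ * asdBasis j * P) := by
      intro i
      have : m i = Pᵀ * (Eᵀ * m i * E) * P := by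
        simp only [Matrix.mul_assoc, hEP, Matrix.mul_one]
        rw [← Matrix.mul_assoc, hPEt, Matrix.one_mul]
      rw [this, hmψ, Matrix.mul_sum, Matrix.sum_mul]
      exact Finset.sum_congr rfl fun i _ => by rw [Matrix.mul_smul, Matrix.smul_mul]
    rw [h1, Matrix.sum_apply]
    refine Finset.sum_congr rfl fun i _ => ?_
    rw [Matrix.smul_apply, smul_eq_mul, h2, Matrix.sum_apply, Finset.sum_mul]
    refine Finset.sum_congr rfl fun j _ => ?_
    rw [Matrix.smul_apply, smul_eq_mul]
    ring

end Frame

/-! ### The invariant `J` of an anti-self-dual curvature tensor -/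

section Invariant

open Matrix

lemma trace_asdBasis (i j : Fin 3) :
    ((asdBasis i)ᵀ * asdBasis j).trace = if i = j then 4 else 0 := by
  fin_cases i <;> fin_cases j <;>
    simp [Matrix.trace, Matrix.mul_apply, Fin.sum_univ_four, asdBasis] <;> norm_num

lemma sum_transpose_asdBasis_mul {ψ : Matrix (Fin 3) (Fin 3) ℝ} (hψ : ∀ i j, ψ i j = ψ j i)
    (ht : ψ.trace = 0) : ∑ i, ∑ j, ψ i j • ((asdBasis i)ᵀ * asdBasis j) = 0 := by
  have h : ψ 2 2 = -ψ 0 0 - ψ 1 1 := by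
    rw [Matrix.trace_fin_three] at ht; linarith
  ext a b
  simp only [Matrix.sum_apply, Fin.sum_univ_three, Matrix.smul_apply, Matrix.mul_apply,
    Fin.sum_univ_four, Matrix.transpose_apply, Matrix.add_apply, hψ 1 0, hψ 2 0, hψ 2 1, h]
  fin_cases a <;> fin_cases b <;> simp [asdBasis]

lemma sum_mul_mul_eq_trace {n : Type*} [Fintype n] (X Y : Matrix n n ℝ) :
    ∑ a, ∑ b, X a b * Y a b = (Xᵀ * Y).trace := by
  simp only [Matrix.trace, Matrix.diag, Matrix.mul_apply, Matrix.transpose_apply]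
  exact Finset.sum_comm

lemma quatMatrix_transpose_mul_asdBasis (i : Fin 3) :
    (quatMatrix 0)ᵀ * asdBasis i * quatMatrix 0 = asdBasis i := by
  ext a b
  simp only [Matrix.mul_apply, Fin.sum_univ_four, Matrix.transpose_apply]
  fin_cases i <;> fin_cases a <;> fin_cases b <;> simp [asdBasis, quatMatrix]

lemma trace_quatMatrix_mul_asdBasis (i : Fin 3) : (quatMatrix 0 * asdBasis i).trace = 0 := by
  fin_cases i <;> simp [Matrix.trace, Fin.sum_univ_four, asdBasis, quatMatrix]

/-- Newton's identity: for `e₁ = 0` the third power sum of the eigenvalues is `3 e₃`. -/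
lemma trace_pow_three {ψ : Matrix (Fin 3) (Fin 3) ℝ} (ht : ψ.trace = 0) :
    (ψ ^ 3).trace = 3 * ψ.det := by
  have h : ψ 2 2 = -ψ 0 0 - ψ 1 1 := by
    rw [Matrix.trace_fin_three] at ht; linarith
  rw [pow_succ, pow_two, Matrix.trace_fin_three, Matrix.det_fin_three]
  simp only [Matrix.mul_apply, Fin.sum_univ_three, h]
  ring

/-- Such a curvature is Ricci-flat, so Weyl equals Riemann, and it is purely anti-self-dual, so the
projection changes nothing. On anti-self-dual forms the operator has matrix `2ψ`, and `tr (2ψ)³ = 8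
· 3 det ψ`. -/
theorem weylInvariantJ_eq {G : Coord4 → Matrix (Fin 4) (Fin 4) ℝ} {y : Coord4}
    {E P : Matrix (Fin 4) (Fin 4) ℝ} (hPE : P * E = 1) (hG : G y = Pᵀ * P)
    {ψ : Matrix (Fin 3) (Fin 3) ℝ} (hψ : ∀ i j, ψ i j = ψ j i) (ht : ψ.trace = 0)
    (hR : ∀ a b c d, riemannUp G a b c d y
        = ∑ i, ∑ j, ψ i j * ((E * asdBasis i * P) a b * (Pᵀ * asdBasis j * P) c d))
    {w : Matrix (Fin 4) (Fin 4) ℝ} (hw : w = Pᵀ * (quatMatrix 0)ᵀ * P)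
    {ε : Fin 4 → Fin 4 → Fin 4 → Fin 4 → ℝ}
    (hε : ∀ a b c d, ε a b c d = w a b * w c d - w a c * w b d + w a d * w b c) :
    weylInvariantJ G ε y = 24 * ψ.det := by
  have hEP : E * P = 1 := mul_eq_one_comm.1 hPE
  have hEPt : Eᵀ * Pᵀ = 1 := by rw [← Matrix.transpose_mul, hPE, Matrix.transpose_one]
  have hPEt : Pᵀ * Eᵀ = 1 := mul_eq_one_comm.1 hEPt
  have hGinv : (G y)⁻¹ = E * Eᵀ := by
    refine Matrix.inv_eq_right_inv ?_
    rw [hG, Matrix.mul_assoc, ← Matrix.mul_assoc P, hPE, Matrix.one_mul, hPEt]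
  have cancel : ∀ X : Matrix (Fin 4) (Fin 4) ℝ, Eᵀ * (Pᵀ * X) = X := fun X => by
    rw [← Matrix.mul_assoc, hEPt, Matrix.one_mul]
  have cancel' : ∀ X : Matrix (Fin 4) (Fin 4) ℝ, P * (E * X) = X := fun X => by
    rw [← Matrix.mul_assoc, hPE, Matrix.one_mul]
  have hric : ∀ b d, ricci G b d y = 0 := by
    intro b d
    have h := congrArg (fun X => (Pᵀ * X * P) b d) (sum_transpose_asdBasis_mul hψ ht)
    simp only [Matrix.mul_zero, Matrix.zero_mul, Matrix.zero_apply] at h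
    rw [← h, ricci]
    simp only [hR, Matrix.mul_sum, Matrix.sum_mul, Matrix.sum_apply]
    rw [Finset.sum_comm]
    refine Finset.sum_congr rfl fun i _ => ?_
    rw [Finset.sum_comm]
    refine Finset.sum_congr rfl fun j _ => ?_
    rw [← Finset.mul_sum, Matrix.mul_smul, Matrix.smul_mul, Matrix.smul_apply, smul_eq_mul]
    congr 1
    have : Pᵀ * ((asdBasis i)ᵀ * asdBasis j) * P
        = (E * asdBasis i * P)ᵀ * (Pᵀ * asdBasis j * P) := by
      simp only [Matrix.transpose_mul, Matrix.mul_assoc, cancel]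
    rw [this, Matrix.mul_apply]
    rfl
  have hweyl : ∀ a b c d, weyl G a b c d y
      = ∑ i, ∑ j, ψ i j * ((Pᵀ * asdBasis i * P) a b * (Pᵀ * asdBasis j * P) c d) := by
    intro a b c d
    simp only [weyl, hric, scalarCurvature, riemann, hR]
    simp only [mul_zero, Finset.sum_const_zero, sub_zero, zero_div, zero_mul, add_zero,
      Finset.mul_sum]
    rw [Finset.sum_comm]
    refine Finset.sum_congr rfl fun i _ => ?_
    rw [Finset.sum_comm]
    refine Finset.sum_congr rfl fun j _ => ?_
    have : Pᵀ * asdBasis i * P = G y * (E * asdBasis i * P) := by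
      rw [hG]
      simp only [Matrix.mul_assoc, cancel']
    have hmul : (G y * (E * asdBasis i * P)) a b = ∑ e, G y a e * (E * asdBasis i * P) e b :=
      Matrix.mul_apply
    rw [this, hmul, Finset.sum_mul, Finset.mul_sum]
    exact Finset.sum_congr rfl fun e _ => by ring
  -- the action of a product of two-forms
  have op : ∀ X : Matrix (Fin 4) (Fin 4) ℝ, ∀ p q,
      ∑ c, ∑ d, X c d * (G y)⁻¹ c p * (G y)⁻¹ d q = (E * (Eᵀ * X * E) * Eᵀ) p q := by
    intro X p q
    have hsymm : ∀ c p, (G y)⁻¹ c p = (G y)⁻¹ p c := fun c p => by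
      rw [← Matrix.transpose_apply (G y)⁻¹ p c, hGinv, Matrix.transpose_mul,
        Matrix.transpose_transpose]
    have : E * (Eᵀ * X * E) * Eᵀ = (G y)⁻¹ * X * (G y)⁻¹ := by
      rw [hGinv]; simp only [Matrix.mul_assoc]
    rw [this, Matrix.mul_apply, Finset.sum_comm]
    refine Finset.sum_congr rfl fun d _ => ?_
    rw [Matrix.mul_apply, Finset.sum_mul]
    refine Finset.sum_congr rfl fun c _ => ?_
    rw [hsymm c p]; ring
  -- `B` embeds `ℝ³` as the anti-self-dual forms and `C` pairs two-forms with their basis; the Weyl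
  -- operator factors through `ψ` as `B (ψ/2) C`.
  set B : Matrix (Fin 4 × Fin 4) (Fin 3) ℝ := Matrix.of fun p i => (Pᵀ * asdBasis i * P) p.1 p.2
    with hB
  set C : Matrix (Fin 3) (Fin 4 × Fin 4) ℝ := Matrix.of fun i p => (E * asdBasis i * Eᵀ) p.1 p.2
    with hC
  have hW : twoFormOperator (G y)⁻¹ (fun a b c d => weyl G a b c d y)
      = B * ((1 / 2 : ℝ) • ψ) * C := by
    ext p q
    simp only [twoFormOperator, Matrix.of_apply, hweyl]
    have h1 : ∀ j, (E * asdBasis j * Eᵀ) q.1 q.2 = ∑ c, ∑ d, (Pᵀ * asdBasis j * P) c d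
        * (G y)⁻¹ c q.1 * (G y)⁻¹ d q.2 := by
      intro j
      rw [op]
      simp only [Matrix.mul_assoc, cancel, hPE, Matrix.mul_one]
    simp only [Matrix.mul_apply, hB, hC, Matrix.of_apply, Matrix.smul_apply, smul_eq_mul]
    have h2 : ∀ i, (E * asdBasis i * Eᵀ) q.1 q.2 = ∑ a, (∑ b, E q.1 b * asdBasis i b a)
        * Eᵀ a q.2 := fun i => by simp only [Matrix.mul_apply]
    simp only [← h2, h1]
    have h3 : ∀ i a b, (Pᵀ * asdBasis i * P) a b = ∑ k, (∑ l, Pᵀ a l * asdBasis i l k)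
        * P k b := fun i a b => by simp only [Matrix.mul_apply]
    simp only [← h3]
    simp only [Fin.sum_univ_three, Finset.mul_sum, ← Finset.sum_add_distrib]
    exact Finset.sum_congr rfl fun c _ => Finset.sum_congr rfl fun d _ => by ring
  -- For the volume form built from `w`, the term `w` times the pairing of `w` with `X` vanishes by
  -- orthogonality. Each of the two others contributes `-X`, because anti-self-dual forms are
  -- invariant under the complex structure.
  have hstar : twoFormOperator (G y)⁻¹ ε * B = -B := by
    ext p i
    set X := Pᵀ * asdBasis i * P with hX
    have h1 : (twoFormOperator (G y)⁻¹ ε * B) p i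
        = (1 / 2) * ∑ c, ∑ d, ε p.1 p.2 c d * (E * asdBasis i * Eᵀ) c d := by
      have h2 : ∀ c d, (E * asdBasis i * Eᵀ) c d = ∑ a, ∑ b, X a b * (G y)⁻¹ c a * (G y)⁻¹ d b := by
        intro c d
        have hsymm : ∀ c p, (G y)⁻¹ c p = (G y)⁻¹ p c := fun c p => by
          rw [← Matrix.transpose_apply (G y)⁻¹ p c, hGinv, Matrix.transpose_mul,
            Matrix.transpose_transpose]
        simp only [hsymm c, hsymm d]
        rw [op, hX]
        simp only [Matrix.mul_assoc, cancel, hPE, Matrix.mul_one]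
      rw [Matrix.mul_apply, Fintype.sum_prod_type]
      simp only [twoFormOperator, Matrix.of_apply, hB, h2, Finset.mul_sum, Finset.sum_mul]
      have comm4 : ∀ f : Fin 4 → Fin 4 → Fin 4 → Fin 4 → ℝ,
          ∑ a, ∑ b, ∑ c, ∑ d, f a b c d = ∑ c, ∑ d, ∑ a, ∑ b, f a b c d := by
        intro f
        calc _ = ∑ a, ∑ c, ∑ b, ∑ d, f a b c d :=
              Finset.sum_congr rfl fun a _ => Finset.sum_comm
          _ = ∑ c, ∑ a, ∑ d, ∑ b, f a b c d := by
              rw [Finset.sum_comm]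
              exact Finset.sum_congr rfl fun c _ => Finset.sum_congr rfl fun a _ =>
                Finset.sum_comm
          _ = _ := Finset.sum_congr rfl fun c _ => Finset.sum_comm
      rw [comm4]
      refine Finset.sum_congr rfl fun c _ => Finset.sum_congr rfl fun d _ =>
        Finset.sum_congr rfl fun a _ => Finset.sum_congr rfl fun b _ => ?_
      rw [hX]; ring
    rw [h1, Matrix.neg_apply]
    set Y := E * asdBasis i * Eᵀ with hY
    have hYt : ∀ c d, Y c d = -Y d c := by
      have : Yᵀ = -Y := by
        rw [hY]
        simp [Matrix.transpose_mul, asdBasis_transpose, Matrix.mul_assoc]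
      intro c d
      rw [← Matrix.neg_apply, ← this, Matrix.transpose_apply]
    have tr0 : ∑ c, ∑ d, w c d * Y c d = 0 := by
      rw [sum_mul_mul_eq_trace, hw, hY]
      simp only [Matrix.transpose_mul, Matrix.transpose_transpose, Matrix.mul_assoc, cancel']
      rw [Matrix.trace_mul_comm]
      simp only [Matrix.mul_assoc, hEPt, Matrix.mul_one]
      exact trace_quatMatrix_mul_asdBasis i
    have conj : ∀ a b, ∑ c, ∑ d, w a c * w b d * Y c d = X a b := by
      intro a b
      have : X = w * Y * wᵀ := by
        rw [hw, hY, hX]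
        simp only [Matrix.transpose_mul, Matrix.transpose_transpose, Matrix.mul_assoc, cancel',
          cancel]
        rw [← Matrix.mul_assoc (quatMatrix 0)ᵀ, ← Matrix.mul_assoc ((quatMatrix 0)ᵀ * _),
          quatMatrix_transpose_mul_asdBasis]
      rw [this, Matrix.mul_apply, Finset.sum_comm]
      refine Finset.sum_congr rfl fun d _ => ?_
      rw [Matrix.mul_apply, Finset.sum_mul]
      exact Finset.sum_congr rfl fun c _ => by rw [Matrix.transpose_apply]; ring
    have e : ∑ c, ∑ d, ε p.1 p.2 c d * Y c d = w p.1 p.2 * (∑ c, ∑ d, w c d * Y c d)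
        - ∑ c, ∑ d, w p.1 c * w p.2 d * Y c d - ∑ c, ∑ d, w p.1 d * w p.2 c * Y d c := by
      simp only [Finset.mul_sum, ← Finset.sum_sub_distrib]
      refine Finset.sum_congr rfl fun c _ => Finset.sum_congr rfl fun d _ => ?_
      rw [hε, hYt d c]; ring
    rw [e, tr0, conj, Finset.sum_comm (f := fun c d => w p.1 d * w p.2 c * Y d c), conj]
    simp only [hB, Matrix.of_apply]
    ring
  have hCB : C * B = (4 : ℝ) • 1 := by
    ext i j
    have : (C * B) i j = ∑ a, ∑ b, (E * asdBasis i * Eᵀ) a b * (Pᵀ * asdBasis j * P) a b := by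
      rw [Matrix.mul_apply, Fintype.sum_prod_type]; rfl
    rw [this, sum_mul_mul_eq_trace]
    simp only [Matrix.transpose_mul, Matrix.transpose_transpose, Matrix.mul_assoc, cancel]
    rw [Matrix.trace_mul_comm]
    simp only [Matrix.mul_assoc, hPE, Matrix.mul_one]
    rw [trace_asdBasis]
    simp [Matrix.one_apply]
  have hK : (1 / 2 : ℝ) • (B * ((1 / 2 : ℝ) • ψ) * C
      - twoFormOperator (G y)⁻¹ ε * (B * ((1 / 2 : ℝ) • ψ) * C)) = B * ((1 / 2 : ℝ) • ψ) * C := by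
    rw [← Matrix.mul_assoc, ← Matrix.mul_assoc, hstar, Matrix.neg_mul, Matrix.neg_mul]
    module
  simp only [weylInvariantJ]
  rw [hW, hK]
  -- The factor 2 is `(1/2)³ · 4²`, with a 4 from each inner product `C B`.
  have h3 : (B * ((1 / 2 : ℝ) • ψ) * C) ^ 3 = B * ((2 : ℝ) • (ψ ^ 3)) * C := by
    have hCB' : ∀ Z : Matrix (Fin 3) (Fin 4 × Fin 4) ℝ, C * (B * Z) = (4 : ℝ) • Z := fun Z => by
      rw [← Matrix.mul_assoc, hCB, Matrix.smul_mul, Matrix.one_mul]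
    rw [pow_succ, pow_two, pow_succ, pow_two]
    simp only [Matrix.mul_assoc, hCB', Matrix.smul_mul, Matrix.mul_smul, smul_smul]
    norm_num
  rw [h3, Matrix.trace_mul_comm, ← Matrix.mul_assoc, hCB, Matrix.smul_mul, Matrix.one_mul,
    Matrix.trace_smul, Matrix.trace_smul, trace_pow_three ht]
  simp only [smul_eq_mul]
  ring

end Invariant

/-! ### Quaternionic frames -/

section QuaternionicFrame

open Matrix

/-- The quaternion relations, and the compatibility with a positive definite form, for the matrices
of three endomorphisms. -/
structure IsQuaternionic (G : Matrix (Fin 4) (Fin 4) ℝ) (U : Fin 3 → Matrix (Fin 4) (Fin 4) ℝ) :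
    Prop where
  symm : Gᵀ = G
  pos : ∀ x : Fin 4 → ℝ, x ≠ 0 → 0 < x ⬝ᵥ G *ᵥ x
  sq : ∀ n, U n * U n = -1
  mul : U 0 * U 1 = U 2
  hermitian : ∀ n, (U n)ᵀ * G * U n = G

/-- For a unit vector `v`, the vectors `v, U₀v, U₁v, U₂v` are orthonormal, since each `U n` is
orthogonal with square `-1` and hence skew. `E` has these as columns and `P = EᵀG` is its inverse.
-/
lemma IsQuaternionic.exists_frame {G : Matrix (Fin 4) (Fin 4) ℝ}
    {U : Fin 3 → Matrix (Fin 4) (Fin 4) ℝ} (h : IsQuaternionic G U) :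
    ∃ E P : Matrix (Fin 4) (Fin 4) ℝ, P * E = 1 ∧ G = Pᵀ * P ∧
      U 0 = E * quatMatrix 0 * P ∧ U 1 = E * quatMatrix 1 * P := by
  -- `(U₀U₁)² = -1` multiplied by `U₀` on the left and `U₁` on the right yields anticommutation.
  have mul' : U 1 * U 0 = -U 2 := by
    have h2 := congrArg (fun X => U 0 * X * U 1) (h.sq 2)
    simp only [← h.mul] at h2
    have : U 0 * (U 0 * U 1 * (U 0 * U 1)) * U 1 = (U 0 * U 0) * (U 1 * U 0) * (U 1 * U 1) := by
      simp only [Matrix.mul_assoc]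
    rw [this, h.sq, h.sq] at h2
    rw [← h.mul]
    simpa using h2
  set B : (Fin 4 → ℝ) → (Fin 4 → ℝ) → ℝ := fun x y => x ⬝ᵥ G *ᵥ y with hB
  have Bsymm : ∀ x y, B x y = B y x := by
    intro x y
    simp only [hB]
    rw [Matrix.dotProduct_mulVec, ← Matrix.mulVec_transpose, h.symm, dotProduct_comm]
  have Bneg : ∀ x y, B (-x) y = -B x y := fun x y => by simp [hB]
  have Binv : ∀ n x y, B (U n *ᵥ x) (U n *ᵥ y) = B x y := by
    intro n x y
    simp only [hB]
    rw [Matrix.mulVec_mulVec, Matrix.dotProduct_mulVec, ← Matrix.mulVec_transpose,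
      Matrix.mulVec_mulVec, Matrix.transpose_mul, h.symm, h.hermitian, ← h.symm,
      Matrix.mulVec_transpose, ← Matrix.dotProduct_mulVec, h.symm]
  have Usq : ∀ n x, U n *ᵥ U n *ᵥ x = -x := fun n x => by
    rw [Matrix.mulVec_mulVec, h.sq, Matrix.neg_mulVec, Matrix.one_mulVec]
  have Bskew : ∀ n x, B (U n *ᵥ x) x = 0 := by
    intro n x
    have := Binv n (U n *ᵥ x) x
    rw [Usq, Bneg, Bsymm x] at this
    linarith
  obtain ⟨v, hv⟩ : ∃ v, B v v = 1 := by
    set x : Fin 4 → ℝ := Pi.single 0 1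
    have hx : 0 < B x x := h.pos x (by simp [x])
    refine ⟨(Real.sqrt (B x x))⁻¹ • x, ?_⟩
    have : B ((Real.sqrt (B x x))⁻¹ • x) ((Real.sqrt (B x x))⁻¹ • x)
        = (Real.sqrt (B x x))⁻¹ * ((Real.sqrt (B x x))⁻¹ * B x x) := by
      simp [hB, Matrix.mulVec_smul]
    rw [this]
    have hs := Real.mul_self_sqrt hx.le
    have hs0 : Real.sqrt (B x x) ≠ 0 := (Real.sqrt_pos.2 hx).ne'
    field_simp
    rw [pow_two]
    exact hs.symm
  have U01 : U 0 *ᵥ U 1 *ᵥ v = U 2 *ᵥ v := by rw [Matrix.mulVec_mulVec, h.mul]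
  have U10 : U 1 *ᵥ U 0 *ᵥ v = -(U 2 *ᵥ v) := by
    rw [Matrix.mulVec_mulVec, mul', Matrix.neg_mulVec]
  have U02 : U 0 *ᵥ U 2 *ᵥ v = -(U 1 *ᵥ v) := by rw [← U01, Usq]
  have U12 : U 1 *ᵥ U 2 *ᵥ v = U 0 *ᵥ v := by
    rw [← neg_neg (U 2 *ᵥ v), ← U10, Matrix.mulVec_neg, Usq, neg_neg]
  have b12 : B (U 0 *ᵥ v) (U 1 *ᵥ v) = 0 := by
    rw [← Binv 0, Usq, U01, Bneg, Bsymm, Bskew, neg_zero]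
  have b13 : B (U 0 *ᵥ v) (U 2 *ᵥ v) = 0 := by
    rw [← Binv 0, Usq, U02, Bneg, Bsymm, Bneg, Bskew, neg_zero, neg_zero]
  have b23 : B (U 1 *ᵥ v) (U 2 *ᵥ v) = 0 := by
    rw [← Binv 1, Usq, U12, Bneg, Bsymm, Bskew, neg_zero]
  set w : Fin 4 → Fin 4 → ℝ := ![v, U 0 *ᵥ v, U 1 *ᵥ v, U 2 *ᵥ v] with hw
  set E : Matrix (Fin 4) (Fin 4) ℝ := Matrix.of fun k j => w j k with hE
  have horth : Eᵀ * G * E = 1 := by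
    have : ∀ i j, (Eᵀ * G * E) i j = B (w i) (w j) := by
      intro i j
      simp only [hB]
      rw [Matrix.mul_assoc, Matrix.mul_apply]
      rfl
    ext i j
    rw [this]
    fin_cases i <;> fin_cases j <;>
      simp [hw, Binv, hv, Bskew, b12, b13, b23, Bsymm v, Bsymm (U 1 *ᵥ v) (U 0 *ᵥ v),
        Bsymm (U 2 *ᵥ v) (U 0 *ᵥ v), Bsymm (U 2 *ᵥ v) (U 1 *ᵥ v)]
  have hEP : E * (Eᵀ * G) = 1 := mul_eq_one_comm.1 horth
  have hU : ∀ n j, ∀ k, (U n * E) k j = (U n *ᵥ w j) k := fun n j k => rfl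
  have hmul : ∀ (L : Matrix (Fin 4) (Fin 4) ℝ) k j, (E * L) k j = ∑ i, L i j * w i k := by
    intro L k j
    rw [Matrix.mul_apply]
    exact Finset.sum_congr rfl fun i _ => mul_comm _ _
  have conj : ∀ X L : Matrix (Fin 4) (Fin 4) ℝ, X * E = E * L → X = E * L * (Eᵀ * G) := by
    intro X L hX
    rw [← hX, Matrix.mul_assoc, hEP, Matrix.mul_one]
  refine ⟨E, Eᵀ * G, horth, ?_, conj _ _ ?_, conj _ _ ?_⟩
  · rw [Matrix.transpose_mul, Matrix.transpose_transpose, h.symm, Matrix.mul_assoc, hEP,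
      Matrix.mul_one]
  · ext k j
    rw [hU, hmul, Fin.sum_univ_four]
    fin_cases j <;> simp [hw, quatMatrix, Usq, U01, U02]
  · ext k j
    rw [hU, hmul, Fin.sum_univ_four]
    fin_cases j <;> simp [hw, quatMatrix, Usq, U10, U12]

lemma coord4_eq_sum (x : Coord4) : x = ∑ k, x k • basisVec k := by
  ext i
  simp [basisVec, Finset.sum_apply, Pi.single_apply]

/-- The matrices of a quaternionic structure on a Euclidean vector space, in the coordinates given
by a linear isomorphism. -/
lemma isQuaternionic_of_linear {T : Type*} [AddCommGroup T] [Module ℝ T]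
    (g : LinearMap.BilinForm ℝ T) (I : Fin 3 → T →ₗ[ℝ] T) (symm : ∀ v w, g v w = g w v) (pos : ∀ v, v ≠ 0 → 0 < g v v)
    (sq : ∀ n v, I n (I n v) = -v) (mul : ∀ v, I 0 (I 1 v) = I 2 v)
    (hermitian : ∀ n v w, g (I n v) (I n w) = g v w)
    (D : Coord4 →ₗ[ℝ] T) (D' : T →ₗ[ℝ] Coord4) (h₁ : ∀ x, D' (D x) = x) (h₂ : ∀ v, D (D' v) = v) :
    IsQuaternionic (Matrix.of fun i j => g (D (basisVec i)) (D (basisVec j)))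
      fun n => Matrix.of fun k j => D' (I n (D (basisVec j))) k := by
  have hmul : ∀ m n, (Matrix.of fun k j => D' (I m (D (basisVec j))) k)
      * (Matrix.of fun k j => D' (I n (D (basisVec j))) k)
      = (Matrix.of fun k j => D' (I m (I n (D (basisVec j)))) k : Matrix (Fin 4) (Fin 4) ℝ) := by
    intro m n
    ext k j
    have : I n (D (basisVec j)) = ∑ l, D' (I n (D (basisVec j))) l • D (basisVec l) := by
      conv_lhs => rw [← h₂ (I n (D (basisVec j))), coord4_eq_sum (D' (I n (D (basisVec j))))]
      simp only [map_sum, map_smul]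
    simp only [Matrix.of_apply]
    conv_rhs => rw [this]
    simp [Matrix.mul_apply, mul_comm]
  have hbil : ∀ x y : Coord4, g (D x) (D y)
      = ∑ k, x k * ∑ l, g (D (basisVec k)) (D (basisVec l)) * y l := by
    intro x y
    conv_lhs => rw [coord4_eq_sum x, coord4_eq_sum y]
    simp only [map_sum, LinearMap.sum_apply, map_smul, LinearMap.smul_apply, smul_eq_mul,
      Finset.mul_sum]
    rw [Finset.sum_comm]
    exact Finset.sum_congr rfl fun k _ => Finset.sum_congr rfl fun l _ => by ring
  refine ⟨?_, fun x hx => ?_, fun n => ?_, ?_, fun n => ?_⟩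
  · ext i j
    exact symm _ _
  · have hD : D (WithLp.toLp 2 x) ≠ 0 := by
      intro h0
      have := h₁ (WithLp.toLp 2 x)
      rw [h0, map_zero] at this
      apply hx
      ext i
      exact congrArg (fun z : Coord4 => z i) this.symm
    have := pos _ hD
    rw [hbil] at this
    exact this
  · rw [hmul]
    ext k j
    simp [sq, h₁, basisVec, Matrix.one_apply, PiLp.single_apply]
  · rw [hmul]
    ext k j
    simp [mul]
  · ext i j
    have e := hbil (D' (I n (D (basisVec i)))) (D' (I n (D (basisVec j))))
    rw [h₂, h₂, hermitian] at e
    rw [Matrix.of_apply, e, Matrix.mul_assoc, Matrix.mul_apply]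
    rfl

end QuaternionicFrame

/-! ### The curvature commutes with parallel endomorphisms -/

section Parallel

lemma pderiv_sub {f g : Coord4 → ℝ} {y : Coord4}
    (hf : DifferentiableAt ℝ f y) (hg : DifferentiableAt ℝ g y) (i : Fin 4) :
    pderiv i (fun z => f z - g z) y = pderiv i f y - pderiv i g y := by
  rw [pderiv, fderiv_fun_sub hf hg]; rfl

/-- This is the integrability condition of `∇U = 0`: the mixed second derivatives of `U` agree
exactly when `U` commutes with the curvature. -/
lemma riemannUp_mul_of_parallel {V : Set Coord4} (hV : IsOpen V)
    {G U : Coord4 → Matrix (Fin 4) (Fin 4) ℝ}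
    (hΓ : ∀ k i j, ContDiffOn ℝ ∞ (christoffel G k i j) V)
    (hU : ∀ i j, ContDiffOn ℝ ∞ (fun z => U z i j) V)
    (hpar : ∀ y ∈ V, ∀ i k j, partialDeriv i (fun z => U z k j) y
      + ∑ l, (christoffel G k i l y * U y l j - christoffel G l i j y * U y k l) = 0)
    {y : Coord4} (hy : y ∈ V) (c d : Fin 4) :
    Matrix.of (fun a b => riemannUp G a b c d y) * U y
      = U y * Matrix.of (fun a b => riemannUp G a b c d y) := by
  have dU : ∀ i j, DifferentiableAt ℝ (fun z => U z i j) y :=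
    fun i j => (hU i j).differentiableAt_of_isOpen hV hy
  have dΓ : ∀ k i j, DifferentiableAt ℝ (christoffel G k i j) y :=
    fun k i j => (hΓ k i j).differentiableAt_of_isOpen hV hy
  set N : Fin 4 → Matrix (Fin 4) (Fin 4) ℝ := fun i => Matrix.of fun k l => christoffel G k i l y
    with hN
  set dN : Fin 4 → Fin 4 → Matrix (Fin 4) (Fin 4) ℝ :=
    fun c d => Matrix.of fun k l => pderiv c (christoffel G k d l) y with hdN
  have p1 : ∀ z ∈ V, ∀ i k j, pderiv i (fun z => U z k j) z
      = ∑ l, U z k l * christoffel G l i j z - ∑ l, christoffel G k i l z * U z l j := by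
    intro z hz i k j
    have h := hpar z hz i k j
    rw [partialDeriv_eq_pderiv, Finset.sum_sub_distrib] at h
    have e : ∑ l, U z k l * christoffel G l i j z = ∑ l, christoffel G l i j z * U z k l :=
      Finset.sum_congr rfl fun l _ => mul_comm _ _
    rw [e]; linarith
  set W : Fin 4 → Matrix (Fin 4) (Fin 4) ℝ := fun c => U y * N c - N c * U y with hW
  have p1' : ∀ i k j, pderiv i (fun z => U z k j) y = W i k j := by
    intro i k j
    rw [p1 y hy]
    change _ = (U y * N i - N i * U y) k j
    rw [Matrix.sub_apply, Matrix.mul_apply, Matrix.mul_apply]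
    rfl
  -- The parallel equation reads `∂_d U = [U, N_d]`; it is differentiated once more, and `∂_c U`
  -- replaced by `W c = [U, N_c]`.
  have p2 : ∀ c d k j, pderiv c (pderiv d fun z => U z k j) y
      = (W c * N d + U y * dN c d - (dN c d * U y + N d * W c)) k j := by
    intro c d k j
    rw [pderiv_congr hV (fun z hz => p1 z hz d k j) hy c,
      pderiv_sub (f := fun z => ∑ l, U z k l * christoffel G l d j z)
        (g := fun z => ∑ l, christoffel G k d l z * U z l j)
        (DifferentiableAt.fun_sum fun l _ => (dU k l).mul (dΓ l d j))
        (DifferentiableAt.fun_sum fun l _ => (dΓ k d l).mul (dU l j)),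
      pderiv_sum _ (f := fun l z => U z k l * christoffel G l d j z)
        (fun l _ => (dU k l).mul (dΓ l d j)),
      pderiv_sum _ (f := fun l z => christoffel G k d l z * U z l j)
        (fun l _ => (dΓ k d l).mul (dU l j))]
    simp only [Matrix.sub_apply, Matrix.add_apply, Matrix.mul_apply,
      ← Finset.sum_add_distrib]
    congr 1
    · refine Finset.sum_congr rfl fun l _ => ?_
      rw [pderiv_mul (dU k l) (dΓ l d j), p1']
      rfl
    · refine Finset.sum_congr rfl fun l _ => ?_
      rw [pderiv_mul (dΓ k d l) (dU l j), p1']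
      rfl
  have hcomm : W c * N d + U y * dN c d - (dN c d * U y + N d * W c)
      = W d * N c + U y * dN d c - (dN d c * U y + N c * W d) := by
    ext k j
    rw [← p2, ← p2, pderiv_comm hV (hU k j) hy]
  have hR : Matrix.of (fun a b => riemannUp G a b c d y)
      = dN c d - dN d c + (N c * N d - N d * N c) := by
    ext a b
    simp only [riemannUp, Finset.sum_sub_distrib, Matrix.of_apply, Matrix.add_apply,
      Matrix.sub_apply, Matrix.mul_apply]
    rfl
  rw [hR]
  simp only [hW] at hcomm
  rw [← sub_eq_zero] at hcomm ⊢
  rw [← neg_eq_zero, ← hcomm]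
  noncomm_ring

end Parallel

/-! ### Hyper-Kähler four-manifolds -/

section HyperKahlerClass

variable {M : Type*} [TopologicalSpace M] [ChartedSpace Coord4 M] [IsManifold 𝓘(ℝ, Coord4) ∞ M]
  {g : MetricField Coord4 M} {I : Fin 3 → EndomorphismField M}

lemma IsHyperKahler.isQuaternionic (h : IsHyperKahler g I) {e : OpenPartialHomeomorph M Coord4}
    (he : e ∈ atlas Coord4 M) {y : Coord4} (hy : y ∈ e.target) :
    IsQuaternionic (metricMatrix g e y) fun n => endoMatrix (I n) e y := by
  have : IsManifold 𝓘(ℝ, Coord4) 1 M := IsManifold.of_le (n := ∞) (by simp)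
  have hd := mdifferentiable_of_mem_atlas (I := 𝓘(ℝ, Coord4)) he
  have h₁ := hd.comp_symm_deriv hy
  have h₂ := hd.symm_comp_deriv (e.map_target hy)
  rw [e.right_inv hy] at h₂
  exact isQuaternionic_of_linear (T := TangentSpace 𝓘(ℝ, Coord4) (e.symm y)) (g (e.symm y))
    (fun n => I n (e.symm y)) (h.symm _) (h.pos _) (fun n => h.sq n _) (h.mul _)
    (fun n => h.hermitian n _)
    (mfderiv 𝓘(ℝ, Coord4) 𝓘(ℝ, Coord4) e.symm y).toLinearMap
    (mfderiv 𝓘(ℝ, Coord4) 𝓘(ℝ, Coord4) e (e.symm y)).toLinearMap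
    (fun x => congrArg (fun L : Coord4 →L[ℝ] Coord4 => L x) h₁)
    (fun v => congrArg (fun L : TangentSpace 𝓘(ℝ, Coord4) (e.symm y) →L[ℝ]
      TangentSpace 𝓘(ℝ, Coord4) (e.symm y) => L v) h₂)

/-- A hyper-Kähler four-manifold has embedding class greater than two where `J` does not vanish
identically. -/
theorem two_lt_of_hyperKahler (h : IsHyperKahler g I) {U : Set M} (hU : IsOpen U)
    (hJ : ∃ p ∈ U, hyperKahlerJ g I p ≠ 0) : 2 < isometricEmbeddingClass g U := by
  obtain ⟨p, hpU, hJ⟩ := hJ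
  set e := chartAt Coord4 p with he
  have hea : e ∈ atlas Coord4 M := chart_mem_atlas Coord4 p
  set G := metricMatrix g e with hG
  set y := e p with hy
  have hyT : y ∈ e.target := e.map_source (mem_chart_source Coord4 p)
  have hsymm : ∀ z ∈ e.target, ∀ i j, G z i j = G z j i := fun z hz i j => by
    rw [← Matrix.transpose_apply (G z) j i, (h.isQuaternionic hea hz).symm]
  have hdet : ∀ z ∈ e.target, (G z).det ≠ 0 := by
    intro z hz
    obtain ⟨E, P, hPE, hGP, -, -⟩ := (h.isQuaternionic hea hz).exists_frame
    have hP : P.det ≠ 0 := fun h0 => by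
      have := congrArg Matrix.det hPE
      rw [Matrix.det_mul, h0, zero_mul, Matrix.det_one] at this
      exact zero_ne_one this
    rw [hG, hGP, Matrix.det_mul, Matrix.det_transpose]
    exact mul_ne_zero hP hP
  have hGs := h.smooth_metric e hea
  have hT := e.open_target
  have hVo : IsOpen (e.target ∩ e.symm ⁻¹' U) := e.isOpen_inter_preimage_symm hU
  refine two_lt_isometricEmbeddingClass (by simp) hU hVo (ψ := e.symm) (fun z hz => hz.2)
    ((contMDiffOn_chart_symm (x := p)).mono fun z hz => hz.1) (G := G) (fun z _ a b => rfl)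
    (y := y) ⟨hyT, by
      rw [mem_preimage, hy, e.left_inv (mem_chart_source Coord4 p)]; exact hpU⟩
    (hdet y hyT) fun ε₁ ε₂ H₁ H₂ hR => ?_
  obtain ⟨E, P, hPE, hGP, hU0, hU1⟩ := (h.isQuaternionic hea hyT).exists_frame
  set T : Fin 4 → Fin 4 → Matrix (Fin 4) (Fin 4) ℝ :=
    fun c d => Matrix.of fun a b => riemannUp G a b c d y with hTdef
  have hcomm : ∀ n c d, T c d * endoMatrix (I n) e y = endoMatrix (I n) e y * T c d :=
    fun n c d => riemannUp_mul_of_parallel hT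
      (fun k i j => contDiffOn_christoffel hT hGs hsymm hdet k i j)
      (h.smooth_complex n e hea) (h.parallel n e hea) hyT c d
  -- The Gauss equation assumed for contradiction itself supplies the symmetries of `R` that make it
  -- an anti-self-dual tensor in the quaternionic frame.
  obtain ⟨ψ, hψ, hψT⟩ := exists_asdTensor hPE (T := T) (R := lowerRiemann G y) (fun c d => by
      rw [← hGP]
      ext a b
      rw [Matrix.of_apply, ← riemann_eq_lowerRiemann hT hGs hsymm hdet hyT, Matrix.mul_apply]
      rfl)
    (fun c d n => by
      fin_cases n
      · have := hcomm 0 c d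
        rwa [hU0] at this
      · have := hcomm 1 c d
        rwa [hU1] at this) hR
  refine asdTensor_not_isGaussTensor (fun h0 => hJ ?_) _ _ _ _ hψ
  have key := weylInvariantJ_eq hPE hGP hψ.asdTensor_symm hψ.trace_eq_zero hψT
    (ε := complexVolume g (I 0) e y) (w := Matrix.of fun a b => kahlerForm g (I 0) e y a b) (by
      have hEPt : E.transpose * P.transpose = 1 := by
        rw [← Matrix.transpose_mul, hPE, Matrix.transpose_one]
      have : Matrix.of (fun a b => kahlerForm g (I 0) e y a b)
          = (endoMatrix (I 0) e y).transpose * G y := by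
        ext a b
        rw [Matrix.mul_apply]
        rfl
      rw [this, hG, hGP, hU0]
      simp only [Matrix.transpose_mul, Matrix.mul_assoc]
      rw [← Matrix.mul_assoc E.transpose, hEPt, Matrix.one_mul]) (fun a b c d => rfl)
  rw [h0, mul_zero] at key
  exact key

end HyperKahlerClass

end

/-- The Fubini-Study metric on `CP²`, the Lorentzian and Riemannian Kerr solutions, and hyper-Kähler
four-manifolds with `J ≠ 0` do not have isometric embedding class `2`, even locally: their class
is larger. -/
theorem corollary2p2 :
    (∀ U : Set CP2, IsOpen U → U.Nonempty → 2 < isometricEmbeddingClass CP2.fubiniStudy U) ∧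
    (∀ (M : Type*) [TopologicalSpace M] [ChartedSpace Coord4 M] [IsManifold 𝓘(ℝ, Coord4) ∞ M]
      (g : MetricField Coord4 M) (U : Set M), IsOpen U → ∀ m a : ℝ, m ≠ 0 → a ≠ 0 →
      (HasCoordinateRegion g U (lorentzianKerr m a) (lorentzianKerrDomain m a) ∨
        HasCoordinateRegion g U (riemannianKerr m a) (riemannianKerrDomain m a)) →
      2 < isometricEmbeddingClass g U) ∧
    (∀ (M : Type*) [TopologicalSpace M] [ChartedSpace Coord4 M] [IsManifold 𝓘(ℝ, Coord4) ∞ M]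
      (g : MetricField Coord4 M) (I : Fin 3 → EndomorphismField M), IsHyperKahler g I →
      ∀ U : Set M, IsOpen U → (∃ p ∈ U, hyperKahlerJ g I p ≠ 0) →
      2 < isometricEmbeddingClass g U) :=
  ⟨fun _ hU hne => two_lt_of_fubiniStudy hU hne,
    fun _ _ _ _ _ _ hU _ _ hm ha h => two_lt_of_kerr hm ha hU h,
    fun _ _ _ _ _ _ h _ hU hJ => two_lt_of_hyperKahler h hU hJ⟩
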